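/- **Setting.** Contexts live in $\mathbb{R}^D$, $D\ge 1$, and have a density $f_X$ with compact support $\mathcal X$. There are $K$ arms; arm $i$ has a joint density $f_i(r,x)$ of (reward, context) on $[0,1]\times\mathcal X$ with context marginal $f_X$, and $f_i(r\mid X=x)=f_i(r,x)/f_X(x)$. A *mode* of a function on $[0,1]$ is a strict local maximum relative to $[0,1]$; its *$p$-mode* is the smallest of its $p$ highest modes (of all its modes if there are fewer than $p$), so the $1$-mode is the highest mode, called *the* mode. Write $\theta^p_i(x)$ for the $p$-mode of $f_i(\cdot\mid X=x)$. **Assumptions.** There are constants $0<\alpha\le 1$, $C_\alpha$, $\check C,\hat C,r_M,\lambda,c_0,\rho_0>0$ and $F$ such that for all $i$, all $x,x'\in\mathcal X$ and $r,r'\in[0,1]$: (a) $|f_i(r,x)-f_i(r',x')|\le C_\alpha|(r,x)-(r',x')|^\alpha$; (b) the local maxima of $f_i(\cdot\mid X=x)$ are points, i.e. every connected component of a level set around which no larger values are taken is a single mode; (c) $\check C(r_0-r)^2\le|f_i(r_0,x)-f_i(r,x)|\le\hat C(r_0-r)^2$ and $f_i(r,x)\ge\lambda$ whenever $r_0$ is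 a mode of $f_i(\cdot\mid X=x)$ and $|r-r_0|\le r_M$; (d) $f_i\le F$; (e) the support has no cusps: $\mathrm{vol}(\mathcal X\cap B(x,\rho))\ge c_0\rho^D$ for $0<\rho\le\rho_0$. "Parameters" below means $D$ and these constants. Put $q=(4\alpha+2D+2)/\alpha$. **Estimators.** For a sample $S$ of $N$ (reward, context) pairs let $k=\lceil N^{2\alpha/(2\alpha+D+1)}\rceil$, let $r_k(r,x)$ be the Euclidean distance of $(r,x)$ to its $k$-th nearest neighbour in $S$, let $\hat f(r,x)=k/(v_{D+1}N\,r_k(r,x)^{D+1})$ with $v_{D+1}$ the volume of the unit ball of $\mathbb R^{D+1}$, and let $R=\{1/m,\dots,(m-1)/m\}$ with $m=m(N)\ge k^2$ arbitrary. The *conditional mode estimator* at $x$ returns a minimizer of $r_k(\cdot,x)$ over $R$. The *conditional $p$-mode estimator* with confidence parameter $\delta'$ and slack $\varepsilon=\varepsilon(N)$ runs through $R$ in decreasing order of $\hat f(\cdot,x)$. For the current point $r$ with $\lambda'=\hat f(r,x)$ it takes the connected component $A$ of $r$ in the graph $G(\lambda'-\beta_k\lambda'-\varepsilon)$, where $\beta_k=100\log(1/\delta')\sqrt{\log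 N}/\sqrt k$ and $G(\gamma)$ has vertices $\{r\in R:\hat f(r,x)>\gamma\}$ and edges $|r_1-r_2|\le\min\{r_k(r_1,x),r_k(r_2,x)\}$. It collects $A$ if $A$ is disjoint from all sets collected before, and stops when $p$ sets are collected. It returns $\min_A\operatorname{argmax}_{A}\hat f(\cdot,x)$ over the collected sets $A$. **Uniform sampling.** In each of $n$ rounds a fresh context is drawn from $f_X$ and an arm pulled least often so far is pulled; ties are broken arbitrarily on the basis of the past and of external randomness (so that the draws of the round are independent of the choice). The pair (reward, context) of a pulled arm $i$ has density $f_i$. Let $S_i$ be the sample of arm $i$ after $n$ rounds. The policy $\hat\pi(x)$ is an arm with the largest estimate computed from $S_i$ at $x$, $i=1,\dots,K$. All ties in the estimators and in $\hat\pi$ are broken arbitrarily. **Theorem.** (1) ($\Delta$-optimality.) Let $\eta>0$. There are $C>0$ and $a\in\mathbb N$, depending only on the parameters and $\eta$, such that the following holds for all $K$, all environments that satisfy the assumptions and in which, for all $i$ and $x\in\mathcal X$, the joint density $f_i(\cdot,x)$ at the highest mode exceeds its value at every other mode, if any, by more than $\eta$ (no condition if the conditional densities are unimodal), and all $0<\delta<1$,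 $\Delta>0$. If $$n\ \ge\ C\,K\,\big[(1+\log(K/\delta))(1+|\log\Delta|)\big]^a\,\Delta^{-(4\alpha+2D+2)/\alpha},$$ that is, $n\ge\widetilde\Omega(\Delta^{-(4\alpha+2D+2)/\alpha})$, then uniform sampling with the conditional mode estimator satisfies $$\mathbb P\big(\forall x\in\mathcal X:\ \theta^1_{\hat\pi(x)}(x)\ge\max_j\theta^1_j(x)-\Delta\big)>1-\delta .$$ (2) (Exact recovery.) Let $p\ge1$ and let $\varepsilon(N)>0$ satisfy $\varepsilon(N)\to0$ and $\varepsilon(N)=\Omega(1/\log N)$; if $p\ge 2$ and $\alpha\le 1/4$, assume moreover $m(N)\ge N$. Let $P(\Delta)$ be the set of $x\in\mathcal X$ for which the $p$-mode of one arm exceeds that of every other arm by more than $\Delta$, and $Q(\Delta)$ the set of $x\in\mathcal X$ such that, for every $i$, the joint density $f_i(\cdot,x)$ at the $p$-th highest mode exceeds that at the $(p+1)$-st highest mode by more than $\Delta$ (no condition if there are at most $p$ modes). For all $K$ and $0<\delta<1$ there is $N_0$, depending only on the parameters, $p$, $\varepsilon(\cdot)$, $K$ and $\delta$, such that for all environments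 that satisfy the assumptions and all $\Delta>0$: if $$n>\max\Big\{K\,(\log(1/\delta)+\log K)^{q}\,(\Delta/3)^{-q}\,\big(\log((\Delta/3)^{-q})\big)^{q},\ K N_0\Big\},$$ then uniform sampling with the conditional $p$-mode estimator with confidence parameter $\delta'=\delta/K$ satisfies $$\mathbb P\big(\hat\pi(x)=\pi(x)\ \ \forall x\in P(\Delta)\cap Q(\Delta)\big)>1-\delta ,$$ where $\pi(x)$ is an arm with the largest $p$-mode at $x$. -/

import Mathlib

open Set MeasureTheory ProbabilityTheory Filter Topology

noncomputable section

namespace ModalBandit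

/-! ### Modes of a function on `[0, 1]` -/

/-- `r` is a mode of `g` on `[0, 1]`: a strict local maximum relative to `[0, 1]`. -/
def IsMode (g : ℝ → ℝ) (r : ℝ) : Prop :=
  r ∈ Icc (0 : ℝ) 1 ∧
    ∃ η > 0, ∀ s ∈ Icc (0 : ℝ) 1, |r - s| ≤ η → s ≠ r → g s < g r

/-- The set of modes of `g` on `[0, 1]`. -/
def modes (g : ℝ → ℝ) : Set ℝ := {r | IsMode g r}

/-- The modes of `g` that are among the `p` highest ones: fewer than `p` modes are higher. -/
def topModes (g : ℝ → ℝ) (p : ℕ) : Set ℝ :=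
  {r | r ∈ modes g ∧ {s | s ∈ modes g ∧ g r < g s}.encard < (p : ℕ∞)}

/-- The `p`-mode: the smallest among the `p` highest modes (among all modes, if there are fewer
than `p`). For `p = 1` this is the highest mode. -/
def pMode (g : ℝ → ℝ) (p : ℕ) : ℝ := sInf (topModes g p)

/-- A local maximum of `g` on `[0, 1]`, as a region: a connected component `M` of a level set of
`g` such that no larger values are taken around `M`. -/
def IsLocalMaxRegion (g : ℝ → ℝ) (M : Set ℝ) : Prop :=
  ∃ r ∈ Icc (0 : ℝ) 1, M = connectedComponentIn {s | s ∈ Icc (0 : ℝ) 1 ∧ g s = g r} r ∧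
    ∃ U : Set ℝ, IsOpen U ∧ M ⊆ U ∧ ∀ s ∈ U ∩ Icc (0 : ℝ) 1, g s ≤ g r

/-! ### The environment -/

/-- Contexts live in Euclidean `D`-space. -/
abbrev Ctx (D : ℕ) : Type := EuclideanSpace ℝ (Fin D)

/-- Euclidean distance of the concatenated vectors `(r, x)` and `(r', x')` in dimension `D + 1`. -/
def jointDist {D : ℕ} (z w : ℝ × Ctx D) : ℝ :=
  Real.sqrt ((z.1 - w.1) ^ 2 + dist z.2 w.2 ^ 2)

/-- A contextual modal bandit with `K` arms: a context density `fX` with compact support `𝒳`, and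
for each arm a joint density `f i r x` of (reward, context) on `[0, 1] × 𝒳` whose context marginal
is `fX`. -/
structure Environment (D K : ℕ) where
  fX : Ctx D → ℝ
  f : Fin K → ℝ → Ctx D → ℝ
  fX_nonneg : ∀ x, 0 ≤ fX x
  fX_measurable : Measurable fX
  fX_integral : ∫ x, fX x = 1
  fX_support : HasCompactSupport fX
  f_nonneg : ∀ i r x, 0 ≤ f i r x
  f_measurable : ∀ i, Measurable (fun z : ℝ × Ctx D => f i z.1 z.2)
  f_reward : ∀ i r x, r ∉ Icc (0 : ℝ) 1 → f i r x = 0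
  f_context : ∀ i r x, x ∉ tsupport fX → f i r x = 0
  f_marginal : ∀ i x, ∫ r, f i r x = fX x

namespace Environment

variable {D K : ℕ}

/-- The support of the context density. -/
def 𝒳 (B : Environment D K) : Set (Ctx D) := tsupport B.fX

/-- The law of (reward, context) for arm `i`. -/
def law (B : Environment D K) (i : Fin K) : Measure (ℝ × Ctx D) :=
  volume.withDensity (fun z => ENNReal.ofReal (B.f i z.1 z.2))

/-- The conditional reward density `f_i(r | X = x)`. -/
def cond (B : Environment D K) (i : Fin K) (x : Ctx D) : ℝ → ℝ :=
  fun r => B.f i r x / B.fX x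

/-- The `p`-mode of the conditional reward density of arm `i` in context `x`. -/
def value (B : Environment D K) (p : ℕ) (i : Fin K) (x : Ctx D) : ℝ :=
  pMode (B.cond i x) p

/-- Arm `i` is `Δ`-optimal in context `x`. -/
def IsDeltaOptimal (B : Environment D K) (p : ℕ) (Δ : ℝ) (i : Fin K) (x : Ctx D) : Prop :=
  ∀ j, B.value p j x - Δ ≤ B.value p i x

/-- `π` is an optimal policy: it selects an arm of largest `p`-mode in each context. -/
def IsOptimalPolicy (B : Environment D K) (p : ℕ) (π : Ctx D → Fin K) : Prop :=
  ∀ x ∈ B.𝒳, ∀ j, B.value p j x ≤ B.value p (π x) x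

/-- The contexts where the `p`-mode of the best arm exceeds that of every other arm by more
than `Δ`. -/
def gapRegion (B : Environment D K) (p : ℕ) (Δ : ℝ) : Set (Ctx D) :=
  {x | x ∈ B.𝒳 ∧ ∃ i, ∀ j, j ≠ i → Δ < B.value p i x - B.value p j x}

/-- The contexts where, for every arm, the density at the `p`-th highest mode exceeds the density
at the `(p+1)`-st highest mode by more than `Δ` (no condition if there are at most `p` modes).
Here `T` is the set of the `p` highest modes. -/
def salientRegion (B : Environment D K) (p : ℕ) (Δ : ℝ) : Set (Ctx D) :=
  {x | x ∈ B.𝒳 ∧ ∀ i, ∃ T ⊆ modes (B.cond i x),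
    T.encard = min (p : ℕ∞) (modes (B.cond i x)).encard ∧
    ∀ j ∈ T, ∀ j' ∈ modes (B.cond i x) \ T, Δ < B.f i j x - B.f i j' x}

end Environment

/-- The numerical constants in the regularity assumptions on an environment. -/
structure Params where
  α : ℝ
  Cα : ℝ
  cLow : ℝ
  cUp : ℝ
  rM : ℝ
  lam : ℝ
  fMax : ℝ
  c₀ : ℝ
  ρ₀ : ℝ
  α_pos : 0 < α
  α_le : α ≤ 1
  cLow_pos : 0 < cLow
  cUp_pos : 0 < cUp
  rM_pos : 0 < rM
  lam_pos : 0 < lam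
  c₀_pos : 0 < c₀
  ρ₀_pos : 0 < ρ₀

/-- The regularity assumptions with constants `θ`. -/
structure Regular {D K : ℕ} (B : Environment D K) (θ : Params) : Prop where
  /-- joint Hölder continuity on `[0, 1] × 𝒳` -/
  holder : ∀ i, ∀ x ∈ B.𝒳, ∀ x' ∈ B.𝒳, ∀ r ∈ Icc (0 : ℝ) 1, ∀ r' ∈ Icc (0 : ℝ) 1,
    |B.f i r x - B.f i r' x'| ≤ θ.Cα * jointDist (r, x) (r', x') ^ θ.α
  /-- the local maxima of the conditional densities are points (the modes) -/
  localMax : ∀ i, ∀ x ∈ B.𝒳, ∀ M, IsLocalMaxRegion (B.cond i x) M →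
    ∃ r₀, M = {r₀} ∧ IsMode (B.cond i x) r₀
  /-- quadratic decay around each mode -/
  quadratic : ∀ i, ∀ x ∈ B.𝒳, ∀ r₀ ∈ modes (B.cond i x), ∀ r ∈ Icc (0 : ℝ) 1, |r₀ - r| ≤ θ.rM →
    θ.cLow * (r₀ - r) ^ 2 ≤ |B.f i r₀ x - B.f i r x| ∧
      |B.f i r₀ x - B.f i r x| ≤ θ.cUp * (r₀ - r) ^ 2
  /-- the joint density is bounded below around the modes -/
  lower : ∀ i, ∀ x ∈ B.𝒳, ∀ r₀ ∈ modes (B.cond i x), ∀ r ∈ Icc (0 : ℝ) 1, |r₀ - r| ≤ θ.rM →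
    θ.lam ≤ B.f i r x
  /-- the sup norm of the joint densities -/
  bounded : ∀ i r x, B.f i r x ≤ θ.fMax
  /-- the context support has no cusps -/
  thick : ∀ x ∈ B.𝒳, ∀ ρ, 0 < ρ → ρ ≤ θ.ρ₀ →
    ENNReal.ofReal (θ.c₀ * ρ ^ D) ≤ volume (B.𝒳 ∩ Metric.closedBall x ρ)

/-! ### Conditional mode estimation -/

section Estimation

variable {D : ℕ}

open scoped Classical in
/-- Distance from `(r, x)` to its `k`-th nearest neighbour in the sample `S`. -/
def knnRadius (S : Multiset (ℝ × Ctx D)) (k : ℕ) (x : Ctx D) (r : ℝ) : ℝ :=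
  sInf {ρ | 0 ≤ ρ ∧ k ≤ (S.filter (fun z => jointDist z (r, x) ≤ ρ)).card}

/-- The `k`-NN density estimate at `(r, x)`; the first factor of the denominator is the volume of
the `(D+1)`-dimensional unit ball. -/
def knnDensity (S : Multiset (ℝ × Ctx D)) (k : ℕ) (x : Ctx D) (r : ℝ) : ℝ :=
  k / ((volume (Metric.ball (0 : EuclideanSpace ℝ (Fin (D + 1))) 1)).toReal * S.card *
    knnRadius S k x r ^ (D + 1))

/-- The grid `1/m, 2/m, …, (m-1)/m`. -/
def grid (m : ℕ) : List ℝ := (List.range (m - 1)).map (fun j => ((j : ℝ) + 1) / m)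

/-- `r` is an output of the conditional mode estimator: a grid point with smallest `k`-NN radius
(ties are broken arbitrarily). -/
def IsModeEstimate (S : Multiset (ℝ × Ctx D)) (k m : ℕ) (x : Ctx D) (r : ℝ) : Prop :=
  r ∈ grid m ∧ ∀ s ∈ grid m, knnRadius S k x r ≤ knnRadius S k x s

/-- Vertices of the graph `G(γ)`. -/
def levelVertices (S : Multiset (ℝ × Ctx D)) (k m : ℕ) (x : Ctx D) (γ : ℝ) : Set ℝ :=
  {r | r ∈ grid m ∧ γ < knnDensity S k x r}

/-- The graph `G(γ)` (grid points that are not vertices of it are isolated here). -/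
def levelGraph (S : Multiset (ℝ × Ctx D)) (k m : ℕ) (x : Ctx D) (γ : ℝ) : SimpleGraph ℝ where
  Adj a b := a ≠ b ∧ a ∈ levelVertices S k m x γ ∧ b ∈ levelVertices S k m x γ ∧
    |a - b| ≤ min (knnRadius S k x a) (knnRadius S k x b)
  symm := ⟨fun a b h => ⟨h.1.symm, h.2.2.1, h.2.1, by
    rw [abs_sub_comm, min_comm]; exact h.2.2.2⟩⟩
  loopless := ⟨fun _ h => h.1 rfl⟩

/-- The connected component of `a` in `G(γ)`. -/
def levelComponent (S : Multiset (ℝ × Ctx D)) (k m : ℕ) (x : Ctx D) (γ : ℝ) (a : ℝ) : Set ℝ :=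
  {b | b ∈ levelVertices S k m x γ ∧ (levelGraph S k m x γ).Reachable a b}

open scoped Classical in
/-- The main loop: run through a list of points, add the set `C a` of the current point `a` if it
is disjoint from all the sets collected so far, and stop once `p` sets are collected. -/
def collect (C : ℝ → Set ℝ) (p : ℕ) : List ℝ → List (Set ℝ) → List (Set ℝ)
  | [], acc => acc
  | a :: l, acc =>
    let acc' := if ∀ A ∈ acc, Disjoint (C a) A then C a :: acc else acc
    if acc'.length = p then acc' else collect C p l acc'

/-- The width `β_k = 100 log(1/δ) √(log n) / √k`. -/
def betaWidth (δ : ℝ) (n k : ℕ) : ℝ :=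
  100 * Real.log (1 / δ) * Real.sqrt (Real.log n) / Real.sqrt k

/-- `r` is an output of the conditional `p`-mode estimator with confidence parameter `δ` and
slack `ε`. The list `L` is the grid sorted by decreasing density estimate, `s` selects the argmax
in each collected set (ties are broken arbitrarily). -/
def IsPModeEstimate (S : Multiset (ℝ × Ctx D)) (p k m : ℕ) (δ ε : ℝ) (x : Ctx D) (r : ℝ) : Prop :=
  ∃ L : List ℝ, L.Perm (grid m) ∧
    L.Pairwise (fun a b => knnDensity S k x b ≤ knnDensity S k x a) ∧
    ∃ s : Set ℝ → ℝ,
      let 𝒜 : List (Set ℝ) := collect (fun a =>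
        levelComponent S k m x
          (knnDensity S k x a - betaWidth δ S.card k * knnDensity S k x a - ε) a) p L []
      (∀ A ∈ 𝒜, s A ∈ A ∧ ∀ b ∈ A, knnDensity S k x b ≤ knnDensity S k x (s A)) ∧
      IsLeast {t | ∃ A ∈ 𝒜, s A = t} r

/-- The number of neighbours used with a sample of size `n`: `n^{2α/(2α+D+1)}`, rounded up. -/
def kSetting (α : ℝ) (D n : ℕ) : ℕ := ⌈(n : ℝ) ^ (2 * α / (2 * α + D + 1))⌉₊

end Estimation

/-! ### Uniform sampling -/

section Sampling

variable {D K : ℕ} {Ω : Type*}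

/-- The number of pulls of arm `i` in the first `t` rounds. -/
def pulls (I : ℕ → Ω → Fin K) (i : Fin K) (t : ℕ) (ω : Ω) : ℕ :=
  ((Finset.range t).filter (fun s => I s ω = i)).card

/-- The sample (with multiplicity) of (reward, context) pairs observed from arm `i` in the first
`t` rounds; `Y i s` is the reward that arm `i` yields if it is pulled in round `s`. -/
def armSample (X : ℕ → Ω → Ctx D) (Y : Fin K → ℕ → Ω → ℝ) (I : ℕ → Ω → Fin K) (i : Fin K)
    (t : ℕ) (ω : Ω) : Multiset (ℝ × Ctx D) :=
  ((Finset.range t).filter (fun s => I s ω = i)).val.map (fun s => (Y i s ω, X s ω))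

/-- `n` rounds of uniform sampling in the environment `B`. In each round a fresh context and fresh
rewards are drawn, and a least-pulled arm is pulled. Ties are broken by any rule that may use the
past and external randomness, collected in a filtration of which the draws of a round are
independent. -/
structure IsUniformSampling [mΩ : MeasurableSpace Ω] (P : Measure Ω) (B : Environment D K) (n : ℕ)
    (X : ℕ → Ω → Ctx D) (Y : Fin K → ℕ → Ω → ℝ) (I : ℕ → Ω → Fin K) : Prop where
  X_measurable : ∀ t, Measurable (X t)
  Y_measurable : ∀ i t, Measurable (Y i t)
  /-- the (reward, context) pair of arm `i` has joint density `f_i` -/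
  law_eq : ∀ i t, P.map (fun ω => (Y i t ω, X t ω)) = B.law i
  nonanticipating : ∃ ℱ : Filtration ℕ mΩ,
    (∀ t, Measurable[ℱ (t + 1)] (X t)) ∧
    (∀ i t, Measurable[ℱ (t + 1)] (Y i t)) ∧
    (∀ t, Measurable[ℱ t] (I t)) ∧
    (∀ i t, Indep (MeasurableSpace.comap (fun ω => (Y i t ω, X t ω)) inferInstance) (ℱ t) P)
  /-- a least-pulled arm is pulled -/
  least_pulled : ∀ t < n, ∀ ω j, pulls I (I t ω) t ω ≤ pulls I j t ω

/-- `πhat` selects, in each context of `𝒳`, an arm with the largest estimated value (ties are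
broken arbitrarily). -/
def IsGreedyPolicy (𝒳 : Set (Ctx D)) (est : Fin K → Ω → Ctx D → ℝ)
    (πhat : Ω → Ctx D → Fin K) : Prop :=
  ∀ ω, ∀ x ∈ 𝒳, ∀ j, est j ω x ≤ est (πhat ω x) ω x

end Sampling

/-- The exponent `(4α + 2D + 2)/α`. -/
def rateExp (α : ℝ) (D : ℕ) : ℝ := (4 * α + 2 * D + 2) / α

end ModalBandit

end

/-!
Both parts follow from one deterministic statement about a single sample and one probabilistic
statement that makes it applicable to all arms at once.

*Good samples.* A sample is good (`GoodSample`) if the number of its points in each Euclidean ball of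
`ℝ × ℝ^D` centred in `[0, 1] × 𝒳` agrees with its expectation up to a small relative error, plus
that error times the number `k` of neighbours. The sample of an arm is not i.i.d. given its size,
since the arm is chosen adaptively. The exponential of the count in a fixed ball is nevertheless
controlled by a supermartingale argument, and the number of pulls of every arm is `n / K` or
`n / K + 1` (`pulls_bounds`). A union bound over a net of `𝒳` and over grids of rewards and radii
gives all balls; the net is finite, of polynomial size, because the balls around the modes over
separated contexts are disjoint and have a mass bounded below. The relative error that holds with
probability more than `1 - δ` is of order `N^(-α/(2α+D+1)) (1 + log (K/δ) + log N)` with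
`N = n / K` (`exists_good_event`, `rateError`).

*Radii and densities.* On a good sample, `k`-NN radii compare like densities: a radius that is not
larger than another one belongs to a density that is not much smaller
(`Regular.le_of_knnRadius_le`), and conversely (`Regular.knnRadius_le_of_le`). Balls that stick out of
`[0, 1] × 𝒳` have less volume inside. The missing volume depends on the context and on the distances
of the reward to the end points of `[0, 1]` only, and each comparison is used only in the direction
in which a loss of volume at the less interior of the two points does no harm.

*One mode.* A grid point near the highest mode competes with the estimate, so the density at the
estimate is almost the maximum. All points of almost maximal density are near the highest mode, by
the density margin, the pointlike local maxima (`exists_mode_above`) and the quadratic decay. An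
error `E` in density becomes an error of order `√E` in the reward, and this is where the rate
`Δ^(-2 (2α+D+1)/α)` comes from.

*Several modes.* Each mode gets a representative on the grid. The region that the estimator considers
at a grid point contains the representative of some mode: the superlevel set of the density contains
a path upwards to a mode, and since the slack `ε` is much larger than the comparison error, the grid
points along it are vertices of the graph and consecutive ones are adjacent
(`PModeSetup.exists_anchor_mem`). The region at a point whose estimated density is at least that of
the representative of a mode in it stays close to that mode, because it cannot cross the dip of the
density around the mode. Hence the collected regions correspond to the `p` highest modes
(`collect_spec`), and the argmax in each is close to its mode (`PModeSetup.pModeEstimate_close`).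

*Rates.* For `Δ`-optimality the required sample size makes the error at most a small multiple of
`Δ ^ 2` (`rateError_le_of_size`). For exact recovery the same holds once `N` exceeds a threshold that
does not depend on `Δ` (`exists_rateError_le_of_gap_size`); the other requirements of the `p`-mode
estimator only involve `N`, and hold eventually since `ε` tends to `0` not faster than `1 / log N`
(`exists_pModeSetup`).
-/

noncomputable section

namespace ModalBandit

/-! ### Functions with pointlike local maxima -/

/-- The shape that the regularity assumptions impose on a joint density `g = f_i(·, x)` in a fixed
context: continuity, pointlike local maxima, and two-sided quadratic behaviour around modes, with
the sign resolved. -/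
structure ModalShape (g : ℝ → ℝ) (cl cu rM lam : ℝ) : Prop where
  cont : ContinuousOn g (Icc 0 1)
  localMax : ∀ M, IsLocalMaxRegion g M → ∃ r₀, M = {r₀} ∧ IsMode g r₀
  quad_le : ∀ t ∈ modes g, ∀ r ∈ Icc (0 : ℝ) 1, |t - r| ≤ rM → g r ≤ g t - cl * (t - r) ^ 2
  le_quad : ∀ t ∈ modes g, ∀ r ∈ Icc (0 : ℝ) 1, |t - r| ≤ rM → g t - cu * (t - r) ^ 2 ≤ g r
  lower : ∀ t ∈ modes g, lam ≤ g t

/-- Every point of `[0, 1]` is joined to a mode that is at least as high, by a segment on which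
`g` drops by less than `e`. The mode is the maximum over the component of the point in the
superlevel set `{g > g r - e}`. -/
theorem exists_mode_above {g : ℝ → ℝ} (hg : ContinuousOn g (Icc 0 1))
    (hloc : ∀ M, IsLocalMaxRegion g M → ∃ r₀, M = {r₀} ∧ IsMode g r₀)
    {r e : ℝ} (hr : r ∈ Icc (0 : ℝ) 1) (he : 0 < e) :
    ∃ t ∈ modes g, g r ≤ g t ∧ ∀ s ∈ uIcc r t, g r - e < g s := by
  set V : Set ℝ := {s | s ∈ Icc (0 : ℝ) 1 ∧ g r - e < g s} with hV
  set J := connectedComponentIn V r with hJ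
  have hrV : r ∈ V := ⟨hr, by linarith⟩
  have hrJ : r ∈ J := mem_connectedComponentIn hrV
  have hJV : J ⊆ V := connectedComponentIn_subset V r
  have hJI : J ⊆ Icc 0 1 := fun s hs => (hJV hs).1
  have hJpre : IsPreconnected J := isPreconnected_connectedComponentIn
  have hcl : closure J ⊆ Icc 0 1 := closure_minimal hJI isClosed_Icc
  obtain ⟨z, hzJ, hz⟩ := (isCompact_Icc.of_isClosed_subset isClosed_closure hcl).exists_isMaxOn
    ⟨r, subset_closure hrJ⟩ (hg.mono hcl)
  have hrz : g r ≤ g z := hz (subset_closure hrJ)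
  have hzV : z ∈ V := ⟨hcl hzJ, by linarith⟩
  have hzJ' : z ∈ J := by
    have h1 : IsPreconnected (insert z J) :=
      hJpre.subset_closure (subset_insert z J) (insert_subset hzJ subset_closure)
    exact h1.subset_connectedComponentIn (mem_insert_of_mem z hrJ)
      (insert_subset hzV hJV) (mem_insert z J)
  -- `J` is open relative to `[0, 1]`
  have hopen : ∀ y ∈ J, ∃ δ > 0, Metric.ball y δ ∩ Icc 0 1 ⊆ J := by
    intro y hy
    have h1 : ∀ᶠ s in 𝓝[Icc 0 1] y, g r - e < g s :=
      (hg y (hJI hy)).eventually (lt_mem_nhds (hJV hy).2)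
    obtain ⟨δ, hδ, h2⟩ := Metric.mem_nhdsWithin_iff.1 h1
    refine ⟨δ, hδ, ?_⟩
    have h3 : IsPreconnected (Metric.ball y δ ∩ Icc (0 : ℝ) 1) :=
      ((convex_ball y δ).inter (convex_Icc 0 1)).isPreconnected
    have h4 := h3.subset_connectedComponentIn (F := V) ⟨Metric.mem_ball_self hδ, hJI hy⟩
      (fun s hs => ⟨hs.2, h2 hs⟩)
    rwa [← connectedComponentIn_eq hy] at h4
  choose! δ hδ hball using hopen
  set M := connectedComponentIn {s | s ∈ Icc (0 : ℝ) 1 ∧ g s = g z} z with hM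
  have hMJ : M ⊆ J := by
    have := (isPreconnected_connectedComponentIn
      (F := {s | s ∈ Icc (0 : ℝ) 1 ∧ g s = g z}) (x := z)).subset_connectedComponentIn (F := V)
      (mem_connectedComponentIn ⟨hzV.1, rfl⟩)
      (fun s hs => by
        have h := connectedComponentIn_subset _ _ hs
        exact ⟨h.1, by rw [h.2]; exact hzV.2⟩)
    rwa [← connectedComponentIn_eq hzJ'] at this
  obtain ⟨r₀, hMr, hr₀⟩ := hloc M ⟨z, hzV.1, rfl, ⋃ y ∈ J, Metric.ball y (δ y),
    isOpen_biUnion fun _ _ => Metric.isOpen_ball,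
    fun s hs => mem_biUnion (hMJ hs) (Metric.mem_ball_self (hδ s (hMJ hs))), by
      rintro s ⟨hs, hsI⟩
      obtain ⟨y, hy, hsy⟩ := mem_iUnion₂.1 hs
      exact hz (subset_closure (hball y hy ⟨hsy, hsI⟩))⟩
  have hzr : z = r₀ := by
    have : z ∈ M := mem_connectedComponentIn ⟨hzV.1, rfl⟩
    rw [hMr] at this
    exact this
  refine ⟨z, hzr ▸ hr₀, hrz, fun s hs => (hJV ?_).2⟩
  exact hJpre.ordConnected.uIcc_subset hrJ hzJ' hs

namespace ModalShape

variable {g : ℝ → ℝ} {cl cu rM lam : ℝ}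

theorem exists_mode (h : ModalShape g cl cu rM lam) : (modes g).Nonempty := by
  obtain ⟨t, ht, -⟩ := exists_mode_above h.cont h.localMax (r := 0) (by simp) one_pos
  exact ⟨t, ht⟩

theorem lt_abs_sub (h : ModalShape g cl cu rM lam) (hcl : 0 < cl) {t t' : ℝ}
    (ht : t ∈ modes g) (ht' : t' ∈ modes g) (hne : t ≠ t') : rM < |t - t'| := by
  by_contra! hle
  have h1 := h.quad_le t ht t' ht'.1 hle
  have h2 := h.quad_le t' ht' t ht.1 (by rwa [abs_sub_comm])
  have h3 : 0 < cl * (t - t') ^ 2 := by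
    have : t - t' ≠ 0 := sub_ne_zero.2 hne
    positivity
  have h4 : cl * (t' - t) ^ 2 = cl * (t - t') ^ 2 := by ring
  linarith

/-- A point whose value is within `E` of the value at a mode `t` that exceeds all other modes by
more than `E` lies near `t`: otherwise the segment to the mode above it would cross the
quadratic dip at distance `rM` from `t`. -/
theorem quad_sub_le (h : ModalShape g cl cu rM lam) (hrM : 0 < rM) {t a E : ℝ}
    (ht : t ∈ modes g) (htop : ∀ t' ∈ modes g, t' ≠ t → g t' < g t - E)
    (hE : E < cl * rM ^ 2) (ha : a ∈ Icc (0 : ℝ) 1) (hga : g t - E ≤ g a) :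
    cl * (t - a) ^ 2 ≤ E := by
  have hnear : |t - a| ≤ rM := by
    by_contra! hfar
    obtain ⟨t', ht', hle, hseg⟩ := exists_mode_above h.cont h.localMax (r := a)
      (e := cl * rM ^ 2 - E) ha (by linarith)
    have htt : t' = t := by
      by_contra hne
      have := htop t' ht' hne
      linarith
    subst htt
    rcases le_total a t' with hat | hat
    · rw [abs_of_nonneg (by linarith)] at hfar
      have hs : t' - rM ∈ uIcc a t' := by
        rw [uIcc_of_le hat]; constructor <;> linarith
      have h1 := hseg _ hs
      have h2 := h.quad_le t' ht (t' - rM) ⟨by linarith [ha.1], by linarith [ht.1.2]⟩ (by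
        rw [abs_of_nonneg (by linarith)]; linarith)
      have : (t' - (t' - rM)) ^ 2 = rM ^ 2 := by ring
      rw [this] at h2
      linarith
    · rw [abs_of_nonpos (by linarith)] at hfar
      have hs : t' + rM ∈ uIcc a t' := by
        rw [uIcc_of_ge hat]; constructor <;> linarith
      have h1 := hseg _ hs
      have h2 := h.quad_le t' ht (t' + rM) ⟨by linarith [ht.1.1], by linarith [ha.2]⟩ (by
        rw [abs_of_nonpos (by linarith)]; linarith)
      have : (t' - (t' + rM)) ^ 2 = rM ^ 2 := by ring
      rw [this] at h2
      linarith
  have := h.quad_le t ht a ha hnear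
  linarith

end ModalShape

/-! ### The highest modes -/

theorem pMode_mem_Icc (g : ℝ → ℝ) (p : ℕ) : pMode g p ∈ Icc (0 : ℝ) 1 := by
  have hsub : topModes g p ⊆ Icc 0 1 := fun r hr => hr.1.1
  rcases (topModes g p).eq_empty_or_nonempty with h | h
  · simp [pMode, h]
  · exact ⟨le_csInf h fun b hb => (hsub hb).1,
      (csInf_le ⟨0, fun b hb => (hsub hb).1⟩ h.some_mem).trans (hsub h.some_mem).2⟩

/-- A set of `min p (number of modes)` modes that are strictly higher than all the other modes is
the set of the `p` highest modes. -/
theorem topModes_eq {g : ℝ → ℝ} {p : ℕ} {T : Set ℝ} (hT : T ⊆ modes g)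
    (hcard : T.encard = min (p : ℕ∞) (modes g).encard)
    (hgap : ∀ j ∈ T, ∀ j' ∈ modes g \ T, g j' < g j) : topModes g p = T := by
  have hTp : T.encard ≤ p := hcard.trans_le (min_le_left _ _)
  have hfin : T.Finite := Set.finite_of_encard_le_coe hTp
  ext r
  constructor
  · rintro ⟨hr, hlt⟩
    by_contra hrT
    have hsub : T ⊆ {s | s ∈ modes g ∧ g r < g s} := fun j hj => ⟨hT hj, hgap j hj r ⟨hr, hrT⟩⟩
    have h1 : T.encard < p := (Set.encard_le_encard hsub).trans_lt hlt
    have h2 : T.encard = (modes g).encard := by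
      rcases min_choice (p : ℕ∞) (modes g).encard with h | h
      · rw [h] at hcard; exact absurd hcard h1.ne
      · rw [h] at hcard; exact hcard
    exact hrT ((hfin.eq_of_subset_of_encard_le hT h2.ge) ▸ hr)
  · intro hr
    refine ⟨hT hr, ?_⟩
    have hsub : {s | s ∈ modes g ∧ g r < g s} ⊆ T \ {r} := by
      rintro s ⟨hs, hlt⟩
      refine ⟨?_, fun h => ?_⟩
      · by_contra hsT
        exact lt_asymm hlt (hgap r hr s ⟨hs, hsT⟩)
      · rw [mem_singleton_iff.1 h] at hlt
        exact lt_irrefl _ hlt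
    have h2 : (T \ {r}).encard < T.encard :=
      (hfin.subset sdiff_subset).encard_lt_encard (sdiff_singleton_ssubset.2 hr)
    exact ((Set.encard_le_encard hsub).trans_lt h2).trans_le hTp

theorem modes_div {g : ℝ → ℝ} {c : ℝ} (hc : 0 < c) : modes (fun r => g r / c) = modes g := by
  ext r
  simp only [modes, IsMode, mem_ofPred_eq, div_lt_div_iff_of_pos_right hc]

theorem topModes_div {g : ℝ → ℝ} {c : ℝ} (hc : 0 < c) (p : ℕ) :
    topModes (fun r => g r / c) p = topModes g p := by
  ext r
  simp only [topModes, modes_div hc, mem_ofPred_eq, div_lt_div_iff_of_pos_right hc]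

theorem isLocalMaxRegion_div {g : ℝ → ℝ} {c : ℝ} (hc : 0 < c) (M : Set ℝ) :
    IsLocalMaxRegion (fun r => g r / c) M ↔ IsLocalMaxRegion g M := by
  simp only [IsLocalMaxRegion, div_le_div_iff_of_pos_right hc, div_left_inj' hc.ne']

/-! ### Regular environments -/

namespace Regular

variable {D K : ℕ} {B : Environment D K} {θ : Params}

/-- If the context density vanished at a point of its support, the conditional densities would
be constant there, and `[0, 1]` would be a local maximum that is not a point. -/
theorem fX_pos (h : Regular B θ) (i : Fin K) {x : Ctx D} (hx : x ∈ B.𝒳) : 0 < B.fX x := by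
  refine lt_of_le_of_ne (B.fX_nonneg x) fun h0 => ?_
  have hcond : B.cond i x = fun _ => 0 := by
    funext r; simp [Environment.cond, ← h0]
  have hreg : IsLocalMaxRegion (B.cond i x) (Icc 0 1) := by
    refine ⟨0, by simp, ?_, univ, isOpen_univ, subset_univ _, ?_⟩
    · simp only [hcond, and_true]
      exact (isPreconnected_Icc.connectedComponentIn (by simp)).symm
    · rw [hcond]; simp
  obtain ⟨r₀, hr₀, -⟩ := h.localMax i x hx _ hreg
  have h1 : (0 : ℝ) ∈ ({r₀} : Set ℝ) := hr₀ ▸ by simp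
  have h2 : (1 : ℝ) ∈ ({r₀} : Set ℝ) := hr₀ ▸ by simp
  rw [mem_singleton_iff] at h1 h2
  exact zero_ne_one (h1.trans h2.symm)

theorem modes_cond (h : Regular B θ) (i : Fin K) {x : Ctx D} (hx : x ∈ B.𝒳) :
    modes (B.cond i x) = modes (fun r => B.f i r x) := modes_div (h.fX_pos i hx)

theorem value_eq (h : Regular B θ) (p : ℕ) (i : Fin K) {x : Ctx D} (hx : x ∈ B.𝒳) :
    B.value p i x = sInf (topModes (fun r => B.f i r x) p) := by
  unfold Environment.value pMode
  congr 1
  exact topModes_div (h.fX_pos i hx) p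

theorem nonempty_support (B : Environment D K) : B.𝒳.Nonempty := by
  by_contra hne
  rw [Set.not_nonempty_iff_eq_empty] at hne
  have : B.fX = 0 := tsupport_eq_empty_iff.1 hne
  have h1 := B.fX_integral
  simp [this] at h1

theorem Cα_nonneg (h : Regular B θ) (i : Fin K) : 0 ≤ θ.Cα := by
  obtain ⟨x, hx⟩ := nonempty_support B
  have h1 := h.holder i x hx x hx 0 (by simp) 1 (by simp)
  simp only [jointDist, dist_self] at h1
  norm_num at h1
  exact (abs_nonneg _).trans h1

/-- The quadratic bounds control absolute values only. The sign is resolved by the intermediate value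
theorem: a point near a mode with at least the value of the mode would yield another point at which
the density equals its value at the mode, against the lower quadratic bound. -/
theorem modalShape (h : Regular B θ) (i : Fin K) {x : Ctx D} (hx : x ∈ B.𝒳) :
    ModalShape (fun r => B.f i r x) θ.cLow θ.cUp θ.rM θ.lam := by
  have hcont : ContinuousOn (fun r => B.f i r x) (Icc 0 1) := by
    intro r hr
    have hbd : ∀ᶠ s in 𝓝[Icc 0 1] r, dist (B.f i s x) (B.f i r x) ≤ θ.Cα * |s - r| ^ θ.α := by
      filter_upwards [self_mem_nhdsWithin] with s hs
      have := h.holder i x hx x hx s hs r hr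
      simp only [jointDist, dist_self] at this
      norm_num [Real.sqrt_sq_eq_abs] at this
      exact this
    refine tendsto_iff_dist_tendsto_zero.2
      (squeeze_zero' (Eventually.of_forall fun _ => dist_nonneg) hbd ?_)
    have h1 : Continuous fun s : ℝ => θ.Cα * |s - r| ^ θ.α :=
      continuous_const.mul ((continuous_abs.comp (continuous_id.sub continuous_const)).rpow_const
        fun _ => Or.inr θ.α_pos.le)
    have h2 := (h1.tendsto r).mono_left (nhdsWithin_le_nhds (s := Icc 0 1))
    simpa [Real.zero_rpow θ.α_pos.ne'] using h2
  have hmodes := h.modes_cond i hx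
  have hlt : ∀ t ∈ modes (fun r => B.f i r x), ∀ r ∈ Icc (0 : ℝ) 1, |t - r| ≤ θ.rM → r ≠ t →
      B.f i r x < B.f i t x := by
    intro t ht r hr hrt hne
    by_contra! hge
    obtain ⟨η, hη, hmax⟩ := ht.2
    -- a point `s` strictly between `r` and `t`, close to `t`, where the density is lower
    set κ : ℝ := min 1 (η / |t - r|) with hκ
    have htr : 0 < |t - r| := abs_pos.2 (sub_ne_zero.2 hne.symm)
    have hκ0 : 0 < κ := lt_min one_pos (div_pos hη htr)
    have hκ1 : κ ≤ 1 := min_le_left _ _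
    set s := t + κ * (r - t) with hs
    have hst : |t - s| = κ * |t - r| := by
      rw [hs, show t - (t + κ * (r - t)) = κ * (t - r) by ring, abs_mul, abs_of_pos hκ0]
    have hsI : s ∈ Icc (0 : ℝ) 1 := by
      have := (convex_Icc (0 : ℝ) 1) ht.1 hr (sub_nonneg.2 hκ1) hκ0.le (by ring)
      convert this using 1
      simp only [smul_eq_mul]; ring
    have hsη : |t - s| ≤ η := by
      rw [hst]
      calc κ * |t - r| ≤ η / |t - r| * |t - r| := by gcongr; exact min_le_right _ _
        _ = η := div_mul_cancel₀ _ htr.ne'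
    have hsne : s ≠ t := by
      intro h0
      rw [h0, sub_self, abs_zero] at hst
      exact (mul_pos hκ0 htr).ne hst
    have hslt := hmax s hsI hsη hsne
    have hsub : uIcc s r ⊆ Icc 0 1 := ordConnected_Icc.uIcc_subset hsI hr
    obtain ⟨c, hc, hgc⟩ := intermediate_value_uIcc (hcont.mono hsub)
      (show B.f i t x ∈ uIcc (B.f i s x) (B.f i r x) from
        Icc_subset_uIcc ⟨hslt.le, hge⟩)
    have hcne : c ≠ t := by
      intro h0
      rw [h0, mem_uIcc] at hc
      rcases lt_or_gt_of_ne hne with hlt | hgt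
      · have : s ≤ t := by nlinarith
        have : s < t := lt_of_le_of_ne this hsne
        rcases hc with hc | hc <;> linarith
      · have : t ≤ s := by nlinarith
        have : t < s := lt_of_le_of_ne this hsne.symm
        rcases hc with hc | hc <;> linarith
    have hct : |t - c| ≤ θ.rM := by
      refine le_trans ?_ hrt
      have hmem : s ∈ uIcc t r := by
        rw [mem_uIcc]
        rcases le_total r t with h1 | h1
        · right; constructor <;> nlinarith
        · left; constructor <;> nlinarith
      have : c ∈ uIcc t r := (uIcc_subset_uIcc hmem right_mem_uIcc) hc
      have := abs_sub_left_of_mem_uIcc this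
      rwa [abs_sub_comm, abs_sub_comm r] at this
    have hq := (h.quadratic i x hx t (hmodes ▸ ht) c (hsub hc) hct).1
    simp only at hgc
    rw [hgc, sub_self, abs_zero] at hq
    have : 0 < (t - c) ^ 2 := by
      have : t - c ≠ 0 := sub_ne_zero.2 hcne.symm
      positivity
    nlinarith [θ.cLow_pos]
  have hle : ∀ t ∈ modes (fun r => B.f i r x), ∀ r ∈ Icc (0 : ℝ) 1, |t - r| ≤ θ.rM →
      B.f i r x ≤ B.f i t x := by
    intro t ht r hr hrt
    rcases eq_or_ne r t with rfl | hne
    · exact le_rfl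
    · exact (hlt t ht r hr hrt hne).le
  refine ⟨hcont, ?_, ?_, ?_, ?_⟩
  · intro M hM
    obtain ⟨r₀, h1, h2⟩ := h.localMax i x hx M ((isLocalMaxRegion_div (h.fX_pos i hx) M).2 hM)
    exact ⟨r₀, h1, by
      have h3 : r₀ ∈ modes (B.cond i x) := h2
      rw [hmodes] at h3
      exact h3⟩
  · intro t ht r hr hrt
    have := (h.quadratic i x hx t (hmodes ▸ ht) r hr hrt).1
    rw [abs_of_nonneg (sub_nonneg.2 (hle t ht r hr hrt))] at this
    linarith
  · intro t ht r hr hrt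
    have := (h.quadratic i x hx t (hmodes ▸ ht) r hr hrt).2
    rw [abs_of_nonneg (sub_nonneg.2 (hle t ht r hr hrt))] at this
    linarith
  · intro t ht
    exact h.lower i x hx t (hmodes ▸ ht) t ht.1 (by simpa using θ.rM_pos.le)

end Regular

end ModalBandit

namespace ModalBandit

/-! ### Volumes of Euclidean balls in the slab `[0, 1] × 𝒳` -/

variable {D K : ℕ}

/-- The closed ball of radius `ρ` around `z` for the Euclidean distance of `ℝ × ℝ^D` (the product
type itself carries the sup distance). -/
def jball (z : ℝ × Ctx D) (ρ : ℝ) : Set (ℝ × Ctx D) := {w | jointDist w z ≤ ρ}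

theorem mem_jball {z w : ℝ × Ctx D} {ρ : ℝ} (hρ : 0 ≤ ρ) :
    w ∈ jball z ρ ↔ (w.1 - z.1) ^ 2 + dist w.2 z.2 ^ 2 ≤ ρ ^ 2 := by
  rw [jball, mem_ofPred_eq, jointDist, Real.sqrt_le_left hρ]

theorem jointDist_nonneg (z w : ℝ × Ctx D) : 0 ≤ jointDist z w := Real.sqrt_nonneg _

theorem jointDist_eq_dist (z w : ℝ × Ctx D) :
    jointDist z w = dist (WithLp.toLp 2 z) (WithLp.toLp 2 w) := by
  rw [WithLp.prod_dist_eq_of_L2, jointDist, Real.dist_eq, sq_abs]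
  rfl

theorem jointDist_comm (z w : ℝ × Ctx D) : jointDist z w = jointDist w z := by
  rw [jointDist_eq_dist, jointDist_eq_dist, dist_comm]

theorem jointDist_triangle (z w v : ℝ × Ctx D) :
    jointDist z v ≤ jointDist z w + jointDist w v := by
  simp only [jointDist_eq_dist]
  exact dist_triangle _ _ _

theorem dist_snd_le_jointDist (z w : ℝ × Ctx D) : dist z.2 w.2 ≤ jointDist z w :=
  Real.le_sqrt_of_sq_le (by nlinarith [sq_nonneg (z.1 - w.1)])

theorem abs_sub_fst_le_jointDist (z w : ℝ × Ctx D) : |z.1 - w.1| ≤ jointDist z w :=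
  Real.le_sqrt_of_sq_le (by rw [sq_abs]; nlinarith [sq_nonneg (dist z.2 w.2)])

theorem jointDist_le_add (z w : ℝ × Ctx D) : jointDist z w ≤ |z.1 - w.1| + dist z.2 w.2 := by
  rw [jointDist]
  refine Real.sqrt_le_iff.2 ⟨by positivity, ?_⟩
  have h1 := abs_nonneg (z.1 - w.1)
  have h2 : 0 ≤ dist z.2 w.2 := dist_nonneg
  rw [← sq_abs (z.1 - w.1)]
  nlinarith

theorem continuous_jointDist (z : ℝ × Ctx D) : Continuous fun w => jointDist w z := by
  unfold jointDist
  fun_prop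

theorem measurableSet_jball (z : ℝ × Ctx D) (ρ : ℝ) : MeasurableSet (jball z ρ) :=
  (isClosed_le (continuous_jointDist z) continuous_const).measurableSet

theorem jball_mono (z : ℝ × Ctx D) {ρ ρ' : ℝ} (h : ρ ≤ ρ') : jball z ρ ⊆ jball z ρ' :=
  fun _ hw => le_trans hw h

/-- The volume of the unit ball of `ℝ × ℝ^D` for the Euclidean distance. -/
def ballVol (D : ℕ) : ℝ := volume.real (jball (0 : ℝ × Ctx D) 1)

theorem jball_subset_closedBall (z : ℝ × Ctx D) (ρ : ℝ) : jball z ρ ⊆ Metric.closedBall z ρ := by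
  intro w hw
  rw [Metric.mem_closedBall, Prod.dist_eq, Real.dist_eq]
  exact max_le ((abs_sub_fst_le_jointDist w z).trans hw) ((dist_snd_le_jointDist w z).trans hw)

theorem volume_jball_ne_top (z : ℝ × Ctx D) (ρ : ℝ) : volume (jball z ρ) ≠ ⊤ :=
  ((measure_mono (jball_subset_closedBall z ρ)).trans_lt
    (isCompact_closedBall z ρ).measure_lt_top).ne

open scoped Pointwise in
theorem volume_real_jball (z : ℝ × Ctx D) {ρ : ℝ} (hρ : 0 < ρ) :
    volume.real (jball z ρ) = ballVol D * ρ ^ (D + 1) := by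
  have h1 : jball z ρ = (fun w => z + w) '' (ρ • jball (0 : ℝ × Ctx D) 1) := by
    ext w
    simp only [image_add_left, mem_preimage, mem_smul_set_iff_inv_smul_mem₀ hρ.ne']
    rw [mem_jball hρ.le, mem_jball zero_le_one]
    simp only [Prod.smul_fst, Prod.smul_snd, Prod.fst_add, Prod.snd_add, Prod.fst_neg,
      Prod.snd_neg, Prod.fst_zero, Prod.snd_zero, sub_zero, norm_smul, norm_inv,
      Real.norm_eq_abs, smul_eq_mul, abs_of_pos hρ, dist_eq_norm]
    rw [show -z.2 + w.2 = w.2 - z.2 by abel, show -z.1 + w.1 = w.1 - z.1 by ring, mul_pow, mul_pow,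
      ← mul_add, inv_pow, one_pow, inv_mul_le_iff₀ (by positivity), mul_one]
  have : (volume : Measure (ℝ × Ctx D)).IsAddHaarMeasure := by
    rw [Measure.volume_eq_prod]; infer_instance
  rw [h1, measureReal_def, image_add_left, measure_preimage_add,
    Measure.addHaar_smul, ENNReal.toReal_mul, ENNReal.toReal_ofReal (abs_nonneg _)]
  have : Module.finrank ℝ (ℝ × Ctx D) = D + 1 := by
    rw [Module.finrank_prod, Module.finrank_self, finrank_euclideanSpace_fin, add_comm]
  rw [this, abs_of_pos (by positivity), mul_comm, ballVol, measureReal_def]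

theorem ballVol_nonneg (D : ℕ) : 0 ≤ ballVol D := measureReal_nonneg

theorem ballVol_pos (D : ℕ) : 0 < ballVol D := by
  refine ENNReal.toReal_pos ?_ (volume_jball_ne_top _ _)
  have h1 : Metric.ball (0 : ℝ × Ctx D) (1 / 2) ⊆ jball 0 1 := by
    intro w hw
    rw [Metric.mem_ball, Prod.dist_eq, max_lt_iff, Real.dist_eq] at hw
    refine (jointDist_le_add w 0).trans ?_
    linarith [hw.1, hw.2]
  exact ((Metric.measure_ball_pos volume _ (by norm_num)).trans_le (measure_mono h1)).ne'

/-- The length of `[r - h, r + h] ∩ [0, 1]`, for `r ∈ [0, 1]` and `h ≥ 0`. -/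
def innerLen (r h : ℝ) : ℝ := min r h + min (1 - r) h

theorem innerLen_mono {r h h' : ℝ} (hh : h ≤ h') : innerLen r h ≤ innerLen r h' :=
  add_le_add (min_le_min_left _ hh) (min_le_min_left _ hh)

theorem innerLen_eq {r h : ℝ} (hh : h ≤ 1 / 2) : innerLen r h = min (min r (1 - r)) h + h := by
  unfold innerLen
  rcases le_total r (1 - r) with h1 | h1
  · rw [min_eq_left h1, min_eq_right (by linarith : h ≤ 1 - r)]
  · rw [min_eq_right h1, min_eq_right (by linarith : h ≤ r), add_comm]

/-- Enlarging the window by the factor `1 + τ` enlarges its part in `[0, 1]` by the factor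
`1 + τ / 2` at least: one half of the window lies in `[0, 1]`. -/
theorem one_add_mul_innerLen_le {r s h τ ρ : ℝ}
    (hh : 0 ≤ h) (hτ : 0 ≤ τ) (hhρ : (1 + τ) * h ≤ ρ) (hρ : ρ ≤ 1 / 2)
    (hs : min (min r (1 - r)) ρ ≤ min s (1 - s)) :
    (1 + τ / 2) * innerLen r h ≤ innerLen s ((1 + τ) * h) := by
  have hτh : 0 ≤ τ * h := mul_nonneg hτ hh
  rw [innerLen_eq (by linarith : h ≤ 1 / 2), innerLen_eq (hhρ.trans hρ)]
  have h1 : min (min r (1 - r)) h ≤ h := min_le_right _ _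
  have h2 : min (min r (1 - r)) h ≤ min (min s (1 - s)) ((1 + τ) * h) :=
    le_min ((min_le_min_left _ (by linarith)).trans hs) (by linarith)
  nlinarith

/-- The volume of the part of a Euclidean ball that lies in `[0, 1] × A`. -/
def slabVol (A : Set (Ctx D)) (x : Ctx D) (r ρ : ℝ) : ℝ :=
  volume.real (jball (r, x) ρ ∩ Icc 0 1 ×ˢ A)

theorem slabVol_nonneg (A : Set (Ctx D)) (x : Ctx D) (r ρ : ℝ) : 0 ≤ slabVol A x r ρ :=
  measureReal_nonneg

theorem volume_slab_ne_top (A : Set (Ctx D)) (z : ℝ × Ctx D) (ρ : ℝ) :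
    volume (jball z ρ ∩ Icc 0 1 ×ˢ A) ≠ ⊤ :=
  ((measure_mono inter_subset_left).trans_lt (volume_jball_ne_top z ρ).lt_top).ne

/-- The volume of a ball in the slab, integrated slice by slice over the contexts. -/
theorem volume_slab_eq {A : Set (Ctx D)} (hA : MeasurableSet A) (x : Ctx D) {r ρ : ℝ}
    (hρ : 0 ≤ ρ) :
    volume (jball (r, x) ρ ∩ Icc 0 1 ×ˢ A) =
      ∫⁻ y, (A ∩ Metric.closedBall x ρ).indicator
        (fun y => ENNReal.ofReal (innerLen r (Real.sqrt (ρ ^ 2 - dist y x ^ 2)))) y := by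
  rw [Measure.volume_eq_prod, Measure.prod_apply_symm
    ((measurableSet_jball _ _).inter (measurableSet_Icc.prod hA))]
  refine lintegral_congr fun y => ?_
  by_cases hy : y ∈ A ∩ Metric.closedBall x ρ
  · rw [indicator_of_mem hy]
    have hd : dist y x ≤ ρ := hy.2
    have hd2 : 0 ≤ ρ ^ 2 - dist y x ^ 2 := by nlinarith [dist_nonneg (x := y) (y := x)]
    set h := Real.sqrt (ρ ^ 2 - dist y x ^ 2) with hh
    have hset : (fun u : ℝ => (u, y)) ⁻¹' (jball (r, x) ρ ∩ Icc 0 1 ×ˢ A)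
        = Icc (max 0 (r - h)) (min 1 (r + h)) := by
      ext u
      simp only [mem_preimage, mem_inter_iff, mem_jball hρ, mem_prod, hy.1, and_true, mem_Icc,
        sup_le_iff, le_inf_iff]
      rw [show (u - r) ^ 2 + dist y x ^ 2 ≤ ρ ^ 2 ↔ (u - r) ^ 2 ≤ ρ ^ 2 - dist y x ^ 2 by
        constructor <;> intro h <;> linarith, ← Real.sqrt_le_sqrt_iff hd2, Real.sqrt_sq_eq_abs,
        ← hh, abs_le]
      constructor
      · rintro ⟨⟨h1, h2⟩, h3, h4⟩
        exact ⟨⟨h3, by linarith⟩, h4, by linarith⟩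
      · rintro ⟨⟨h3, h1⟩, h4, h2⟩
        exact ⟨⟨by linarith, by linarith⟩, h3, h4⟩
    rw [hset, Real.volume_Icc, innerLen]
    congr 1
    have e1 : min 1 (r + h) = r + min (1 - r) h := by
      rw [← min_add_add_left]; ring_nf
    have e2 : max 0 (r - h) = r - min r h := by
      rw [sub_eq_add_neg r (min r h), ← max_neg_neg, ← max_add_add_left]; ring_nf
    rw [e1, e2]; ring
  · rw [indicator_of_notMem hy]
    convert measure_empty (μ := (volume : Measure ℝ))
    ext u
    simp only [mem_preimage, mem_inter_iff, mem_prod, mem_empty_iff_false, iff_false]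
    rintro ⟨h1, -, h2⟩
    exact hy ⟨h2, (dist_snd_le_jointDist (u, y) (r, x)).trans h1⟩

/-- Moving the centre inwards and enlarging the radius by the factor `1 + τ` increases the volume
in the slab by the factor `1 + τ / 2` at least. -/
theorem one_add_mul_slabVol_le {A : Set (Ctx D)} (hA : MeasurableSet A) (x : Ctx D)
    {r s ρ τ : ℝ} (hρ : 0 ≤ ρ) (hτ : 0 ≤ τ)
    (hρ2 : (1 + τ) * ρ ≤ 1 / 2) (hrs : min (min r (1 - r)) ((1 + τ) * ρ) ≤ min s (1 - s)) :
    (1 + τ / 2) * slabVol A x r ρ ≤ slabVol A x s ((1 + τ) * ρ) := by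
  have h1τ : 0 ≤ 1 + τ / 2 := by linarith
  have hρτ : 0 ≤ (1 + τ) * ρ := by positivity
  have key : ENNReal.ofReal (1 + τ / 2) * volume (jball (r, x) ρ ∩ Icc 0 1 ×ˢ A)
      ≤ volume (jball (s, x) ((1 + τ) * ρ) ∩ Icc 0 1 ×ˢ A) := by
    rw [volume_slab_eq hA x hρ, volume_slab_eq hA x hρτ,
      ← lintegral_const_mul' _ _ ENNReal.ofReal_ne_top]
    refine lintegral_mono fun y => ?_
    by_cases hy : y ∈ A ∩ Metric.closedBall x ρ
    · have hy2 : y ∈ A ∩ Metric.closedBall x ((1 + τ) * ρ) :=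
        ⟨hy.1, Metric.closedBall_subset_closedBall (by nlinarith) hy.2⟩
      simp only [indicator_of_mem hy, indicator_of_mem hy2]
      have hd : dist y x ≤ ρ := hy.2
      have hd0 : 0 ≤ dist y x := dist_nonneg
      rw [← ENNReal.ofReal_mul h1τ]
      refine ENNReal.ofReal_le_ofReal ?_
      set h := Real.sqrt (ρ ^ 2 - dist y x ^ 2) with hh
      have hhρ : h ≤ ρ := by
        rw [hh, Real.sqrt_le_left hρ]; nlinarith
      refine (one_add_mul_innerLen_le (Real.sqrt_nonneg _) hτ
        (mul_le_mul_of_nonneg_left hhρ (by linarith)) hρ2 hrs).trans (innerLen_mono ?_)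
      refine Real.le_sqrt_of_sq_le ?_
      rw [mul_pow, Real.sq_sqrt (by nlinarith)]
      nlinarith [mul_nonneg hτ (sq_nonneg (dist y x)), mul_nonneg (mul_nonneg hτ hτ)
        (sq_nonneg (dist y x))]
    · simp [indicator_of_notMem hy]
  have := ENNReal.toReal_mono (volume_slab_ne_top _ _ _) key
  rwa [ENNReal.toReal_mul, ENNReal.toReal_ofReal h1τ] at this

theorem slabVol_le_add_shell (A : Set (Ctx D)) (x : Ctx D) (r : ℝ)
    {ρ ρ' : ℝ} (hρ : 0 < ρ) (h : ρ ≤ ρ') :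
    slabVol A x r ρ' ≤ slabVol A x r ρ + ballVol D * (ρ' ^ (D + 1) - ρ ^ (D + 1)) := by
  have hsub : jball (r, x) ρ' ∩ Icc 0 1 ×ˢ A ⊆
      (jball (r, x) ρ ∩ Icc 0 1 ×ˢ A) ∪ (jball (r, x) ρ' \ jball (r, x) ρ) := by
    rintro w ⟨h1, h2⟩
    by_cases hw : w ∈ jball (r, x) ρ
    · exact Or.inl ⟨hw, h2⟩
    · exact Or.inr ⟨h1, hw⟩
  have hfin : volume (jball (r, x) ρ' \ jball (r, x) ρ) ≠ ⊤ :=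
    ((measure_mono sdiff_subset).trans_lt (volume_jball_ne_top (r, x) ρ').lt_top).ne
  have h1 := measureReal_mono hsub (measure_union_ne_top (volume_slab_ne_top A (r, x) ρ) hfin)
  have h2 := measureReal_union_le (μ := volume) (jball (r, x) ρ ∩ Icc 0 1 ×ˢ A)
    (jball (r, x) ρ' \ jball (r, x) ρ)
  have h3 : volume.real (jball (r, x) ρ' \ jball (r, x) ρ)
      = ballVol D * (ρ' ^ (D + 1) - ρ ^ (D + 1)) := by
    rw [measureReal_sdiff (jball_mono _ h) (measurableSet_jball _ _) (volume_jball_ne_top _ _),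
      volume_real_jball _ hρ, volume_real_jball _ (hρ.trans_le h)]
    ring
  rw [h3] at h2
  exact h1.trans h2

theorem slabVol_le (A : Set (Ctx D)) (x : Ctx D) (r : ℝ) {ρ : ℝ} (hρ : 0 < ρ) :
    slabVol A x r ρ ≤ ballVol D * ρ ^ (D + 1) := by
  rw [← volume_real_jball (r, x) hρ]
  exact measureReal_mono inter_subset_left (volume_jball_ne_top _ _)

/-- A set without cusps occupies a fixed proportion of every small ball of the slab. -/
theorem le_slabVol {A : Set (Ctx D)} (hA : MeasurableSet A) {x : Ctx D} {r ρ c₀ : ℝ}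
    (hr : r ∈ Icc (0 : ℝ) 1) (hρ : 0 < ρ) (hρ1 : ρ ≤ 1) (hc₀ : 0 < c₀)
    (hthick : ENNReal.ofReal (c₀ * (ρ / 2) ^ D) ≤ volume (A ∩ Metric.closedBall x (ρ / 2))) :
    c₀ / 2 ^ (D + 1) * ρ ^ (D + 1) ≤ slabVol A x r ρ := by
  have key : ENNReal.ofReal (ρ / 2) * ENNReal.ofReal (c₀ * (ρ / 2) ^ D)
      ≤ volume (jball (r, x) ρ ∩ Icc 0 1 ×ˢ A) := by
    rw [volume_slab_eq hA x hρ.le]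
    refine (mul_le_mul_right hthick _).trans ?_
    rw [← lintegral_indicator_const (hA.inter Metric.isClosed_closedBall.measurableSet)]
    refine lintegral_mono fun y => ?_
    by_cases hy : y ∈ A ∩ Metric.closedBall x (ρ / 2)
    · have hy2 : y ∈ A ∩ Metric.closedBall x ρ :=
        ⟨hy.1, Metric.closedBall_subset_closedBall (by linarith) hy.2⟩
      simp only [indicator_of_mem hy, indicator_of_mem hy2]
      refine ENNReal.ofReal_le_ofReal ?_
      have hd : dist y x ≤ ρ / 2 := hy.2
      have hd0 : 0 ≤ dist y x := dist_nonneg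
      refine le_trans ?_ (innerLen_mono (h := ρ / 2) (Real.le_sqrt_of_sq_le (by nlinarith)))
      unfold innerLen
      rcases le_total r (1 / 2) with h | h
      · have e1 : min (1 - r) (ρ / 2) = ρ / 2 := min_eq_right (by linarith)
        have e2 : 0 ≤ min r (ρ / 2) := le_min hr.1 (by linarith)
        linarith
      · have e1 : min r (ρ / 2) = ρ / 2 := min_eq_right (by linarith)
        have e2 : 0 ≤ min (1 - r) (ρ / 2) := le_min (by linarith [hr.2]) (by linarith)
        linarith
    · simp [indicator_of_notMem hy]
  have h1 := ENNReal.toReal_mono (volume_slab_ne_top _ _ _) key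
  rw [ENNReal.toReal_mul, ENNReal.toReal_ofReal (by positivity),
    ENNReal.toReal_ofReal (by positivity)] at h1
  refine le_trans (le_of_eq ?_) h1
  rw [div_pow, pow_succ, pow_succ]
  field_simp

/-! ### Probabilities of balls -/

namespace Environment

/-- The probability that a (reward, context) pair of arm `i` falls into a ball. -/
def mass (B : Environment D K) (i : Fin K) (x : Ctx D) (r ρ : ℝ) : ℝ :=
  (B.law i).real (jball (r, x) ρ)

theorem measurableSet_support (B : Environment D K) : MeasurableSet B.𝒳 :=
  (isClosed_tsupport _).measurableSet

theorem law_eq_setLIntegral (B : Environment D K) (i : Fin K) {A : Set (ℝ × Ctx D)}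
    (hA : MeasurableSet A) :
    B.law i A = ∫⁻ z in A ∩ Icc 0 1 ×ˢ B.𝒳, ENNReal.ofReal (B.f i z.1 z.2) := by
  rw [law, withDensity_apply _ hA, ← lintegral_indicator hA, ← lintegral_indicator
    (hA.inter (measurableSet_Icc.prod B.measurableSet_support))]
  refine lintegral_congr fun z => ?_
  by_cases hz : z ∈ Icc (0 : ℝ) 1 ×ˢ B.𝒳
  · by_cases hzA : z ∈ A
    · rw [indicator_of_mem hzA, indicator_of_mem (mem_inter hzA hz)]
    · rw [indicator_of_notMem hzA, indicator_of_notMem fun h => hzA (mem_of_mem_inter_left h)]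
  · rw [indicator_of_notMem (s := A ∩ _) (fun h => hz (mem_of_mem_inter_right h))]
    have : B.f i z.1 z.2 = 0 := by
      rw [mem_prod, not_and_or] at hz
      rcases hz with hz | hz
      · exact B.f_reward i _ _ hz
      · exact B.f_context i _ _ hz
    by_cases hzA : z ∈ A
    · rw [indicator_of_mem hzA, this, ENNReal.ofReal_zero]
    · rw [indicator_of_notMem hzA]

end Environment

namespace Regular

variable {B : Environment D K} {θ : Params}

theorem abs_sub_le_of_mem (h : Regular B θ) (i : Fin K) {x : Ctx D} (hx : x ∈ B.𝒳) {r ρ : ℝ}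
    (hr : r ∈ Icc (0 : ℝ) 1) {z : ℝ × Ctx D}
    (hz : z ∈ jball (r, x) ρ ∩ Icc 0 1 ×ˢ B.𝒳) :
    |B.f i z.1 z.2 - B.f i r x| ≤ θ.Cα * ρ ^ θ.α := by
  refine (h.holder i z.2 hz.2.2 x hx z.1 hz.2.1 r hr).trans ?_
  exact mul_le_mul_of_nonneg_left (Real.rpow_le_rpow (jointDist_nonneg _ _) hz.1 θ.α_pos.le)
    (h.Cα_nonneg i)

theorem mass_le (h : Regular B θ) (i : Fin K) {x : Ctx D} (hx : x ∈ B.𝒳) {r ρ : ℝ}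
    (hr : r ∈ Icc (0 : ℝ) 1) (hρ : 0 ≤ ρ) :
    B.mass i x r ρ ≤ (B.f i r x + θ.Cα * ρ ^ θ.α) * slabVol B.𝒳 x r ρ := by
  have hnn : 0 ≤ B.f i r x + θ.Cα * ρ ^ θ.α :=
    add_nonneg (B.f_nonneg _ _ _) (mul_nonneg (h.Cα_nonneg i) (Real.rpow_nonneg hρ _))
  have h1 : B.law i (jball (r, x) ρ) ≤ ENNReal.ofReal (B.f i r x + θ.Cα * ρ ^ θ.α) *
      volume (jball (r, x) ρ ∩ Icc 0 1 ×ˢ B.𝒳) := by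
    rw [B.law_eq_setLIntegral i (measurableSet_jball _ _), ← setLIntegral_const]
    refine setLIntegral_mono' ((measurableSet_jball _ _).inter
      (measurableSet_Icc.prod B.measurableSet_support)) fun z hz => ?_
    exact ENNReal.ofReal_le_ofReal (by
      linarith [(abs_le.1 (h.abs_sub_le_of_mem i hx hr hz)).2])
  have h2 := ENNReal.toReal_mono
    (ENNReal.mul_ne_top ENNReal.ofReal_ne_top (volume_slab_ne_top _ _ _)) h1
  rwa [ENNReal.toReal_mul, ENNReal.toReal_ofReal hnn] at h2

theorem mass_ne_top (h : Regular B θ) (i : Fin K) {x : Ctx D} (hx : x ∈ B.𝒳) {r ρ : ℝ}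
    (hr : r ∈ Icc (0 : ℝ) 1) : B.law i (jball (r, x) ρ) ≠ ⊤ := by
  have h1 : B.law i (jball (r, x) ρ) ≤ ENNReal.ofReal (B.f i r x + θ.Cα * ρ ^ θ.α) *
      volume (jball (r, x) ρ ∩ Icc 0 1 ×ˢ B.𝒳) := by
    rw [B.law_eq_setLIntegral i (measurableSet_jball _ _), ← setLIntegral_const]
    refine setLIntegral_mono' ((measurableSet_jball _ _).inter
      (measurableSet_Icc.prod B.measurableSet_support)) fun z hz => ?_
    exact ENNReal.ofReal_le_ofReal (by
      linarith [(abs_le.1 (h.abs_sub_le_of_mem i hx hr hz)).2])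
  exact (h1.trans_lt (ENNReal.mul_lt_top ENNReal.ofReal_lt_top
    (volume_slab_ne_top _ _ _).lt_top)).ne

theorem le_mass (h : Regular B θ) (i : Fin K) {x : Ctx D} (hx : x ∈ B.𝒳) {r ρ : ℝ}
    (hr : r ∈ Icc (0 : ℝ) 1) :
    (B.f i r x - θ.Cα * ρ ^ θ.α) * slabVol B.𝒳 x r ρ ≤ B.mass i x r ρ := by
  rcases le_or_gt (B.f i r x - θ.Cα * ρ ^ θ.α) 0 with hneg | hpos
  · exact (mul_nonpos_of_nonpos_of_nonneg hneg (slabVol_nonneg _ _ _ _)).trans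
      measureReal_nonneg
  have h1 : ENNReal.ofReal (B.f i r x - θ.Cα * ρ ^ θ.α) *
      volume (jball (r, x) ρ ∩ Icc 0 1 ×ˢ B.𝒳) ≤ B.law i (jball (r, x) ρ) := by
    rw [B.law_eq_setLIntegral i (measurableSet_jball _ _), ← setLIntegral_const]
    refine setLIntegral_mono' ((measurableSet_jball _ _).inter
      (measurableSet_Icc.prod B.measurableSet_support)) fun z hz => ?_
    exact ENNReal.ofReal_le_ofReal (by
      linarith [(abs_le.1 (h.abs_sub_le_of_mem i hx hr hz)).1])
  have h2 := ENNReal.toReal_mono (h.mass_ne_top i hx hr) h1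
  rwa [ENNReal.toReal_mul, ENNReal.toReal_ofReal hpos.le] at h2

theorem fMax_pos (h : Regular B θ) (i : Fin K) : 0 < θ.fMax := by
  obtain ⟨x, hx⟩ := nonempty_support B
  obtain ⟨t, ht⟩ := (h.modalShape i hx).exists_mode
  exact θ.lam_pos.trans_le (((h.modalShape i hx).lower t ht).trans (h.bounded i t x))

theorem law_real_le (h : Regular B θ) (i : Fin K) {A : Set (ℝ × Ctx D)} (hA : MeasurableSet A)
    (hfin : volume A ≠ ⊤) : (B.law i).real A ≤ θ.fMax * volume.real A := by
  have h1 : B.law i A ≤ ENNReal.ofReal θ.fMax * volume A := by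
    rw [Environment.law, withDensity_apply _ hA, ← setLIntegral_const]
    exact setLIntegral_mono' hA fun z _ => ENNReal.ofReal_le_ofReal (h.bounded _ _ _)
  have h2 := ENNReal.toReal_mono (ENNReal.mul_ne_top ENNReal.ofReal_ne_top hfin) h1
  rwa [ENNReal.toReal_mul, ENNReal.toReal_ofReal (h.fMax_pos i).le] at h2

theorem le_slabVol (h : Regular B θ) {x : Ctx D} (hx : x ∈ B.𝒳) {r ρ : ℝ}
    (hr : r ∈ Icc (0 : ℝ) 1) (hρ : 0 < ρ) (hρ1 : ρ ≤ 1) (hρ₀ : ρ ≤ θ.ρ₀) :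
    θ.c₀ / 2 ^ (D + 1) * ρ ^ (D + 1) ≤ slabVol B.𝒳 x r ρ :=
  ModalBandit.le_slabVol B.measurableSet_support hr hρ hρ1 θ.c₀_pos
    (h.thick x hx _ (by positivity) (by linarith))

end Regular

end ModalBandit

namespace ModalBandit

variable {D K : ℕ}

/-! ### Nearest-neighbour radii -/

open scoped Classical in
/-- The number of sample points in the Euclidean ball of radius `ρ` around `(r, x)`. -/
def ballCount (S : Multiset (ℝ × Ctx D)) (x : Ctx D) (r ρ : ℝ) : ℕ :=
  (S.filter (fun z => jointDist z (r, x) ≤ ρ)).card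

section Knn

variable {S : Multiset (ℝ × Ctx D)} {k : ℕ} {x : Ctx D} {r ρ : ℝ}

theorem ballCount_mono (S : Multiset (ℝ × Ctx D)) (x : Ctx D) (r : ℝ) {ρ ρ' : ℝ} (h : ρ ≤ ρ') :
    ballCount S x r ρ ≤ ballCount S x r ρ' := by
  classical
  exact Multiset.card_le_card (Multiset.monotone_filter_right S fun z hz => le_trans hz h)

theorem knnRadius_nonneg (S : Multiset (ℝ × Ctx D)) (k : ℕ) (x : Ctx D) (r : ℝ) :
    0 ≤ knnRadius S k x r := Real.sInf_nonneg fun _ h => h.1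

theorem knnRadius_le (hρ : 0 ≤ ρ) (h : k ≤ ballCount S x r ρ) : knnRadius S k x r ≤ ρ :=
  csInf_le ⟨0, fun _ h => h.1⟩ ⟨hρ, h⟩

theorem ballCount_lt (hρ : 0 ≤ ρ) (h : ρ < knnRadius S k x r) : ballCount S x r ρ < k := by
  by_contra! hle
  exact absurd (knnRadius_le hρ hle) (not_le.2 h)

/-- The infimum in the nearest-neighbour radius is attained. -/
theorem le_ballCount (hk : k ≤ S.card) (h : knnRadius S k x r ≤ ρ) : k ≤ ballCount S x r ρ := by
  classical
  refine le_trans ?_ (ballCount_mono S x r h)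
  set μ := knnRadius S k x r with hμ
  have hne : {ρ : ℝ | 0 ≤ ρ ∧ k ≤ (S.filter (fun z => jointDist z (r, x) ≤ ρ)).card}.Nonempty := by
    obtain ⟨M, hM⟩ := (S.toFinset.image fun z => jointDist z (r, x)).exists_le
    refine ⟨max M 0, le_max_right _ _, ?_⟩
    rw [Multiset.filter_eq_self.2 fun z hz => ?_]
    · exact hk
    · exact (hM _ (Finset.mem_image_of_mem _ (Multiset.mem_toFinset.2 hz))).trans (le_max_left _ _)
  have hev : ∀ᶠ ρ' in 𝓝[>] μ, ∀ z ∈ S.toFinset, jointDist z (r, x) ≤ ρ' →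
      jointDist z (r, x) ≤ μ := by
    rw [Filter.eventually_all_finset]
    intro z _
    rcases le_or_gt (jointDist z (r, x)) μ with h | h
    · exact Eventually.of_forall fun _ _ => h
    · filter_upwards [Ioo_mem_nhdsGT h] with ρ' hρ' hle
      exact absurd hle (not_le.2 hρ'.2)
  obtain ⟨ρ', hρ', hgt⟩ := (hev.and self_mem_nhdsWithin).exists
  obtain ⟨ρ₁, ⟨-, hk₁⟩, hlt⟩ := exists_lt_of_csInf_lt hne (show sInf _ < ρ' from hgt)
  refine hk₁.trans (Multiset.card_le_card ?_)
  refine Multiset.le_filter.2 ⟨Multiset.filter_le _ _, fun z hz => ?_⟩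
  rw [Multiset.mem_filter] at hz
  exact hρ' z (Multiset.mem_toFinset.2 hz.1) (hz.2.trans hlt.le)

end Knn

/-! ### Comparison of radii and densities -/

/-- The counts of the sample `S` in all small balls agree with their expectations under the law
of arm `i`, up to relative errors of order `l` (relative to the expectation or to `k`). -/
def GoodSample (B : Environment D K) (i : Fin K) (S : Multiset (ℝ × Ctx D)) (k : ℕ) (l : ℝ) :
    Prop :=
  ∀ x ∈ B.𝒳, ∀ r ∈ Icc (0 : ℝ) 1, ∀ ρ, 0 < ρ → ρ ≤ 1 →
    (ballCount S x r ρ : ℝ) ≤ (1 + l) * (S.card * B.mass i x r ρ) + 3 * l * k ∧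
    (1 - l) * (S.card * B.mass i x r ρ) - 3 * l * k ≤ ballCount S x r ρ

theorem mul_one_sub_le_of_le {k l V : ℝ} (hk : 0 ≤ k) (hl : 0 ≤ l)
    (h : k ≤ (1 + l) * V + 3 * l * k) : k * (1 - 4 * l) ≤ V := by
  have h1 : 0 ≤ k * (4 * l ^ 2) := by positivity
  have h2 : k * (1 - 4 * l) * (1 + l) ≤ V * (1 + l) := by linarith
  exact le_of_mul_le_mul_right h2 (by linarith)

theorem le_mul_one_add_of_le {k l V : ℝ} (hk : 0 ≤ k) (hl : 0 ≤ l) (hl1 : l ≤ 1 / 16)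
    (h : (1 - l) * V - 3 * l * k ≤ k) : V ≤ k * (1 + 5 * l) := by
  have h1 : 0 ≤ k * (l * (1 - 5 * l)) := mul_nonneg hk (mul_nonneg hl (by linarith))
  have h2 : V * (1 - l) ≤ k * (1 + 5 * l) * (1 - l) := by linarith
  exact le_of_mul_le_mul_right h2 (by linarith)

theorem one_add_le_mul_of_le {l q τ : ℝ} (hl : 0 ≤ l) (hq : 0 ≤ q) (hA : 8 * l + q ≤ 1 / 2)
    (hτ : 4 * (8 * l + q) ≤ τ) : 1 + 3 * l ≤ (1 - l) * ((1 + τ / 2) * (1 - 4 * l - q)) := by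
  have h1 : 0 ≤ τ := by linarith
  have h2 : 1 - 5 * l - q ≤ (1 - l) * (1 - 4 * l - q) := by
    have := mul_nonneg hl hq
    have := mul_nonneg hl hl
    linarith
  have h3 : (1 + τ / 2) * (1 - 5 * l - q) ≤ (1 + τ / 2) * ((1 - l) * (1 - 4 * l - q)) :=
    mul_le_mul_of_nonneg_left h2 (by linarith)
  have h4 : τ / 2 * (1 / 2) ≤ τ / 2 * (1 - 5 * l - q) :=
    mul_le_mul_of_nonneg_left (by linarith) (by linarith)
  linarith

theorem one_add_pow_le {τ : ℝ} (h0 : 0 ≤ τ) (h1 : τ ≤ 1) (n : ℕ) :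
    (1 + τ) ^ n ≤ 1 + (2 ^ n - 1) * τ := by
  induction n with
  | zero => simp
  | succ n ih =>
    have h2 : (1 : ℝ) ≤ 2 ^ n := one_le_pow₀ (by norm_num)
    calc (1 + τ) ^ (n + 1) = (1 + τ) ^ n * (1 + τ) := pow_succ _ _
      _ ≤ (1 + (2 ^ n - 1) * τ) * (1 + τ) := by gcongr
      _ ≤ 1 + (2 ^ (n + 1) - 1) * τ := by
        rw [pow_succ]
        nlinarith [mul_nonneg (sub_nonneg.2 h2) (mul_nonneg h0 (sub_nonneg.2 h1))]

/-- The proportion of every small ball that the slab `[0, 1] × 𝒳` occupies at least, divided by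
the volume of the unit ball. -/
def slabConst (θ : Params) (D : ℕ) : ℝ := θ.c₀ / 2 ^ (D + 1)

theorem slabConst_pos (θ : Params) (D : ℕ) : 0 < slabConst θ D :=
  div_pos θ.c₀_pos (by positivity)

/-- The growth rate of volumes of balls in the slab under dilations, relative to the volume. -/
def shellConst (θ : Params) (D : ℕ) : ℝ := ballVol D / slabConst θ D * 4 ^ (D + 1)

theorem shellConst_nonneg (θ : Params) (D : ℕ) : 0 ≤ shellConst θ D :=
  mul_nonneg (div_nonneg (ballVol_nonneg D) (slabConst_pos θ D).le) (by positivity)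

/-- The constant in the comparison of densities through nearest-neighbour radii. -/
def compConst (θ : Params) (D : ℕ) : ℝ := 2 + (9 + 2 * shellConst θ D) * (θ.fMax + θ.Cα)

section Compare

variable {B : Environment D K} {θ : Params} {i : Fin K} {S : Multiset (ℝ × Ctx D)} {k : ℕ} {l : ℝ}
  {x : Ctx D} {r s τ R : ℝ}

/-- Points whose density is not much lower than that of `r`, and which are not closer to the
boundary of `[0, 1]`, have a nearest-neighbour radius that is not much larger than that of `r`. -/
theorem Regular.knnRadius_le_of_le (h : Regular B θ) (hS : GoodSample B i S k l)
    (hl : 0 ≤ l) (hk : 0 < k) (hkS : k ≤ S.card) (hx : x ∈ B.𝒳)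
    (hr : r ∈ Icc (0 : ℝ) 1) (hs : s ∈ Icc (0 : ℝ) 1) (hρ : 0 < knnRadius S k x r)
    (hτ : 0 ≤ τ) (hρR : (1 + τ) * knnRadius S k x r ≤ R) (hR : R ≤ 1 / 2)
    (hrs : min (min r (1 - r)) R ≤ min s (1 - s)) {e Q : ℝ} (he : 0 ≤ e)
    (hg : B.f i r x - e ≤ B.f i s x)
    (hQ : S.card * (ballVol D * knnRadius S k x r ^ (D + 1)) ≤ Q * k)
    (hA : 8 * l + (e + 2 * (θ.Cα * R ^ θ.α)) * Q ≤ 1 / 2)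
    (hτA : 4 * (8 * l + (e + 2 * (θ.Cα * R ^ θ.α)) * Q) ≤ τ) :
    knnRadius S k x s ≤ (1 + τ) * knnRadius S k x r := by
  set ρ := knnRadius S k x r with hρdef
  set b := θ.Cα * R ^ θ.α with hb
  set N : ℝ := (S.card : ℝ) with hN
  have hk' : (0 : ℝ) < k := by exact_mod_cast hk
  have hN0 : 0 ≤ N := Nat.cast_nonneg _
  have hC := h.Cα_nonneg i
  have hτρ : 0 ≤ τ * ρ := mul_nonneg hτ hρ.le
  have hρR' : ρ ≤ R := by linarith
  have hb0 : 0 ≤ b := mul_nonneg hC (Real.rpow_nonneg (hρ.le.trans hρR') _)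
  have hbρ : θ.Cα * ρ ^ θ.α ≤ b :=
    mul_le_mul_of_nonneg_left (Real.rpow_le_rpow hρ.le hρR' θ.α_pos.le) hC
  have hbρ' : θ.Cα * ((1 + τ) * ρ) ^ θ.α ≤ b :=
    mul_le_mul_of_nonneg_left (Real.rpow_le_rpow (by positivity) hρR θ.α_pos.le) hC
  set W := slabVol B.𝒳 x r ρ with hW
  set W' := slabVol B.𝒳 x s ((1 + τ) * ρ) with hW'
  have hW0 : 0 ≤ W := slabVol_nonneg _ _ _ _
  have hW'0 : 0 ≤ W' := slabVol_nonneg _ _ _ _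
  have hWW' : (1 + τ / 2) * W ≤ W' :=
    one_add_mul_slabVol_le B.measurableSet_support x hρ.le hτ (hρR.trans hR)
      ((min_le_min_left _ hρR).trans hrs)
  have hNW : N * W ≤ Q * k :=
    (mul_le_mul_of_nonneg_left (slabVol_le _ _ _ hρ) hN0).trans hQ
  set G := B.f i r x with hG
  have h1 : (k : ℝ) ≤ (1 + l) * (N * ((G + b) * W)) + 3 * l * k := by
    have e1 : (k : ℝ) ≤ ballCount S x r ρ := by exact_mod_cast le_ballCount hkS le_rfl
    have e2 := (hS x hx r hr ρ hρ (by linarith)).1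
    have e3 : B.mass i x r ρ ≤ (G + b) * W :=
      (h.mass_le i hx hr hρ.le).trans (mul_le_mul_of_nonneg_right (by linarith) hW0)
    have e4 : (1 + l) * (N * B.mass i x r ρ) ≤ (1 + l) * (N * ((G + b) * W)) := by gcongr
    linarith
  set q := (e + 2 * b) * Q with hq
  have hq0 : 0 ≤ q := by
    have : 0 ≤ Q * k := (mul_nonneg hN0 hW0).trans hNW
    exact mul_nonneg (by positivity) (nonneg_of_mul_nonneg_left this hk')
  have h2 : k * (1 - 4 * l) ≤ N * ((G + b) * W) := mul_one_sub_le_of_le hk'.le hl h1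
  have h3 : k * (1 - 4 * l - q) ≤ N * (G - e - b) * W := by
    have e1 : (e + 2 * b) * (N * W) ≤ (e + 2 * b) * (Q * k) := by gcongr
    have e2 : (e + 2 * b) * (Q * k) = q * k := by rw [hq]; ring
    linarith
  have h4 : 0 < N * (G - e - b) := by
    have : 0 < k * (1 - 4 * l - q) := mul_pos hk' (by linarith)
    exact pos_of_mul_pos_left (this.trans_le h3) hW0
  have h5 : (1 + τ / 2) * (k * (1 - 4 * l - q)) ≤ N * ((G - e - b) * W') := by
    calc (1 + τ / 2) * (k * (1 - 4 * l - q)) ≤ (1 + τ / 2) * (N * (G - e - b) * W) := by gcongr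
      _ = N * (G - e - b) * ((1 + τ / 2) * W) := by ring
      _ ≤ N * (G - e - b) * W' := by gcongr
      _ = _ := by ring
  refine knnRadius_le (by positivity) ?_
  have h6 := (hS x hx s hs ((1 + τ) * ρ) (by positivity) (by linarith)).2
  have h7 : (G - e - b) * W' ≤ B.mass i x s ((1 + τ) * ρ) :=
    le_trans (mul_le_mul_of_nonneg_right (by linarith) hW'0) (h.le_mass i hx hs)
  have hl1 : 0 ≤ 1 - l := by linarith
  have h8 : (1 - l) * ((1 + τ / 2) * (k * (1 - 4 * l - q)))
      ≤ (1 - l) * (N * B.mass i x s ((1 + τ) * ρ)) := by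
    refine mul_le_mul_of_nonneg_left (h5.trans ?_) hl1
    gcongr
  have h9 := mul_le_mul_of_nonneg_left (one_add_le_mul_of_le hl hq0 hA hτA) hk'.le
  have h10 : (k : ℝ) ≤ ballCount S x s ((1 + τ) * ρ) := by linarith
  exact_mod_cast h10

/-- A point whose nearest-neighbour radius is not much larger than that of `r`, where `r` lies
well inside `[0, 1]`, has a density that is not much lower than that of `r`. -/
theorem Regular.le_of_knnRadius_le (h : Regular B θ) (hS : GoodSample B i S k l)
    (hl : 0 ≤ l) (hl1 : l ≤ 1 / 16) (hk : 0 < k) (hkS : k ≤ S.card) (hx : x ∈ B.𝒳)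
    (hr : r ∈ Icc R (1 - R)) (hs : s ∈ Icc (0 : ℝ) 1) (hρ : 0 < knnRadius S k x r)
    (hτ : 0 < τ) (hτ1 : τ ≤ 1) (hρR : (1 + τ) * knnRadius S k x r ≤ R) (hR : R ≤ 1 / 2)
    (hR₀ : R ≤ θ.ρ₀) (hrs : knnRadius S k x s ≤ (1 + τ) * knnRadius S k x r) :
    B.f i r x - compConst θ D * (l + θ.Cα * R ^ θ.α + τ) ≤ B.f i s x := by
  set ρ := knnRadius S k x r with hρdef
  set b := θ.Cα * R ^ θ.α with hb
  set N : ℝ := (S.card : ℝ) with hN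
  have hk' : (0 : ℝ) < k := by exact_mod_cast hk
  have hN0 : 0 < N := by
    rw [hN]; exact_mod_cast hk.trans_le hkS
  have hC := h.Cα_nonneg i
  have hτρ : 0 ≤ τ * ρ := mul_nonneg hτ.le hρ.le
  have hR0 : 0 < R := (by positivity : 0 < (1 + τ) * ρ).trans_le hρR
  have hrI : r ∈ Icc (0 : ℝ) 1 := ⟨hR0.le.trans hr.1, by linarith [hr.2]⟩
  set ρ' := ρ / (1 + τ) with hρ'
  have hρ'0 : 0 < ρ' := by positivity
  have hρ'ρ : ρ' < ρ := div_lt_self hρ (by linarith)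
  have hb0 : 0 ≤ b := mul_nonneg hC (Real.rpow_nonneg hR0.le _)
  have hbC : b ≤ θ.Cα :=
    mul_le_of_le_one_right hC (Real.rpow_le_one hR0.le (by linarith) θ.α_pos.le)
  have hbρ' : θ.Cα * ρ' ^ θ.α ≤ b :=
    mul_le_mul_of_nonneg_left (Real.rpow_le_rpow hρ'0.le (by linarith) θ.α_pos.le) hC
  have hbτ : θ.Cα * ((1 + τ) * ρ) ^ θ.α ≤ b :=
    mul_le_mul_of_nonneg_left (Real.rpow_le_rpow (by positivity) hρR θ.α_pos.le) hC
  set W := slabVol B.𝒳 x r ρ' with hW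
  set W' := slabVol B.𝒳 x s ((1 + τ) * ρ) with hW'
  have hc := slabConst_pos θ D
  have hW1 : slabConst θ D * ρ' ^ (D + 1) ≤ W :=
    h.le_slabVol hx hrI hρ'0 (by linarith) (by linarith)
  have hW0 : 0 < W := lt_of_lt_of_le (by positivity) hW1
  have hsh := shellConst_nonneg θ D
  -- the volume around `s` is at most that around `r`, and the shell around `r` is small
  have hWW' : W' ≤ (1 + shellConst θ D * τ) * W := by
    have e1 : W' ≤ slabVol B.𝒳 x r ((1 + τ) * ρ) := by
      have := one_add_mul_slabVol_le (A := B.𝒳) (r := s) (s := r) (τ := 0) B.measurableSet_support x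
        (show 0 ≤ (1 + τ) * ρ by positivity) le_rfl (by linarith)
        (le_min ((min_le_right _ _).trans (by linarith [hr.1]))
          ((min_le_right _ _).trans (by linarith [hr.2])))
      simpa using this
    have e2 := slabVol_le_add_shell B.𝒳 x r hρ'0 (show ρ' ≤ (1 + τ) * ρ by linarith)
    have e3 : (1 + τ) * ρ = ρ' * (1 + τ) ^ 2 := by rw [hρ']; field_simp
    have e4 : (1 + τ) ^ (2 * (D + 1)) ≤ 1 + 4 ^ (D + 1) * τ := by
      have := one_add_pow_le hτ.le hτ1 (2 * (D + 1))
      rw [pow_mul 2 2 (D + 1), show (2 : ℝ) ^ 2 = 4 by norm_num] at this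
      linarith
    have e5 : ballVol D * (((1 + τ) * ρ) ^ (D + 1) - ρ' ^ (D + 1))
        ≤ shellConst θ D * τ * W := by
      rw [e3, mul_pow, ← pow_mul]
      calc ballVol D * (ρ' ^ (D + 1) * (1 + τ) ^ (2 * (D + 1)) - ρ' ^ (D + 1))
          = ballVol D * ρ' ^ (D + 1) * ((1 + τ) ^ (2 * (D + 1)) - 1) := by ring
        _ ≤ ballVol D * ρ' ^ (D + 1) * (4 ^ (D + 1) * τ) := by
            have := ballVol_nonneg D
            gcongr
            linarith
        _ = shellConst θ D * τ * (slabConst θ D * ρ' ^ (D + 1)) := by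
            rw [shellConst]; field_simp
        _ ≤ shellConst θ D * τ * W := by gcongr
    linarith
  set G := B.f i r x with hG
  have hG0 : 0 ≤ G := B.f_nonneg _ _ _
  have hs0 : 0 ≤ B.f i s x := B.f_nonneg _ _ _
  have hsF : B.f i s x ≤ θ.fMax := h.bounded _ _ _
  have hGF : G ≤ θ.fMax := h.bounded _ _ _
  have h1 : N * ((G - b) * W) ≤ k * (1 + 5 * l) := by
    have e1 : (ballCount S x r ρ' : ℝ) ≤ k := by
      exact_mod_cast (ballCount_lt hρ'0.le hρ'ρ).le
    have e2 := (hS x hx r hrI ρ' hρ'0 (by linarith)).2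
    have e3 : (G - b) * W ≤ B.mass i x r ρ' :=
      le_trans (mul_le_mul_of_nonneg_right (by linarith) hW0.le) (h.le_mass i hx hrI)
    refine le_mul_one_add_of_le hk'.le hl hl1 (le_trans ?_ (e2.trans e1))
    have : 0 ≤ 1 - l := by linarith
    gcongr
  have h2 : k * (1 - 4 * l) ≤ N * ((B.f i s x + b) * ((1 + shellConst θ D * τ) * W)) := by
    have e1 : (k : ℝ) ≤ ballCount S x s ((1 + τ) * ρ) := by
      exact_mod_cast le_ballCount hkS hrs
    have e2 := (hS x hx s hs ((1 + τ) * ρ) (by positivity) (by linarith)).1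
    have e3 : B.mass i x s ((1 + τ) * ρ)
        ≤ (B.f i s x + b) * ((1 + shellConst θ D * τ) * W) := by
      refine (h.mass_le i hx hs (by positivity)).trans ?_
      have : 0 ≤ W' := slabVol_nonneg _ _ _ _
      gcongr
    refine mul_one_sub_le_of_le hk'.le hl (e1.trans (e2.trans ?_))
    gcongr
  have h3 : (G - b) * (1 - 4 * l) ≤ (1 + 5 * l) * ((B.f i s x + b) * (1 + shellConst θ D * τ)) := by
    have e1 : 0 ≤ 1 - 4 * l := by linarith
    have e2 : N * ((G - b) * W) * (1 - 4 * l) ≤ k * (1 + 5 * l) * (1 - 4 * l) := by gcongr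
    have e3 : k * (1 - 4 * l) * (1 + 5 * l) ≤
      N * ((B.f i s x + b) * ((1 + shellConst θ D * τ) * W)) * (1 + 5 * l) := by gcongr
    have e4 : (G - b) * (1 - 4 * l) * (N * W) ≤
        (1 + 5 * l) * ((B.f i s x + b) * (1 + shellConst θ D * τ)) * (N * W) := by
      calc _ = N * ((G - b) * W) * (1 - 4 * l) := by ring
        _ ≤ k * (1 + 5 * l) * (1 - 4 * l) := e2
        _ = k * (1 - 4 * l) * (1 + 5 * l) := by ring
        _ ≤ _ := e3
        _ = _ := by ring
    exact le_of_mul_le_mul_right e4 (by positivity)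
  have h4 : (1 + 5 * l) * ((B.f i s x + b) * (1 + shellConst θ D * τ)) ≤
      B.f i s x + b + (5 * l + 2 * shellConst θ D * τ) * (θ.fMax + θ.Cα) := by
    have e1 : (1 + 5 * l) * (1 + shellConst θ D * τ) ≤ 1 + (5 * l + 2 * shellConst θ D * τ) := by
      have : 5 * l * (shellConst θ D * τ) ≤ 1 * (shellConst θ D * τ) := by
        have : 0 ≤ shellConst θ D * τ := by positivity
        gcongr
        linarith
      linarith
    calc _ = (B.f i s x + b) * ((1 + 5 * l) * (1 + shellConst θ D * τ)) := by ring
      _ ≤ (B.f i s x + b) * (1 + (5 * l + 2 * shellConst θ D * τ)) := by gcongr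
      _ = B.f i s x + b + (5 * l + 2 * shellConst θ D * τ) * (B.f i s x + b) := by ring
      _ ≤ _ := by gcongr
  have h5 : G - b - 4 * l * θ.fMax ≤ (G - b) * (1 - 4 * l) := by
    linarith [mul_nonneg hl hb0, mul_le_mul_of_nonneg_left hGF hl]
  have hF0 : 0 ≤ θ.fMax := hG0.trans hGF
  rw [compConst]
  have e1 : (5 * l + 2 * shellConst θ D * τ) * (θ.fMax + θ.Cα) + 4 * l * θ.fMax + 2 * b
      ≤ (2 + (9 + 2 * shellConst θ D) * (θ.fMax + θ.Cα)) * (l + b + τ) := by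
    have p1 := mul_nonneg hl hC
    have p2 := mul_nonneg hl (mul_nonneg hsh (add_nonneg hF0 hC))
    have p3 := mul_nonneg hb0 (mul_nonneg hsh (add_nonneg hF0 hC))
    have p4 := mul_nonneg hb0 (add_nonneg hF0 hC)
    have p5 := mul_nonneg hτ.le (add_nonneg hF0 hC)
    linarith
  linarith

/-- A point of density at least `λ / 2` has a small nearest-neighbour radius. -/
theorem Regular.knnRadius_le_of_density (h : Regular B θ) (hS : GoodSample B i S k l)
    (hl1 : l ≤ 1 / 16) (hx : x ∈ B.𝒳)
    (hr : r ∈ Icc (0 : ℝ) 1) (hR0 : 0 < R) (hR : R ≤ 1)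
    (hR₀ : R ≤ θ.ρ₀) (hg : θ.lam / 2 ≤ B.f i r x - θ.Cα * R ^ θ.α)
    (hN : 4 * k ≤ S.card * (θ.lam * slabConst θ D * R ^ (D + 1))) :
    knnRadius S k x r ≤ R := by
  refine knnRadius_le hR0.le ?_
  have h1 := (hS x hx r hr R hR0 hR).2
  have h2 := h.le_mass i hx hr (ρ := R)
  have h3 := h.le_slabVol hx hr hR0 hR hR₀
  have hlam := θ.lam_pos
  have h4 : θ.lam / 2 * (slabConst θ D * R ^ (D + 1)) ≤ B.mass i x r R := by
    refine le_trans ?_ h2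
    exact mul_le_mul hg h3 (mul_nonneg (slabConst_pos θ D).le (by positivity)) (by linarith)
  have h5 : (2 * k : ℝ) ≤ S.card * B.mass i x r R := by
    have : (S.card : ℝ) * (θ.lam / 2 * (slabConst θ D * R ^ (D + 1))) ≤ S.card * B.mass i x r R := by
      gcongr
    linarith
  have h6 : (1 - l) * (2 * k) ≤ (1 - l) * (S.card * B.mass i x r R) := by
    have : 0 ≤ 1 - l := by linarith
    gcongr
  have hk : (0 : ℝ) ≤ k := Nat.cast_nonneg k
  have h7 : (k : ℝ) ≤ ballCount S x r R := by
    linarith [mul_le_mul_of_nonneg_right hl1 hk]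
  exact_mod_cast h7

/-- Nearest-neighbour radii are bounded below, since the density is bounded above. -/
theorem Regular.lt_knnRadius (h : Regular B θ) (hS : GoodSample B i S k l)
    (hl : 0 ≤ l) (hl1 : l ≤ 1 / 16) (hkS : k ≤ S.card) (hx : x ∈ B.𝒳)
    (hr : r ∈ Icc (0 : ℝ) 1) (hR0 : 0 < R) (hR : R ≤ 1)
    (hN : 2 * (S.card * (θ.fMax * (ballVol D * R ^ (D + 1)))) < k) :
    R < knnRadius S k x r := by
  by_contra! hle
  have h0 : (k : ℝ) ≤ ballCount S x r R := by exact_mod_cast le_ballCount hkS hle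
  have h1 := (hS x hx r hr R hR0 hR).1
  have h2 : B.mass i x r R ≤ θ.fMax * (ballVol D * R ^ (D + 1)) := by
    rw [← volume_real_jball (r, x) hR0]
    exact h.law_real_le i (measurableSet_jball _ _) (volume_jball_ne_top _ _)
  have h3 : (1 + l) * (S.card * B.mass i x r R) ≤
      (1 + l) * (S.card * (θ.fMax * (ballVol D * R ^ (D + 1)))) := by gcongr
  have hk : (0 : ℝ) ≤ k := Nat.cast_nonneg k
  nlinarith

end Compare

end ModalBandit

namespace ModalBandit

/-! ### The collection loop -/

section Collect

variable {C : ℝ → Set ℝ} {f : ℝ → ℝ} {p : ℕ} {L : List ℝ} {M T : Set ℝ} {anc : ℝ → ℝ}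

/-- The hypotheses under which the collection loop finds the `p` highest modes. The points of the
list `L` are sorted by the estimated density `f`, the sets `C a` are the candidate regions, `M` is
the set of modes, `T` the set of the `p` highest ones, and `anc t` is a point of `L` that
represents the mode `t`. -/
structure CollectSetup (C : ℝ → Set ℝ) (f : ℝ → ℝ) (p : ℕ) (L : List ℝ) (M T : Set ℝ)
    (anc : ℝ → ℝ) : Prop where
  sorted : L.Pairwise (fun a b => f b ≤ f a)
  anc_mem : ∀ t ∈ M, anc t ∈ L
  self_mem : ∀ a ∈ L, a ∈ C a
  nested : ∀ a ∈ L, ∀ b ∈ L, f b ≤ f a → (C a ∩ C b).Nonempty → C a ⊆ C b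
  exists_mode : ∀ a ∈ L, ∃ t ∈ M, anc t ∈ C a
  unique_mode : ∀ a ∈ L, ∀ t ∈ M, ∀ t' ∈ M, f (anc t) ≤ f a → anc t ∈ C a → anc t' ∈ C a → t' = t
  top_first : ∀ a ∈ L, ∀ t ∈ M, f (anc t) ≤ f a → anc t ∈ C a → t ∉ T → ∀ j ∈ T, f a < f (anc j)
  subset : T ⊆ M
  encard_eq : T.encard = min (p : ℕ∞) M.encard

/-- The set `A` is the region of the list point `a`, and it belongs to the mode `t`: it contains
the representative of `t`, which does not precede `a`. -/
def IsRegionOf (C : ℝ → Set ℝ) (f : ℝ → ℝ) (anc : ℝ → ℝ) (A : Set ℝ) (a t : ℝ) : Prop :=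
  A = C a ∧ f (anc t) ≤ f a ∧ anc t ∈ C a

namespace CollectSetup

theorem covered (h : CollectSetup C f p L M T anc) {pre : List ℝ} {acc : List (Set ℝ)}
    (hpre : ∀ a ∈ pre, a ∈ L)
    (h1 : ∀ A ∈ acc, ∃ a ∈ pre, ∃ t ∈ T, IsRegionOf C f anc A a t)
    (h2 : ∀ a ∈ pre, ∃ a' ∈ pre, C a' ∈ acc ∧ f a ≤ f a' ∧ (C a' ∩ C a).Nonempty)
    {j : ℝ} (hj : j ∈ M) (hjpre : anc j ∈ pre) :
    ∃ A ∈ acc, ∃ a ∈ pre, IsRegionOf C f anc A a j := by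
  obtain ⟨a', ha', hacc, hle, hne⟩ := h2 _ hjpre
  have hsub := h.nested a' (hpre _ ha') _ (h.anc_mem j hj) hle hne
  obtain ⟨a, -, t, ht, hA, -, hmem⟩ := h1 _ hacc
  rw [← hA] at hmem
  have htj : t = j := h.unique_mode _ (h.anc_mem j hj) j hj t (h.subset ht) le_rfl
    (h.self_mem _ (h.anc_mem j hj)) (hsub hmem)
  subst htj
  exact ⟨C a', hacc, a', ha', rfl, hle, hmem⟩

theorem encard_le (h : CollectSetup C f p L M T anc) : T.encard ≤ p :=
  h.encard_eq.trans_le (min_le_left _ _)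

/-- The number of top modes that have a region among finitely many sets is at most the number of
these sets, as a region belongs to one mode only. -/
theorem encard_le_length (h : CollectSetup C f p L M T anc) {acc : List (Set ℝ)}
    (hT : ∀ j ∈ T, ∃ A ∈ acc, ∃ a ∈ L, IsRegionOf C f anc A a j) :
    T.encard ≤ acc.length := by
  classical
  choose! F hF a ha hreg using hT
  have hinj : Set.InjOn F T := by
    intro j hj j' hj' heq
    have h1 := hreg j hj
    have h2 := hreg j' hj'
    have h3 : C (a j) = C (a j') := h1.1.symm.trans (heq.trans h2.1)
    exact h.unique_mode _ (ha j' hj') j' (h.subset hj') j (h.subset hj) h2.2.1 h2.2.2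
      (h3 ▸ h1.2.2)
  have hmaps : F '' T ⊆ (acc.toFinset : Set (Set ℝ)) := by
    rintro _ ⟨j, hj, rfl⟩
    simpa using hF j hj
  calc T.encard = (F '' T).encard := hinj.encard_image.symm
    _ ≤ (acc.toFinset : Set (Set ℝ)).encard := Set.encard_le_encard hmaps
    _ = acc.toFinset.card := Set.encard_coe_eq_coe_finsetCard _
    _ ≤ acc.length := by exact_mod_cast List.toFinset_card_le acc

/-- Once `p` disjoint regions of top modes are collected, all top modes have a region. -/
theorem covered_of_length_eq (h : CollectSetup C f p L M T anc) {acc : List (Set ℝ)}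
    (h1 : ∀ A ∈ acc, ∃ a ∈ L, ∃ t ∈ T, IsRegionOf C f anc A a t)
    (h3 : acc.Pairwise Disjoint) (hlen : acc.length = p) :
    ∀ j ∈ T, ∃ A ∈ acc, ∃ a ∈ L, IsRegionOf C f anc A a j := by
  classical
  choose! a ha t ht hreg using h1
  have hmem : ∀ A ∈ acc, anc (t A) ∈ A := fun A hA => by
    have := (hreg A hA).2.2
    rwa [← (hreg A hA).1] at this
  have hnodup : acc.Nodup := by
    rw [List.Nodup]
    refine h3.imp_of_mem ?_
    rintro A A' hA - hd rfl
    exact Set.disjoint_left.1 hd (hmem A hA) (hmem A hA)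
  have hinj : Set.InjOn t (acc.toFinset : Set (Set ℝ)) := by
    intro A hA A' hA' heq
    by_contra hne
    rw [Finset.mem_coe, List.mem_toFinset] at hA hA'
    have hd : Disjoint A A' := h3.forall hA hA' hne
    have h5 := hmem A' hA'
    rw [← heq] at h5
    exact Set.disjoint_left.1 hd (hmem A hA) h5
  have hsub : t '' (acc.toFinset : Set (Set ℝ)) ⊆ T := by
    rintro _ ⟨A, hA, rfl⟩
    exact ht A (by simpa using hA)
  have hcard : T.encard ≤ (t '' (acc.toFinset : Set (Set ℝ))).encard := by
    rw [hinj.encard_image, Set.encard_coe_eq_coe_finsetCard, List.toFinset_card_of_nodup hnodup,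
      hlen]
    exact h.encard_le
  have heq := ((acc.toFinset.finite_toSet).image t).eq_of_subset_of_encard_le hsub hcard
  intro j hj
  rw [← heq] at hj
  obtain ⟨A, hA, rfl⟩ := hj
  have hA' : A ∈ acc := by simpa using hA
  exact ⟨A, hA', a A, ha A hA', hreg A hA'⟩

/-- The loop, started in a state that satisfies its invariant (every collected set is a region of
a top mode, every processed point has a region that meets a set collected no later, the collected
sets are disjoint), ends with regions of exactly the top modes. -/
theorem collect_spec_aux (h : CollectSetup C f p L M T anc) :
    ∀ (l pre : List ℝ) (acc : List (Set ℝ)), L = pre ++ l →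
    (∀ A ∈ acc, ∃ a ∈ pre, ∃ t ∈ T, IsRegionOf C f anc A a t) →
    (∀ a ∈ pre, ∃ a' ∈ pre, C a' ∈ acc ∧ f a ≤ f a' ∧ (C a' ∩ C a).Nonempty) →
    acc.Pairwise Disjoint → acc.length < p →
    (∀ A ∈ collect C p l acc, ∃ a ∈ L, ∃ t ∈ T, IsRegionOf C f anc A a t) ∧
    (∀ j ∈ T, ∃ A ∈ collect C p l acc, ∃ a ∈ L, IsRegionOf C f anc A a j) := by
  intro l
  induction l with
  | nil =>
    intro pre acc hL h1 h2 _ _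
    rw [List.append_nil] at hL
    subst hL
    exact ⟨h1, fun j hj => h.covered (fun _ h => h) h1 h2 (h.subset hj)
      (h.anc_mem j (h.subset hj))⟩
  | cons a l ih =>
    intro pre acc hL h1 h2 h3 hlen
    have hpre : ∀ b ∈ pre, b ∈ L := fun b hb => hL ▸ List.mem_append_left _ hb
    have haL : a ∈ L := hL ▸ by simp
    have hsort := h.sorted
    rw [hL, List.pairwise_append, List.pairwise_cons] at hsort
    have hsplit : ∀ b ∈ L, b ∈ pre ∧ f a ≤ f b ∨ f b ≤ f a := by
      intro b hb
      rw [hL, List.mem_append, List.mem_cons] at hb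
      rcases hb with hb | rfl | hb
      · exact Or.inl ⟨hb, hsort.2.2 b hb a (by simp)⟩
      · exact Or.inr le_rfl
      · exact Or.inr (hsort.2.1.1 b hb)
    have hL' : L = (pre ++ [a]) ++ l := by rw [hL]; simp
    by_cases hdis : ∀ A ∈ acc, Disjoint (C a) A
    · obtain ⟨t, htM, htC⟩ := h.exists_mode a haL
      have hfa : f (anc t) ≤ f a := by
        rcases hsplit _ (h.anc_mem t htM) with ⟨hp, hle⟩ | hle
        · exfalso
          obtain ⟨a', ha', hacc, hle', hne⟩ := h2 _ hp
          have hs1 := h.nested a' (hpre _ ha') _ (h.anc_mem t htM) hle' hne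
          have hs2 := h.nested _ (h.anc_mem t htM) a haL hle
            ⟨anc t, h.self_mem _ (h.anc_mem t htM), htC⟩
          have := h.self_mem a' (hpre _ ha')
          exact Set.disjoint_left.1 (hdis _ hacc) (hs2 (hs1 this)) this
        · exact hle
      have htT : t ∈ T := by
        by_contra htT
        have hcov : ∀ j ∈ T, ∃ A ∈ acc, ∃ b ∈ L, IsRegionOf C f anc A b j := by
          intro j hj
          have hlt := h.top_first a haL t htM hfa htC htT j hj
          rcases hsplit _ (h.anc_mem j (h.subset hj)) with ⟨hp, -⟩ | hle
          · obtain ⟨A, hA, b, hb, hr⟩ := h.covered hpre h1 h2 (h.subset hj) hp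
            exact ⟨A, hA, b, hpre b hb, hr⟩
          · exact absurd hle (not_le.2 hlt)
        have hTp : T.encard < p :=
          (h.encard_le_length hcov).trans_lt (by exact_mod_cast hlen)
        have hTM : T.encard = M.encard := by
          rcases min_choice (p : ℕ∞) M.encard with h' | h'
          · exact absurd (h.encard_eq.trans h') hTp.ne
          · exact h.encard_eq.trans h'
        have hfin : T.Finite := Set.finite_of_encard_le_coe h.encard_le
        exact htT ((hfin.eq_of_subset_of_encard_le h.subset hTM.ge) ▸ htM)
      have h1' : ∀ A ∈ C a :: acc, ∃ b ∈ pre ++ [a], ∃ t ∈ T, IsRegionOf C f anc A b t := by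
        intro A hA
        rcases List.mem_cons.1 hA with rfl | hA
        · exact ⟨a, by simp, t, htT, rfl, hfa, htC⟩
        · obtain ⟨b, hb, hr⟩ := h1 A hA
          exact ⟨b, List.mem_append_left _ hb, hr⟩
      have h2' : ∀ b ∈ pre ++ [a], ∃ a' ∈ pre ++ [a], C a' ∈ C a :: acc ∧ f b ≤ f a' ∧
          (C a' ∩ C b).Nonempty := by
        intro b hb
        rcases List.mem_append.1 hb with hb | hb
        · obtain ⟨a', ha', hr, hr'⟩ := h2 b hb
          exact ⟨a', List.mem_append_left _ ha', List.mem_cons_of_mem _ hr, hr'⟩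
        · rw [List.mem_singleton] at hb
          subst hb
          exact ⟨b, by simp, by simp, le_rfl, b, h.self_mem b haL, h.self_mem b haL⟩
      have h3' : (C a :: acc).Pairwise Disjoint := List.pairwise_cons.2 ⟨hdis, h3⟩
      rw [collect]
      simp only [if_pos hdis]
      by_cases hp : (C a :: acc).length = p
      · rw [if_pos hp]
        have h1'' : ∀ A ∈ C a :: acc, ∃ b ∈ L, ∃ t ∈ T, IsRegionOf C f anc A b t := by
          intro A hA
          obtain ⟨b, hb, hr⟩ := h1' A hA
          exact ⟨b, hL' ▸ List.mem_append_left _ hb, hr⟩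
        exact ⟨h1'', h.covered_of_length_eq h1'' h3' hp⟩
      · rw [if_neg hp]
        refine ih _ _ hL' h1' h2' h3' ?_
        rw [List.length_cons] at hp ⊢
        omega
    · have h1' : ∀ A ∈ acc, ∃ b ∈ pre ++ [a], ∃ t ∈ T, IsRegionOf C f anc A b t := by
        intro A hA
        obtain ⟨b, hb, hr⟩ := h1 A hA
        exact ⟨b, List.mem_append_left _ hb, hr⟩
      have h2' : ∀ b ∈ pre ++ [a], ∃ a' ∈ pre ++ [a], C a' ∈ acc ∧ f b ≤ f a' ∧
          (C a' ∩ C b).Nonempty := by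
        intro b hb
        rcases List.mem_append.1 hb with hb | hb
        · obtain ⟨a', ha', hr, hr'⟩ := h2 b hb
          exact ⟨a', List.mem_append_left _ ha', hr, hr'⟩
        · rw [List.mem_singleton] at hb
          subst hb
          push Not at hdis
          obtain ⟨A, hA, hnd⟩ := hdis
          obtain ⟨a', ha', t, ht, hr⟩ := h1 A hA
          refine ⟨a', List.mem_append_left _ ha', hr.1 ▸ hA, hsort.2.2 a' ha' b (by simp), ?_⟩
          rw [Set.not_disjoint_iff_nonempty_inter, Set.inter_comm] at hnd
          rwa [← hr.1]
      rw [collect]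
      simp only [if_neg hdis, if_neg hlen.ne]
      exact ih _ _ hL' h1' h2' h3 hlen

theorem collect_spec (h : CollectSetup C f p L M T anc) (hp : 1 ≤ p) :
    (∀ A ∈ collect C p L [], ∃ a ∈ L, ∃ t ∈ T, IsRegionOf C f anc A a t) ∧
    (∀ j ∈ T, ∃ A ∈ collect C p L [], ∃ a ∈ L, IsRegionOf C f anc A a j) :=
  h.collect_spec_aux L [] [] rfl (by simp) (by simp) List.Pairwise.nil hp

end CollectSetup

end Collect

/-! ### The grid -/

theorem mem_grid {m : ℕ} {r : ℝ} : r ∈ grid m ↔ ∃ j : ℕ, 1 ≤ j ∧ j < m ∧ r = (j : ℝ) / m := by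
  simp only [grid, List.bind_eq_flatMap, List.pure_def, List.mem_map, List.mem_flatMap,
    List.mem_range, List.mem_singleton]
  constructor
  · rintro ⟨_, ⟨j, hj, rfl⟩, rfl⟩
    exact ⟨j + 1, by omega, by omega, by push_cast; rfl⟩
  · rintro ⟨j, h1, h2, rfl⟩
    refine ⟨_, ⟨j - 1, by omega, rfl⟩, ?_⟩
    rw [Nat.cast_sub h1]
    simp

theorem mem_Icc_of_mem_grid {m : ℕ} {r : ℝ} (h : r ∈ grid m) : r ∈ Icc (0 : ℝ) 1 := by
  obtain ⟨j, h1, h2, rfl⟩ := mem_grid.1 h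
  exact ⟨by positivity, div_le_one_of_le₀ (by exact_mod_cast h2.le) (Nat.cast_nonneg m)⟩

/-- Every point of `[0, 1]` has a grid point nearby whose distance from the boundary is at
least `R`. -/
theorem exists_grid_near {m : ℕ} {R t : ℝ} (hm : 0 < m) (hR : 0 < R) (hRm : 2 * R + 1 / m ≤ 1)
    (ht : t ∈ Icc (0 : ℝ) 1) : ∃ s ∈ grid m, s ∈ Icc R (1 - R) ∧ |s - t| ≤ R + 2 / m := by
  have hm' : (0 : ℝ) < m := by exact_mod_cast hm
  have hm1 : 0 < 1 / (m : ℝ) := by positivity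
  set c := max R (min t (1 - R - 1 / m)) with hc
  have hc1 : R ≤ c := le_max_left _ _
  have hc2 : c ≤ 1 - R - 1 / m := max_le (by linarith) (min_le_right _ _)
  have hct : |c - t| ≤ R + 1 / m := by
    rw [abs_le]
    constructor
    · have : min t (1 - R - 1 / m) ≤ c := le_max_right _ _
      rcases min_cases t (1 - R - 1 / m) with ⟨h, -⟩ | ⟨h, -⟩ <;> linarith [ht.2]
    · have : c ≤ max R t := max_le_max_left _ (min_le_left _ _)
      rcases max_cases R t with ⟨h, -⟩ | ⟨h, -⟩ <;> linarith [ht.1]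
  set j := ⌈c * m⌉₊ with hj
  have hcm : 0 < c * m := mul_pos (hR.trans_le hc1) hm'
  have hj1 : c * m ≤ j := Nat.le_ceil _
  have hj2 : (j : ℝ) < c * m + 1 := Nat.ceil_lt_add_one hcm.le
  have hs1 : c ≤ (j : ℝ) / m := (le_div_iff₀ hm').2 hj1
  have hs2 : (j : ℝ) / m ≤ c + 1 / m := by
    rw [div_le_iff₀ hm', add_mul, one_div_mul_cancel hm'.ne']
    exact hj2.le
  refine ⟨(j : ℝ) / m, mem_grid.2 ⟨j, Nat.ceil_pos.2 hcm, ?_, rfl⟩, ⟨hc1.trans hs1, by linarith⟩, ?_⟩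
  · have : (j : ℝ) < m := by
      have : (j : ℝ) / m < 1 := by linarith
      rwa [div_lt_one hm'] at this
    exact_mod_cast this
  · have : (2 : ℝ) / m = 1 / m + 1 / m := by ring
    rw [abs_le] at hct ⊢
    constructor <;> linarith [hct.1, hct.2]

/-! ### Graphs of level sets of the density estimate -/

section Level

variable {D : ℕ} {S : Multiset (ℝ × Ctx D)} {k m : ℕ} {x : Ctx D}

theorem levelGraph_mono {γ γ' : ℝ} (h : γ' ≤ γ) :
    levelGraph S k m x γ ≤ levelGraph S k m x γ' := fun _ _ hab =>
  ⟨hab.1, ⟨hab.2.1.1, h.trans_lt hab.2.1.2⟩, ⟨hab.2.2.1.1, h.trans_lt hab.2.2.1.2⟩, hab.2.2.2⟩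

theorem levelComponent_subset {γ γ' a b : ℝ} (h : γ' ≤ γ)
    (hne : (levelComponent S k m x γ a ∩ levelComponent S k m x γ' b).Nonempty) :
    levelComponent S k m x γ a ⊆ levelComponent S k m x γ' b := by
  obtain ⟨z, hza, hzb⟩ := hne
  intro w hw
  refine ⟨⟨hw.1.1, h.trans_lt hw.1.2⟩, ?_⟩
  exact hzb.2.trans ((hza.2.mono (levelGraph_mono h)).symm.trans (hw.2.mono (levelGraph_mono h)))

/-- A segment of the grid all of whose points are vertices is connected, if no nearest-neighbour
radius falls below the mesh. -/
theorem reachable_of_segment {γ a b : ℝ} (hmesh : ∀ s ∈ grid m, 1 / (m : ℝ) ≤ knnRadius S k x s)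
    (ha : a ∈ grid m) (hb : b ∈ grid m)
    (hseg : ∀ s ∈ grid m, s ∈ uIcc a b → s ∈ levelVertices S k m x γ) :
    (levelGraph S k m x γ).Reachable a b := by
  wlog hab : a ≤ b generalizing a b
  · exact (this hb ha (fun s hs hs' => hseg s hs (uIcc_comm a b ▸ hs')) (le_of_not_ge hab)).symm
  obtain ⟨i, hi1, hi2, rfl⟩ := mem_grid.1 ha
  obtain ⟨j, hj1, hj2, rfl⟩ := mem_grid.1 hb
  have hm : (0 : ℝ) < m := by exact_mod_cast (by omega : 0 < m)
  have hij : i ≤ j := by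
    have := (div_le_div_iff_of_pos_right hm).1 hab
    exact_mod_cast this
  rw [uIcc_of_le hab] at hseg
  have key : ∀ n, i ≤ n → n ≤ j →
      (levelGraph S k m x γ).Reachable ((i : ℝ) / m) ((n : ℝ) / m) := by
    intro n hin
    induction n, hin using Nat.le_induction with
    | base => intro _; exact SimpleGraph.Reachable.refl _
    | succ n hin ih =>
      intro hnj
      refine (ih (by omega)).trans (SimpleGraph.Adj.reachable ?_)
      have hv : ∀ q : ℕ, i ≤ q → q ≤ j → ((q : ℝ) / m ∈ grid m ∧
          (q : ℝ) / m ∈ levelVertices S k m x γ) := by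
        intro q hq1 hq2
        have hg : (q : ℝ) / m ∈ grid m := mem_grid.2 ⟨q, by omega, by omega, rfl⟩
        refine ⟨hg, hseg _ hg ⟨?_, ?_⟩⟩
        · have : (i : ℝ) ≤ q := by exact_mod_cast hq1
          gcongr
        · have : (q : ℝ) ≤ j := by exact_mod_cast hq2
          gcongr
      have hd : ((n : ℝ) / m) - ((n + 1 : ℕ) : ℝ) / m = -(1 / m) := by push_cast; ring
      refine ⟨fun heq => ?_, (hv n hin (by omega)).2, (hv (n + 1) (by omega) hnj).2, ?_⟩
      · rw [heq, sub_self] at hd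
        have : 0 < 1 / (m : ℝ) := by positivity
        linarith
      · rw [hd, abs_neg, abs_of_pos (by positivity)]
        exact le_min (hmesh _ (hv n hin (by omega)).1) (hmesh _ (hv (n + 1) (by omega) hnj).1)
  exact key j hij le_rfl

end Level

end ModalBandit

namespace ModalBandit

variable {D K : ℕ}

/-! ### The conditional mode estimator on a good sample -/

/-- A good sample together with a radius `R` below which all the relevant nearest-neighbour radii
lie, and a radius `R₁` that bounds those of grid points near modes. -/
structure KnnSetup (B : Environment D K) (θ : Params) (i : Fin K) (S : Multiset (ℝ × Ctx D))
    (k m : ℕ) (l R R₁ : ℝ) : Prop where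
  regular : Regular B θ
  good : GoodSample B i S k l
  l_nonneg : 0 ≤ l
  l_le : l ≤ 1 / 16
  k_pos : 0 < k
  k_le : k ≤ S.card
  R₁_pos : 0 < R₁
  R₁_le : 2 * R₁ ≤ R
  R_le : R ≤ 1 / 4
  R_le_ρ₀ : R ≤ θ.ρ₀
  m_pos : 0 < m
  m_inv_le : 1 / (m : ℝ) ≤ 1 / 2
  near : R + 2 / m ≤ θ.rM
  density : θ.cUp * (R + 2 / m) ^ 2 + θ.Cα * R ^ θ.α ≤ θ.lam / 2
  radius : 4 * k ≤ S.card * (θ.lam * slabConst θ D * R₁ ^ (D + 1))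

/-- The accuracy with which densities at modes are compared through nearest-neighbour radii that
agree up to the factor `1 + τ`. -/
def compError (θ : Params) (D m : ℕ) (l R τ : ℝ) : ℝ :=
  compConst θ D * (l + θ.Cα * R ^ θ.α + τ) + θ.cUp * (R + 2 / m) ^ 2

/-- The grid point `s` represents the mode `t` of the density of arm `i`: it is close to `t`, well
inside `[0, 1]`, and has almost the same density and a small nearest-neighbour radius. -/
structure IsAnchor (B : Environment D K) (θ : Params) (i : Fin K) (S : Multiset (ℝ × Ctx D))
    (k m : ℕ) (R R₁ : ℝ) (x : Ctx D) (t s : ℝ) : Prop where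
  mem_grid : s ∈ grid m
  mem_Icc : s ∈ Icc R (1 - R)
  near : |s - t| ≤ R + 2 / m
  density : B.f i t x - θ.cUp * (R + 2 / m) ^ 2 ≤ B.f i s x
  radius : knnRadius S k x s ≤ R₁

namespace KnnSetup

variable {B : Environment D K} {θ : Params} {i : Fin K} {S : Multiset (ℝ × Ctx D)} {k m : ℕ}
  {l R R₁ : ℝ} {x : Ctx D}

theorem R_pos (h : KnnSetup B θ i S k m l R R₁) : 0 < R := by
  linarith [h.R₁_pos, h.R₁_le]

theorem knnRadius_pos (h : KnnSetup B θ i S k m l R R₁) (hx : x ∈ B.𝒳) {r : ℝ}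
    (hr : r ∈ Icc (0 : ℝ) 1) : 0 < knnRadius S k x r := by
  set c := 2 * (S.card * (θ.fMax * ballVol D)) + 1 with hc
  have hc1 : 1 ≤ c := by
    have := (h.regular.fMax_pos i).le
    have := ballVol_nonneg D
    rw [hc]
    have : 0 ≤ (S.card : ℝ) * (θ.fMax * ballVol D) := by positivity
    linarith
  have hc0 : 0 < c := by linarith
  have hR1 : 1 / c ≤ 1 := by rw [div_le_one hc0]; exact hc1
  refine lt_trans (show 0 < 1 / c by positivity) (h.regular.lt_knnRadius h.good h.l_nonneg h.l_le
    h.k_le hx hr (by positivity) hR1 ?_)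
  have h1 : (1 / c) ^ (D + 1) ≤ 1 / c := by
    rw [pow_succ]
    exact mul_le_of_le_one_left (by positivity) (pow_le_one₀ (by positivity) hR1)
  have h2 : (1 : ℝ) ≤ k := by exact_mod_cast h.k_pos
  have h3 : (c - 1) * (1 / c) ^ (D + 1) ≤ (c - 1) * (1 / c) := by
    have : 0 ≤ c - 1 := by linarith
    gcongr
  have h4 : (c - 1) * (1 / c) < 1 := by
    rw [mul_one_div, div_lt_one hc0]; linarith
  calc _ = (c - 1) * (1 / c) ^ (D + 1) := by rw [hc]; ring
    _ < 1 := h3.trans_lt h4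
    _ ≤ k := h2

theorem exists_anchor (h : KnnSetup B θ i S k m l R R₁) (hx : x ∈ B.𝒳) {t : ℝ}
    (ht : t ∈ modes fun r => B.f i r x) : ∃ s, IsAnchor B θ i S k m R R₁ x t s := by
  have hR := h.R_pos
  obtain ⟨s, hsg, hsI, hst⟩ := exists_grid_near h.m_pos hR (by linarith [h.R_le, h.m_inv_le]) ht.1
  have hs := mem_Icc_of_mem_grid hsg
  have hshape := h.regular.modalShape i hx
  have hcU := θ.cUp_pos
  have h1 : B.f i t x - θ.cUp * (R + 2 / m) ^ 2 ≤ B.f i s x := by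
    refine le_trans ?_ (hshape.le_quad t ht s hs (by rw [abs_sub_comm]; exact hst.trans h.near))
    have : (t - s) ^ 2 ≤ (R + 2 / m) ^ 2 := by
      rw [← sq_abs, abs_sub_comm]
      gcongr
    gcongr
  refine ⟨s, hsg, hsI, hst, h1, ?_⟩
  have hR₁ := h.R₁_pos
  have hR₁R : R₁ ≤ R := by linarith [h.R₁_le]
  have h2 : θ.Cα * R₁ ^ θ.α ≤ θ.Cα * R ^ θ.α :=
    mul_le_mul_of_nonneg_left (Real.rpow_le_rpow hR₁.le hR₁R θ.α_pos.le) (h.regular.Cα_nonneg i)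
  have h3 := hshape.lower t ht
  exact h.regular.knnRadius_le_of_density h.good h.l_le hx hs hR₁
    (by linarith [h.R_le]) (hR₁R.trans h.R_le_ρ₀) (by linarith [h.density]) h.radius

theorem le_of_anchor (h : KnnSetup B θ i S k m l R R₁) (hx : x ∈ B.𝒳) {t s a τ : ℝ}
    (hs : IsAnchor B θ i S k m R R₁ x t s) (ha : a ∈ Icc (0 : ℝ) 1) (hτ : 0 < τ) (hτ1 : τ ≤ 1)
    (has : knnRadius S k x a ≤ (1 + τ) * knnRadius S k x s) :
    B.f i t x - compError θ D m l R τ ≤ B.f i a x := by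
  have hpos := h.knnRadius_pos hx (mem_Icc_of_mem_grid hs.mem_grid)
  have h1 := h.regular.le_of_knnRadius_le h.good h.l_nonneg h.l_le h.k_pos h.k_le hx hs.mem_Icc ha
    hpos hτ hτ1 (by
      calc (1 + τ) * knnRadius S k x s ≤ (1 + 1) * R₁ := by gcongr; exact hs.radius
        _ ≤ R := by linarith [h.R₁_le]) (by linarith [h.R_le]) h.R_le_ρ₀ has
  rw [compError]
  linarith [hs.density]

theorem le_of_anchor' (h : KnnSetup B θ i S k m l R R₁) (hx : x ∈ B.𝒳) {t s a : ℝ}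
    (hs : IsAnchor B θ i S k m R R₁ x t s) (ha : a ∈ Icc (0 : ℝ) 1)
    (has : knnRadius S k x a ≤ knnRadius S k x s) :
    B.f i t x - compError θ D m l R R ≤ B.f i a x := by
  have hR := h.R_pos
  refine h.le_of_anchor hx hs ha hR (by linarith [h.R_le]) (has.trans ?_)
  have := knnRadius_nonneg S k x s
  nlinarith

/-- The mode estimate is close to the highest mode `t` if the other modes are lower by more than
the accuracy of the comparison. -/
theorem modeEstimate_close (h : KnnSetup B θ i S k m l R R₁) (hx : x ∈ B.𝒳) {t a : ℝ}
    (ht : t ∈ modes fun r => B.f i r x)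
    (htop : ∀ t' ∈ modes (fun r => B.f i r x), t' ≠ t →
      B.f i t' x < B.f i t x - compError θ D m l R R)
    (hE : compError θ D m l R R < θ.cLow * θ.rM ^ 2) (ha : IsModeEstimate S k m x a) :
    θ.cLow * (t - a) ^ 2 ≤ compError θ D m l R R := by
  obtain ⟨s, hs⟩ := h.exists_anchor hx ht
  have haI := mem_Icc_of_mem_grid ha.1
  exact (h.regular.modalShape i hx).quad_sub_le θ.rM_pos ht htop hE haI
    (h.le_of_anchor' hx hs haI (ha.2 s hs.mem_grid))

end KnnSetup

/-! ### The conditional `p`-mode estimator on a good sample -/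

/-- The volume of the unit ball of `ℝ^(D+1)`, the normalizing constant of the density estimate. -/
def unitBallVol (D : ℕ) : ℝ :=
  (volume (Metric.ball (0 : EuclideanSpace ℝ (Fin (D + 1))) 1)).toReal

theorem unitBallVol_pos (D : ℕ) : 0 < unitBallVol D :=
  ENNReal.toReal_pos (Metric.measure_ball_pos volume _ one_pos).ne' measure_ball_lt_top.ne

theorem knnDensity_eq (S : Multiset (ℝ × Ctx D)) (k : ℕ) (x : Ctx D) (r : ℝ) :
    knnDensity S k x r = k / (unitBallVol D * S.card * knnRadius S k x r ^ (D + 1)) := rfl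

theorem knnDensity_nonneg (S : Multiset (ℝ × Ctx D)) (k : ℕ) (x : Ctx D) (r : ℝ) :
    0 ≤ knnDensity S k x r := by
  have := (unitBallVol_pos D).le
  have := knnRadius_nonneg S k x r
  rw [knnDensity_eq]
  positivity

section Density

variable {S : Multiset (ℝ × Ctx D)} {k : ℕ} {x : Ctx D} {a b : ℝ}

theorem knnDensity_le_iff (hk : 0 < k) (hkS : k ≤ S.card) (ha : 0 < knnRadius S k x a)
    (hb : 0 < knnRadius S k x b) :
    knnDensity S k x a ≤ knnDensity S k x b ↔ knnRadius S k x b ≤ knnRadius S k x a := by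
  have hv := unitBallVol_pos D
  have hk' : (0 : ℝ) < k := by exact_mod_cast hk
  have hN : (0 : ℝ) < S.card := by exact_mod_cast hk.trans_le hkS
  rw [knnDensity_eq, knnDensity_eq, div_le_div_iff_of_pos_left hk' (by positivity) (by positivity),
    mul_le_mul_iff_right₀ (by positivity), pow_le_pow_iff_left₀ hb.le ha.le (by omega)]

theorem mul_knnDensity_eq {k : ℕ} (hkS : 0 < S.card) (ha : 0 < knnRadius S k x a) :
    knnDensity S k x a * (unitBallVol D * S.card * knnRadius S k x a ^ (D + 1)) = k := by
  have hv := unitBallVol_pos D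
  have hN : (0 : ℝ) < S.card := by exact_mod_cast hkS
  rw [knnDensity_eq, div_mul_cancel₀]
  positivity

/-- If the radius grows by the factor `1 + τ` at most, then the density estimate decreases by the
proportion `(D + 1) τ` at most. -/
theorem knnDensity_ge_of_radius_le {τ : ℝ} (hk : 0 < k) (hkS : k ≤ S.card)
    (ha : 0 < knnRadius S k x a) (hb : 0 < knnRadius S k x b) (hτ : 0 ≤ τ) (hτ1 : τ ≤ 1)
    (h : knnRadius S k x b ≤ (1 + τ) * knnRadius S k x a) :
    (1 - (D + 1) * τ) * knnDensity S k x a ≤ knnDensity S k x b := by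
  have hv := unitBallVol_pos D
  have hN' : 0 < S.card := hk.trans_le hkS
  have hN : (0 : ℝ) < S.card := by exact_mod_cast hN'
  have ea := mul_knnDensity_eq (x := x) (k := k) hN' ha
  have eb := mul_knnDensity_eq (x := x) (k := k) hN' hb
  have hfa := knnDensity_nonneg S k x a
  have hfb := knnDensity_nonneg S k x b
  set c := unitBallVol D * S.card with hc
  have hc0 : 0 < c := by positivity
  have h1 : knnRadius S k x b ^ (D + 1) ≤ (1 + τ) ^ (D + 1) * knnRadius S k x a ^ (D + 1) := by
    rw [← mul_pow]; gcongr
  have h2 : knnDensity S k x a * (c * knnRadius S k x a ^ (D + 1)) ≤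
      (knnDensity S k x b * (1 + τ) ^ (D + 1)) * (c * knnRadius S k x a ^ (D + 1)) := by
    calc _ = knnDensity S k x b * (c * knnRadius S k x b ^ (D + 1)) := by rw [ea, eb]
      _ ≤ knnDensity S k x b * (c * ((1 + τ) ^ (D + 1) * knnRadius S k x a ^ (D + 1))) := by gcongr
      _ = _ := by ring
  have h3 : knnDensity S k x a ≤ knnDensity S k x b * (1 + τ) ^ (D + 1) :=
    le_of_mul_le_mul_right h2 (by positivity)
  have h4 : 1 - (D + 1) * τ ≤ (1 - τ) ^ (D + 1) := by
    have := one_add_mul_le_pow (show -2 ≤ -τ by linarith) (D + 1)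
    push_cast at this
    rw [← sub_eq_add_neg] at this
    linarith
  have h5 : (1 - τ) ^ (D + 1) * (1 + τ) ^ (D + 1) ≤ 1 := by
    rw [← mul_pow]
    exact pow_le_one₀ (by nlinarith) (by nlinarith)
  calc (1 - (D + 1) * τ) * knnDensity S k x a
      ≤ (1 - τ) ^ (D + 1) * knnDensity S k x a := by gcongr
    _ ≤ (1 - τ) ^ (D + 1) * (knnDensity S k x b * (1 + τ) ^ (D + 1)) := by
        have : 0 ≤ 1 - τ := by linarith
        gcongr
    _ = knnDensity S k x b * ((1 - τ) ^ (D + 1) * (1 + τ) ^ (D + 1)) := by ring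
    _ ≤ knnDensity S k x b := mul_le_of_le_one_right hfb h5

/-- If the density estimate decreases by the proportion `ξ` at most, then the radius grows by the
factor `1 + 2 ξ` at most. -/
theorem radius_le_of_knnDensity_ge {ξ : ℝ} (hk : 0 < k) (hkS : k ≤ S.card)
    (ha : 0 < knnRadius S k x a) (hb : 0 < knnRadius S k x b) (hξ : 0 ≤ ξ) (hξ1 : ξ ≤ 1 / 2)
    (h : (1 - ξ) * knnDensity S k x a ≤ knnDensity S k x b) :
    knnRadius S k x b ≤ (1 + 2 * ξ) * knnRadius S k x a := by
  have hv := unitBallVol_pos D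
  have hN' : 0 < S.card := hk.trans_le hkS
  have hN : (0 : ℝ) < S.card := by exact_mod_cast hN'
  have hk' : (0 : ℝ) < k := by exact_mod_cast hk
  have ea := mul_knnDensity_eq (x := x) (k := k) hN' ha
  have eb := mul_knnDensity_eq (x := x) (k := k) hN' hb
  set c := unitBallVol D * S.card with hc
  have hc0 : 0 < c := by positivity
  refine le_of_pow_le_pow_left₀ (Nat.succ_ne_zero D) (by positivity) ?_
  rw [Nat.succ_eq_add_one, mul_pow]
  have hfa : 0 < knnDensity S k x a :=
    pos_of_mul_pos_left (by rw [ea]; exact hk') (by positivity)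
  have h1 : (1 - ξ) * (knnDensity S k x a * (c * knnRadius S k x b ^ (D + 1))) ≤
      knnDensity S k x a * (c * knnRadius S k x a ^ (D + 1)) := by
    calc _ = (1 - ξ) * knnDensity S k x a * (c * knnRadius S k x b ^ (D + 1)) := by ring
      _ ≤ knnDensity S k x b * (c * knnRadius S k x b ^ (D + 1)) := by gcongr
      _ = _ := by rw [ea, eb]
  have h2 : 1 ≤ (1 + 2 * ξ) ^ (D + 1) * (1 - ξ) := by
    have e1 : 1 ≤ (1 + 2 * ξ) * (1 - ξ) := by nlinarith
    have e2 : 1 + 2 * ξ ≤ (1 + 2 * ξ) ^ (D + 1) := le_self_pow₀ (by linarith) (by omega)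
    exact e1.trans (mul_le_mul_of_nonneg_right e2 (by linarith))
  have h3 : (1 - ξ) * knnRadius S k x b ^ (D + 1) ≤ knnRadius S k x a ^ (D + 1) := by
    refine le_of_mul_le_mul_left ?_ (mul_pos hfa hc0)
    linarith
  calc knnRadius S k x b ^ (D + 1)
      ≤ (1 + 2 * ξ) ^ (D + 1) * (1 - ξ) * knnRadius S k x b ^ (D + 1) :=
        le_mul_of_one_le_left (by positivity) h2
    _ = (1 + 2 * ξ) ^ (D + 1) * ((1 - ξ) * knnRadius S k x b ^ (D + 1)) := by ring
    _ ≤ _ := by gcongr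

end Density

/-- The first set that the estimator collects contains the first grid point, so the `1`-mode
estimator returns a grid point of smallest nearest-neighbour radius. -/
theorem KnnSetup.isModeEstimate {B : Environment D K} {θ : Params} {i : Fin K}
    {S : Multiset (ℝ × Ctx D)} {k m : ℕ} {l R R₁ : ℝ} {x : Ctx D}
    (h : KnnSetup B θ i S k m l R R₁) (hx : x ∈ B.𝒳) {δ ε r : ℝ} (hε : 0 < ε)
    (hβ : 0 ≤ betaWidth δ S.card k) (hr : IsPModeEstimate S 1 k m δ ε x r) :
    IsModeEstimate S k m x r := by
  obtain ⟨L, hperm, hsort, s, hs, ⟨A, hA, rfl⟩, -⟩ := hr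
  cases L with
  | nil => simp [collect] at hA
  | cons a L =>
    have hag : a ∈ grid m := hperm.subset (by simp)
    simp only [collect, List.not_mem_nil, false_imp_iff, implies_true, if_true, List.length_singleton,
      List.mem_singleton] at hA hs
    subst hA
    obtain ⟨hsA, hmax⟩ := hs _ rfl
    have hfa := hmax a ⟨⟨hag, by
      have := mul_nonneg hβ (knnDensity_nonneg S k x a)
      linarith⟩, SimpleGraph.Reachable.refl _⟩
    refine ⟨hsA.1.1, fun b hb => ?_⟩
    have hle : knnDensity S k x b ≤ knnDensity S k x a := by
      have := hperm.mem_iff.2 hb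
      rcases List.mem_cons.1 this with rfl | hbL
      · exact le_rfl
      · exact (List.pairwise_cons.1 hsort).1 b hbL
    exact (knnDensity_le_iff h.k_pos h.k_le (h.knnRadius_pos hx (mem_Icc_of_mem_grid hb))
      (h.knnRadius_pos hx (mem_Icc_of_mem_grid hsA.1.1))).1 (hle.trans hfa)

/-- The conditions on the slack `ε` and on the width `β` under which the `p`-mode estimator
separates the modes (`dip`) and rejects all other points (`path`, `level`). The radius `ρm` bounds
all nearest-neighbour radii from below, `τ` is the growth of radii that the slack allows, and `e`
is a loss of density along a segment that this growth makes up for. -/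
structure PModeSetup (B : Environment D K) (θ : Params) (i : Fin K) (S : Multiset (ℝ × Ctx D))
    (k m : ℕ) (l R R₁ β ε ξ rm ρm Q e τ : ℝ) : Prop extends KnnSetup B θ i S k m l R R₁ where
  β_nonneg : 0 ≤ β
  ε_pos : 0 < ε
  ξ_ge : β + ε * (unitBallVol D * S.card * R₁ ^ (D + 1)) / k ≤ ξ
  ξ_le : ξ ≤ 1 / 2
  ξ_pos : 0 < ξ
  rm_le : rm ≤ θ.rM
  R_add_lt : R + 2 / m < rm / 2
  dip : compError θ D m l R (2 * ξ) < θ.cLow * (rm / 2) ^ 2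
  mesh : 1 / (m : ℝ) ≤ ρm
  ρm_pos : 0 < ρm
  ρm_le : ρm ≤ 1
  ρm_lt : 2 * (S.card * (θ.fMax * (ballVol D * ρm ^ (D + 1)))) < k
  low : 2 ^ (D + 1) * k ≤ unitBallVol D * S.card * ε * R ^ (D + 1)
  Q_ge : ballVol D ≤ Q * (unitBallVol D * ε)
  e_pos : 0 < e
  path : 4 * (8 * l + (e + θ.Cα * (R + 2 / m) ^ θ.α + 2 * (θ.Cα * R ^ θ.α)) * Q) ≤ τ
  τ_le : τ ≤ 1
  level : (D + 1) * τ * k < ε * (unitBallVol D * S.card * ρm ^ (D + 1))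

namespace PModeSetup

variable {B : Environment D K} {θ : Params} {i : Fin K} {S : Multiset (ℝ × Ctx D)} {k m : ℕ}
  {l R R₁ β ε ξ rm ρm Q e τ : ℝ} {x : Ctx D}

theorem lt_knnRadius (h : PModeSetup B θ i S k m l R R₁ β ε ξ rm ρm Q e τ) (hx : x ∈ B.𝒳) {r : ℝ}
    (hr : r ∈ grid m) : ρm < knnRadius S k x r :=
  h.regular.lt_knnRadius h.good h.l_nonneg h.l_le h.k_le hx (mem_Icc_of_mem_grid hr) h.ρm_pos
    h.ρm_le h.ρm_lt

theorem card_pos (h : PModeSetup B θ i S k m l R R₁ β ε ξ rm ρm Q e τ) : 0 < S.card :=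
  h.k_pos.trans_le h.k_le

/-- Every grid point has a mode whose representative lies in the region of the point: the segment
to the representative of a mode above the point stays in the level set. -/
theorem exists_anchor_mem (h : PModeSetup B θ i S k m l R R₁ β ε ξ rm ρm Q e τ) (hx : x ∈ B.𝒳)
    {anc : ℝ → ℝ}
    (hanc : ∀ t ∈ modes (fun r => B.f i r x), IsAnchor B θ i S k m R R₁ x t (anc t))
    {r : ℝ} (hr : r ∈ grid m) :
    ∃ t ∈ modes (fun r => B.f i r x),
      anc t ∈ levelComponent S k m x (knnDensity S k x r - β * knnDensity S k x r - ε) r := by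
  have hrI := mem_Icc_of_mem_grid hr
  have hshape := h.regular.modalShape i hx
  obtain ⟨t, ht, -, hseg⟩ := exists_mode_above hshape.cont hshape.localMax hrI h.e_pos
  have ha := hanc t ht
  refine ⟨t, ht, ?_⟩
  set γ := knnDensity S k x r - β * knnDensity S k x r - ε with hγ
  have hf0 := knnDensity_nonneg S k x r
  have hβf := mul_nonneg h.β_nonneg hf0
  have hpos : ∀ s ∈ grid m, 0 < knnRadius S k x s := fun s hs =>
    h.knnRadius_pos hx (mem_Icc_of_mem_grid hs)
  have hvert : ∀ s ∈ grid m, s ∈ uIcc r (anc t) → s ∈ levelVertices S k m x γ := by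
    intro s hs hsu
    refine ⟨hs, ?_⟩
    rcases lt_or_ge (knnDensity S k x r) ε with hlow | hhigh
    · have := knnDensity_nonneg S k x s
      linarith
    have hsI := mem_Icc_of_mem_grid hs
    have hv := unitBallVol_pos D
    have hN : (0 : ℝ) < S.card := by exact_mod_cast h.card_pos
    have hρ := hpos r hr
    have hR := h.R_pos
    have heq := mul_knnDensity_eq (x := x) (k := k) h.card_pos hρ
    have hεμ : ε * (unitBallVol D * S.card * knnRadius S k x r ^ (D + 1)) ≤ k := by
      rw [← heq]; gcongr
    have h2ρ : 2 * knnRadius S k x r ≤ R := by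
      refine le_of_pow_le_pow_left₀ (Nat.succ_ne_zero D) hR.le ?_
      rw [Nat.succ_eq_add_one, mul_pow]
      have hc : 0 < unitBallVol D * S.card * ε := mul_pos (by positivity) h.ε_pos
      refine le_of_mul_le_mul_left ?_ hc
      have h2 : (2 : ℝ) ^ (D + 1) * (ε * (unitBallVol D * S.card * knnRadius S k x r ^ (D + 1))) ≤
        2 ^ (D + 1) * k := by gcongr
      linarith [h.low]
    -- a point `s'` of the segment between `r` and the mode that is close to `s`
    have hclose : ∃ s' ∈ uIcc r t, |s - s'| ≤ R + 2 / m := by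
      by_cases hst : s ∈ uIcc r t
      · exact ⟨s, hst, by simpa using (by positivity : 0 ≤ R + 2 / (m : ℝ))⟩
      · refine ⟨t, right_mem_uIcc, le_trans ?_ ha.near⟩
        rw [mem_uIcc] at hsu hst
        rw [not_or, not_and_or, not_and_or] at hst
        rcases hsu with ⟨h1, h2⟩ | ⟨h1, h2⟩
        · have h3 : t < s := by
            rcases hst.1 with h | h
            · exact absurd h1 h
            · exact not_le.1 h
          rw [abs_of_pos (by linarith), abs_of_pos (by linarith)]
          linarith
        · have h3 : s < t := by
            rcases hst.2 with h | h
            · exact not_le.1 h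
            · exact absurd h2 h
          rw [abs_of_neg (by linarith), abs_of_neg (by linarith)]
          linarith
    obtain ⟨s', hs', hss'⟩ := hclose
    have hs'I : s' ∈ Icc (0 : ℝ) 1 := ordConnected_Icc.uIcc_subset hrI ht.1 hs'
    have hC := h.regular.Cα_nonneg i
    have hg1 : |B.f i s x - B.f i s' x| ≤ θ.Cα * (R + 2 / m) ^ θ.α := by
      refine (h.regular.holder i x hx x hx s hsI s' hs'I).trans ?_
      refine mul_le_mul_of_nonneg_left (Real.rpow_le_rpow (jointDist_nonneg _ _) ?_ θ.α_pos.le) hC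
      refine (jointDist_le_add _ _).trans ?_
      simpa using hss'
    have hg2 := hseg s' hs'
    have hτ0 : 0 ≤ τ := by
      have hQ0 : 0 ≤ Q := by
        have h1 : 0 < unitBallVol D * ε := mul_pos hv h.ε_pos
        exact nonneg_of_mul_nonneg_left ((ballVol_nonneg D).trans h.Q_ge) h1
      refine le_trans ?_ h.path
      have := h.l_nonneg
      have := h.e_pos
      positivity
    have hmin : min (min r (1 - r)) R ≤ min s (1 - s) := by
      have h1 := ha.mem_Icc
      rw [mem_uIcc] at hsu
      refine le_min ?_ ?_
      · rcases hsu with ⟨h2, h3⟩ | ⟨h2, h3⟩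
        · exact (min_le_left _ _).trans ((min_le_left _ _).trans h2)
        · exact (min_le_right _ _).trans (h1.1.trans h2)
      · rcases hsu with ⟨h2, h3⟩ | ⟨h2, h3⟩
        · exact (min_le_right _ _).trans (by linarith [h1.2])
        · exact (min_le_left _ _).trans ((min_le_right _ _).trans (by linarith))
    have hrad : knnRadius S k x s ≤ (1 + τ) * knnRadius S k x r := by
      refine h.regular.knnRadius_le_of_le h.good h.l_nonneg h.k_pos h.k_le hx hrI hsI hρ hτ0 ?_
        (by linarith [h.R_le]) hmin (e := e + θ.Cα * (R + 2 / m) ^ θ.α) (Q := Q) ?_ ?_ ?_ ?_ h.path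
      · calc (1 + τ) * knnRadius S k x r ≤ (1 + 1) * knnRadius S k x r := by
              gcongr; exact h.τ_le
          _ ≤ R := by linarith
      · have := h.e_pos
        positivity
      · linarith [(abs_le.1 hg1).1]
      · have hQ0 : 0 ≤ Q := by
          have h1 : 0 < unitBallVol D * ε := mul_pos hv h.ε_pos
          exact nonneg_of_mul_nonneg_left ((ballVol_nonneg D).trans h.Q_ge) h1
        calc S.card * (ballVol D * knnRadius S k x r ^ (D + 1))
            ≤ S.card * (Q * (unitBallVol D * ε) * knnRadius S k x r ^ (D + 1)) := by
              gcongr; exact h.Q_ge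
          _ = Q * (ε * (unitBallVol D * S.card * knnRadius S k x r ^ (D + 1))) := by ring
          _ ≤ Q * k := by gcongr
      · linarith [h.path, h.τ_le]
    have hdens := knnDensity_ge_of_radius_le h.k_pos h.k_le hρ (hpos s hs) hτ0 h.τ_le hrad
    have hsmall : (D + 1) * τ * knnDensity S k x r < ε := by
      have hc : 0 < unitBallVol D * S.card * knnRadius S k x r ^ (D + 1) := by positivity
      refine lt_of_mul_lt_mul_right ?_ hc.le
      calc (D + 1) * τ * knnDensity S k x r * (unitBallVol D * S.card * knnRadius S k x r ^ (D + 1))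
          = (D + 1) * τ * k := by rw [mul_assoc, heq]
        _ < ε * (unitBallVol D * S.card * ρm ^ (D + 1)) := h.level
        _ ≤ _ := by
          have := h.ε_pos
          have := h.ρm_pos
          have := (h.lt_knnRadius hx hr).le
          gcongr
    linarith
  refine ⟨hvert _ ha.mem_grid right_mem_uIcc, reachable_of_segment (fun s hs =>
    h.mesh.trans (h.lt_knnRadius hx hs).le) hr ha.mem_grid hvert⟩

/-- A region that contains the representative of a mode which does not precede its defining point
stays near the mode: it cannot cross the quadratic dip around it. -/
theorem abs_sub_lt (h : PModeSetup B θ i S k m l R R₁ β ε ξ rm ρm Q e τ) (hx : x ∈ B.𝒳)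
    {r t s : ℝ} (ht : t ∈ modes fun r => B.f i r x)
    (hs : IsAnchor B θ i S k m R R₁ x t s)
    (hle : knnDensity S k x s ≤ knnDensity S k x r)
    (hmem : s ∈ levelComponent S k m x (knnDensity S k x r - β * knnDensity S k x r - ε) r)
    {b : ℝ}
    (hb : b ∈ levelComponent S k m x (knnDensity S k x r - β * knnDensity S k x r - ε) r) :
    |b - t| < rm / 2 := by
  set γ := knnDensity S k x r - β * knnDensity S k x r - ε with hγ
  have hpos : ∀ s ∈ grid m, 0 < knnRadius S k x s := fun s hs =>
    h.knnRadius_pos hx (mem_Icc_of_mem_grid hs)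
  have hv := unitBallVol_pos D
  have hN : (0 : ℝ) < S.card := by exact_mod_cast h.card_pos
  have hk : (0 : ℝ) < k := by exact_mod_cast h.k_pos
  have hfs := knnDensity_nonneg S k x s
  have hε := h.ε_pos
  have hR₁ := h.R₁_pos
  -- the slack is a small proportion of the density estimate at the representative
  have hγs : (1 - ξ) * knnDensity S k x s ≤ γ := by
    have h1 : ε ≤ ε * (unitBallVol D * S.card * R₁ ^ (D + 1)) / k * knnDensity S k x s := by
      have heq := mul_knnDensity_eq (x := x) (k := k) h.card_pos (hpos s hs.mem_grid)
      have h2 : (k : ℝ) ≤ knnDensity S k x s * (unitBallVol D * S.card * R₁ ^ (D + 1)) := by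
        rw [← heq]
        have := hs.radius
        have := (hpos s hs.mem_grid).le
        gcongr
      rw [div_mul_eq_mul_div, le_div_iff₀ hk]
      calc ε * k ≤ ε * (knnDensity S k x s * (unitBallVol D * S.card * R₁ ^ (D + 1))) := by gcongr
        _ = _ := by ring
    have h3 : (β + ε * (unitBallVol D * S.card * R₁ ^ (D + 1)) / k) * knnDensity S k x s ≤
        ξ * knnDensity S k x s := by gcongr; exact h.ξ_ge
    have hβ1 : β ≤ 1 := by
      have h4 : 0 ≤ ε * (unitBallVol D * S.card * R₁ ^ (D + 1)) / k := by positivity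
      linarith [h.ξ_ge, h.ξ_le]
    have h5 : (1 - β) * knnDensity S k x s ≤ (1 - β) * knnDensity S k x r := by
      have : 0 ≤ 1 - β := by linarith
      gcongr
    linarith
  have hhigh : ∀ b ∈ levelVertices S k m x γ,
      B.f i t x - compError θ D m l R (2 * ξ) ≤ B.f i b x ∧ knnRadius S k x b ≤ R := by
    intro b hb
    have hrad := radius_le_of_knnDensity_ge h.k_pos h.k_le (hpos s hs.mem_grid) (hpos b hb.1)
      h.ξ_pos.le h.ξ_le (hγs.trans hb.2.le)
    refine ⟨h.le_of_anchor hx hs (mem_Icc_of_mem_grid hb.1) (by linarith [h.ξ_pos])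
      (by linarith [h.ξ_le]) hrad, hrad.trans ?_⟩
    calc (1 + 2 * ξ) * knnRadius S k x s ≤ (1 + 1) * R₁ := by
          have := (hpos s hs.mem_grid).le
          have := hs.radius
          have := h.ξ_le
          have := h.ξ_pos
          gcongr
          linarith
      _ ≤ R := by linarith [h.R₁_le]
  have hm : 0 ≤ 2 / (m : ℝ) := by positivity
  have hstep : ∀ b b', (levelGraph S k m x γ).Adj b b' → |b - t| < rm / 2 → |b' - t| < rm / 2 := by
    intro b b' hadj hbt
    have h1 := (hhigh b hadj.2.1).2
    have h2 := (hhigh b' hadj.2.2.1).1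
    have h3 : |b' - t| ≤ rm := by
      have e1 : |b - b'| ≤ R := hadj.2.2.2.trans ((min_le_left _ _).trans h1)
      have e2 := abs_sub_le b' b t
      rw [abs_sub_comm] at e1
      linarith [h.R_add_lt]
    have h4 := (h.regular.modalShape i hx).quad_le t ht b' (mem_Icc_of_mem_grid hadj.2.2.1.1)
      (by rw [abs_sub_comm]; exact h3.trans h.rm_le)
    have h5 : θ.cLow * (t - b') ^ 2 < θ.cLow * (rm / 2) ^ 2 := by linarith [h.dip]
    have h6 := lt_of_mul_lt_mul_left h5 θ.cLow_pos.le
    have hrm : 0 < rm / 2 := by linarith [h.R_add_lt, h.R_pos]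
    rw [abs_sub_comm]
    exact abs_lt_of_sq_lt_sq h6 hrm.le
  have hreach : (levelGraph S k m x γ).Reachable s b := hmem.2.symm.trans hb.2
  obtain ⟨w⟩ := hreach
  have hst : |s - t| < rm / 2 := hs.near.trans_lt h.R_add_lt
  clear hmem hb hs hfs hγs hhigh hle
  induction w with
  | nil => exact hst
  | cons hadj _ ih => exact ih (hstep _ _ hadj hst)

/-- On a good sample, the `p`-mode estimate is close to the `p`-mode, if the `p` highest modes are
higher than the other ones by at least the accuracy of the comparison. -/
theorem pModeEstimate_close (h : PModeSetup B θ i S k m l R R₁ β ε ξ rm ρm Q e τ) (hx : x ∈ B.𝒳)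
    {p : ℕ} (hp : 1 ≤ p) {T : Set ℝ} (hT : T ⊆ modes fun r => B.f i r x)
    (hcard : T.encard = min (p : ℕ∞) (modes fun r => B.f i r x).encard) {Δ w : ℝ}
    (hgap : ∀ j ∈ T, ∀ j' ∈ modes (fun r => B.f i r x) \ T, Δ < B.f i j x - B.f i j' x)
    (hΔ : compError θ D m l R R ≤ Δ) (hw0 : 0 ≤ w)
    (hw : compError θ D m l R R ≤ θ.cLow * w ^ 2)
    {δ r : ℝ} (hβ : β = betaWidth δ S.card k) (hr : IsPModeEstimate S p k m δ ε x r) :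
    |r - sInf T| ≤ w := by
  obtain ⟨L, hperm, hsort, s, hs, ⟨A₀, hA₀, rfl⟩, hmin⟩ := hr
  rw [← hβ] at hs hA₀ hmin
  set M := modes fun r => B.f i r x with hM
  set C : ℝ → Set ℝ := fun a =>
    levelComponent S k m x (knnDensity S k x a - β * knnDensity S k x a - ε) a with hC
  have hshape := h.regular.modalShape i hx
  have hex : ∀ t ∈ M, ∃ s, IsAnchor B θ i S k m R R₁ x t s := fun t ht => h.exists_anchor hx ht
  choose! anc hanc using hex
  have hpos : ∀ s ∈ grid m, 0 < knnRadius S k x s := fun s hs =>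
    h.knnRadius_pos hx (mem_Icc_of_mem_grid hs)
  have hmemL : ∀ a, a ∈ L ↔ a ∈ grid m := fun a => hperm.mem_iff
  have hβ1 : β ≤ 1 := by
    have h4 : 0 ≤ ε * (unitBallVol D * S.card * R₁ ^ (D + 1)) / k := by
      have := unitBallVol_pos D
      have := h.ε_pos
      have := h.R₁_pos
      positivity
    linarith [h.ξ_ge, h.ξ_le]
  have hsetup : CollectSetup C (knnDensity S k x) p L M T anc := by
    refine ⟨hsort, fun t ht => (hmemL _).2 (hanc t ht).mem_grid, ?_, ?_, ?_, ?_, ?_, hT, hcard⟩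
    · intro a ha
      refine ⟨⟨(hmemL a).1 ha, ?_⟩, SimpleGraph.Reachable.refl _⟩
      have := mul_nonneg h.β_nonneg (knnDensity_nonneg S k x a)
      linarith [h.ε_pos]
    · intro a _ b _ hab hne
      refine levelComponent_subset ?_ hne
      have : (1 - β) * knnDensity S k x b ≤ (1 - β) * knnDensity S k x a := by
        have : 0 ≤ 1 - β := by linarith
        gcongr
      linarith
    · intro a ha
      exact h.exists_anchor_mem hx hanc ((hmemL a).1 ha)
    · intro a _ t ht t' ht' hle hmem hmem'
      by_contra hne
      have h1 := h.abs_sub_lt hx ht (hanc t ht) hle hmem hmem'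
      have h2 := (hanc t' ht').near.trans_lt h.R_add_lt
      have h3 := hshape.lt_abs_sub θ.cLow_pos ht' ht hne
      have h4 := abs_sub_le t' (anc t') t
      rw [abs_sub_comm t' (anc t')] at h4
      linarith [h.rm_le]
    · intro a ha t ht hle hmem htT j hj
      by_contra! hge
      have haI := mem_Icc_of_mem_grid ((hmemL a).1 ha)
      have hself : a ∈ C a := by
        refine ⟨⟨(hmemL a).1 ha, ?_⟩, SimpleGraph.Reachable.refl _⟩
        have := mul_nonneg h.β_nonneg (knnDensity_nonneg S k x a)
        linarith [h.ε_pos]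
      have h1 := h.abs_sub_lt hx ht (hanc t ht) hle hmem hself
      have hrm : rm / 2 ≤ θ.rM := by
        have : 0 ≤ |a - t| := abs_nonneg _
        linarith [h.rm_le]
      have h2 := hshape.quad_le t ht a haI (by rw [abs_sub_comm]; linarith)
      have h3 := h.le_of_anchor' hx (hanc j (hT hj)) haI
        ((knnDensity_le_iff h.k_pos h.k_le (hpos _ (hanc j (hT hj)).mem_grid)
          (hpos a ((hmemL a).1 ha))).1 hge)
      have h4 := hgap j hj t ⟨ht, htT⟩
      have h5 : 0 ≤ θ.cLow * (t - a) ^ 2 := mul_nonneg θ.cLow_pos.le (sq_nonneg _)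
      linarith
  obtain ⟨hall, hcov⟩ := hsetup.collect_spec hp
  have hfin : T.Finite := Set.finite_of_encard_le_coe hsetup.encard_le
  -- the maximizer of the density estimate over the region of a mode is close to the mode
  have hclose : ∀ A ∈ collect C p L [], ∀ a ∈ L, ∀ t ∈ M,
      IsRegionOf C (knnDensity S k x) anc A a t → |s A - t| ≤ w := by
    rintro A hA a - t ht ⟨rfl, hle, hmem⟩
    obtain ⟨hsA, hmax⟩ := hs _ hA
    have h1 := h.abs_sub_lt hx ht (hanc t ht) hle hmem hsA
    have hsI := mem_Icc_of_mem_grid hsA.1.1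
    have h2 := hshape.quad_le t ht _ hsI (by
      rw [abs_sub_comm]
      have : 0 ≤ |s (C a) - t| := abs_nonneg _
      linarith [h.rm_le])
    have h3 := h.le_of_anchor' hx (hanc t ht) hsI
      ((knnDensity_le_iff h.k_pos h.k_le (hpos _ (hanc t ht).mem_grid)
        (hpos _ hsA.1.1)).1 (hmax _ hmem))
    have h4 : θ.cLow * (t - s (C a)) ^ 2 ≤ θ.cLow * w ^ 2 := by linarith
    have h5 := le_of_mul_le_mul_left h4 θ.cLow_pos
    rw [abs_sub_comm]
    exact abs_le_of_sq_le_sq h5 hw0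
  obtain ⟨a, ha, t, ht, hreg⟩ := hall A₀ hA₀
  have h1 := hclose A₀ hA₀ a ha t (hT ht) hreg
  have hinf : sInf T ∈ T := Set.Nonempty.csInf_mem ⟨t, ht⟩ hfin
  have hle : sInf T ≤ t := csInf_le hfin.bddBelow ht
  obtain ⟨A, hA, a', ha', hreg'⟩ := hcov _ hinf
  have h2 := hclose A hA a' ha' _ (hT hinf) hreg'
  have h3 : s A₀ ≤ s A := hmin ⟨A, hA, rfl⟩
  rw [abs_le] at h1 h2 ⊢
  constructor <;> linarith [h1.1, h2.2]

end PModeSetup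

end ModalBandit

namespace ModalBandit

variable {D K : ℕ} {Ω : Type*}

/-! ### Pull counts of uniform sampling -/

theorem pulls_succ (I : ℕ → Ω → Fin K) (i : Fin K) (t : ℕ) (ω : Ω) :
    pulls I i (t + 1) ω = pulls I i t ω + if I t ω = i then 1 else 0 := by
  rw [pulls, Finset.range_add_one, Finset.filter_insert, pulls]
  split_ifs with h
  · rw [Finset.card_insert_of_notMem (by simp)]
  · rfl

theorem sum_pulls (I : ℕ → Ω → Fin K) (t : ℕ) (ω : Ω) : ∑ i, pulls I i t ω = t := by
  have := Finset.card_eq_sum_card_fiberwise (s := Finset.range t) (t := Finset.univ)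
    (f := fun s => I s ω) (fun _ _ => by simp)
  simpa [pulls] using this.symm

/-- Pulling a least-pulled arm keeps the pull counts of any two arms within one of each other. -/
theorem pulls_le_succ {I : ℕ → Ω → Fin K} {n : ℕ} {ω : Ω}
    (h : ∀ t < n, ∀ j, pulls I (I t ω) t ω ≤ pulls I j t ω) :
    ∀ t ≤ n, ∀ i j, pulls I i t ω ≤ pulls I j t ω + 1 := by
  intro t
  induction t with
  | zero => intro _ i j; simp [pulls]
  | succ t ih =>
    intro ht i j
    have h1 := ih (by omega) i j
    rw [pulls_succ, pulls_succ]
    by_cases hi : I t ω = i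
    · have h2 := h t (by omega) j
      rw [hi] at h2
      rw [if_pos hi]
      omega
    · rw [if_neg hi]
      omega

theorem pulls_bounds {I : ℕ → Ω → Fin K} {n : ℕ} {ω : Ω}
    (h : ∀ t < n, ∀ j, pulls I (I t ω) t ω ≤ pulls I j t ω) (i : Fin K) :
    n / K ≤ pulls I i n ω ∧ pulls I i n ω ≤ n / K + 1 := by
  have hK : 0 < K := i.pos
  have h1 := pulls_le_succ h n le_rfl
  have h2 := sum_pulls I n ω
  constructor
  · by_contra! hlt
    have h3 : ∑ j, pulls I j n ω < ∑ _j : Fin K, n / K :=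
      Finset.sum_lt_sum (fun j _ => by have := h1 j i; omega) ⟨i, Finset.mem_univ _, hlt⟩
    rw [h2, Finset.sum_const, Finset.card_univ, Fintype.card_fin, smul_eq_mul] at h3
    exact absurd (Nat.mul_div_le n K) (not_le.2 h3)
  · by_contra! hlt
    have h3 : ∑ _j : Fin K, (n / K + 1) < ∑ j, pulls I j n ω :=
      Finset.sum_lt_sum (fun j _ => by have := h1 i j; omega) ⟨i, Finset.mem_univ _, hlt⟩
    rw [h2, Finset.sum_const, Finset.card_univ, Fintype.card_fin, smul_eq_mul] at h3
    exact absurd h3.le (not_le.2 (Nat.lt_mul_div_succ n hK))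

/-- The number of rounds before `t` in which arm `i` is pulled and its (reward, context) pair lies
in `A`. -/
def hits (X : ℕ → Ω → Ctx D) (Y : Fin K → ℕ → Ω → ℝ) (I : ℕ → Ω → Fin K) (i : Fin K)
    (A : Set (ℝ × Ctx D)) (t : ℕ) (ω : Ω) : ℕ :=
  open scoped Classical in
  ((Finset.range t).filter (fun s => I s ω = i ∧ (Y i s ω, X s ω) ∈ A)).card

open scoped Classical in
theorem hits_succ (X : ℕ → Ω → Ctx D) (Y : Fin K → ℕ → Ω → ℝ) (I : ℕ → Ω → Fin K) (i : Fin K)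
    (A : Set (ℝ × Ctx D)) (t : ℕ) (ω : Ω) :
    hits X Y I i A (t + 1) ω =
      hits X Y I i A t ω + if I t ω = i ∧ (Y i t ω, X t ω) ∈ A then 1 else 0 := by
  rw [hits, Finset.range_add_one, Finset.filter_insert, hits]
  split_ifs with h
  · rw [Finset.card_insert_of_notMem (by simp)]
  · rfl

theorem card_armSample (X : ℕ → Ω → Ctx D) (Y : Fin K → ℕ → Ω → ℝ) (I : ℕ → Ω → Fin K)
    (i : Fin K) (t : ℕ) (ω : Ω) : (armSample X Y I i t ω).card = pulls I i t ω := by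
  rw [armSample, Multiset.card_map, pulls]
  rfl

theorem ballCount_armSample (X : ℕ → Ω → Ctx D) (Y : Fin K → ℕ → Ω → ℝ) (I : ℕ → Ω → Fin K)
    (i : Fin K) (t : ℕ) (ω : Ω) (x : Ctx D) (r ρ : ℝ) :
    ballCount (armSample X Y I i t ω) x r ρ = hits X Y I i (jball (r, x) ρ) t ω := by
  classical
  rw [ballCount, armSample, Multiset.filter_map, Multiset.card_map, hits, ← Finset.filter_val,
    Finset.filter_filter, Finset.card_def]
  congr

/-! ### Concentration of the counts -/

section Concentration

variable [mΩ : MeasurableSpace Ω] {P : Measure Ω} [IsProbabilityMeasure P]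
  {B : Environment D K} {n : ℕ} {X : ℕ → Ω → Ctx D} {Y : Fin K → ℕ → Ω → ℝ} {I : ℕ → Ω → Fin K}

theorem IsUniformSampling.isProbabilityMeasure_law (h : IsUniformSampling P B n X Y I)
    (i : Fin K) : IsProbabilityMeasure (B.law i) := by
  rw [← h.law_eq i 0]
  exact Measure.isProbabilityMeasure_map
    ((h.Y_measurable i 0).prodMk (h.X_measurable 0)).aemeasurable

/-- The exponential supermartingale behind the concentration of the counts: given the past, a
round in which arm `i` is pulled multiplies the exponential by the factor
`exp (-ψ) * (1 + q (exp c - 1)) ≤ 1` on average, where `q` is the probability of `A`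
and `ψ = q (exp c - 1)`. -/
theorem IsUniformSampling.lintegral_exp_le_one (h : IsUniformSampling P B n X Y I) (i : Fin K)
    {A : Set (ℝ × Ctx D)} (hA : MeasurableSet A) (c : ℝ) (t : ℕ) :
    Measurable (fun ω => ENNReal.ofReal (Real.exp (c * hits X Y I i A t ω -
      (B.law i).real A * (Real.exp c - 1) * pulls I i t ω))) ∧
    ∫⁻ ω, ENNReal.ofReal (Real.exp (c * hits X Y I i A t ω -
      (B.law i).real A * (Real.exp c - 1) * pulls I i t ω)) ∂P ≤ 1 := by
  classical
  have := h.isProbabilityMeasure_law i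
  obtain ⟨ℱ, hX, hY, hI, hind⟩ := h.nonanticipating
  set q := (B.law i).real A with hq
  set ψ := q * (Real.exp c - 1) with hψ
  set W : ℕ → Ω → ENNReal := fun t ω =>
    ENNReal.ofReal (Real.exp (c * hits X Y I i A t ω - ψ * pulls I i t ω)) with hW
  set g : ℝ × Ctx D → ENNReal := fun z =>
    if z ∈ A then ENNReal.ofReal (Real.exp (c - ψ)) else ENNReal.ofReal (Real.exp (-ψ)) with hg
  have hgm : Measurable g := Measurable.ite hA measurable_const measurable_const
  have hrec : ∀ t ω, W (t + 1) ω =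
      W t ω * (if I t ω = i then g (Y i t ω, X t ω) else 1) := by
    intro t ω
    simp only [hW, hg]
    rw [hits_succ, pulls_succ]
    by_cases h1 : I t ω = i
    · by_cases h2 : (Y i t ω, X t ω) ∈ A
      · rw [if_pos ⟨h1, h2⟩, if_pos h1, if_pos h1, if_pos h2,
          ← ENNReal.ofReal_mul (Real.exp_nonneg _), ← Real.exp_add]
        congr 2
        push_cast; ring
      · rw [if_neg (fun h => h2 h.2), if_pos h1, if_pos h1, if_neg h2,
          ← ENNReal.ofReal_mul (Real.exp_nonneg _), ← Real.exp_add]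
        congr 2
        push_cast; ring
    · rw [if_neg (fun h => h1 h.1), if_neg h1, if_neg h1, mul_one, add_zero, add_zero]
  have hIset : ∀ t, MeasurableSet[ℱ t] {ω | I t ω = i} := fun t =>
    (hI t) (measurableSet_singleton i)
  have hZ : ∀ t, Measurable[ℱ (t + 1)] fun ω => (Y i t ω, X t ω) := fun t =>
    (hY i t).prodMk (hX t)
  have hWm : ∀ t, Measurable[ℱ t] (W t) := by
    intro t
    induction t with
    | zero => simp only [hW, hits, pulls, Finset.range_zero, Finset.filter_empty]
              exact measurable_const
    | succ t ih =>
      rw [show W (t + 1) = fun ω => W t ω * (if I t ω = i then g (Y i t ω, X t ω) else 1) from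
        funext (hrec t)]
      exact (ih.mono (ℱ.mono (Nat.le_succ t)) le_rfl).mul
        (Measurable.ite (ℱ.mono (Nat.le_succ t) _ (hIset t)) (hgm.comp (hZ t)) measurable_const)
  have hfactor : ∫⁻ z, g z ∂(B.law i) ≤ 1 := by
    have h1 : g = fun z => A.indicator (fun _ => ENNReal.ofReal (Real.exp (c - ψ))) z +
        Aᶜ.indicator (fun _ => ENNReal.ofReal (Real.exp (-ψ))) z := by
      funext z
      by_cases hz : z ∈ A <;> simp [hg, hz]
    rw [h1, lintegral_add_left (measurable_const.indicator hA), lintegral_indicator_const hA,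
      lintegral_indicator_const hA.compl, ← ofReal_measureReal (measure_ne_top _ A),
      ← ofReal_measureReal (measure_ne_top _ Aᶜ), measureReal_compl hA,
      ← ENNReal.ofReal_mul (Real.exp_nonneg _), ← ENNReal.ofReal_mul (Real.exp_nonneg _),
      ← ENNReal.ofReal_add (by positivity) (mul_nonneg (Real.exp_nonneg _)
        (sub_nonneg.2 (measureReal_mono (subset_univ _) (measure_ne_top _ _)))),
      ENNReal.ofReal_le_one, probReal_univ, ← hq]
    calc Real.exp (c - ψ) * q + Real.exp (-ψ) * (1 - q)
        = Real.exp (-ψ) * (ψ + 1) := by rw [sub_eq_add_neg, Real.exp_add, hψ]; ring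
      _ ≤ Real.exp (-ψ) * Real.exp ψ := by gcongr; exact Real.add_one_le_exp ψ
      _ = 1 := by rw [← Real.exp_add, neg_add_cancel, Real.exp_zero]
  change Measurable (W t) ∧ ∫⁻ ω, W t ω ∂P ≤ 1
  refine ⟨(hWm t).mono (ℱ.le t) le_rfl, ?_⟩
  induction t with
  | zero => simp [hW, hits, pulls]
  | succ t ih =>
    have hWm' : Measurable (W t) := (hWm t).mono (ℱ.le t) le_rfl
    have hIs' : MeasurableSet {ω | I t ω = i} := ℱ.le t _ (hIset t)
    have hZ' : Measurable fun ω => (Y i t ω, X t ω) :=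
      (h.Y_measurable i t).prodMk (h.X_measurable t)
    have hsplit : ∀ ω, W (t + 1) ω = {ω | I t ω = i}ᶜ.indicator (W t) ω +
        {ω | I t ω = i}.indicator (W t) ω * g (Y i t ω, X t ω) := by
      intro ω
      rw [hrec]
      by_cases h1 : I t ω = i <;> simp [h1]
    have hindep : ∫⁻ ω, {ω | I t ω = i}.indicator (W t) ω * g (Y i t ω, X t ω) ∂P =
        (∫⁻ ω, {ω | I t ω = i}.indicator (W t) ω ∂P) * ∫⁻ ω, g (Y i t ω, X t ω) ∂P := by
      refine lintegral_mul_eq_lintegral_mul_lintegral_of_independent_measurableSpace (ℱ.le t)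
        hZ'.comap_le (hind i t).symm ((hWm t).indicator (hIset t)) ?_
      exact hgm.comp (comap_measurable _)
    have hlaw : ∫⁻ ω, g (Y i t ω, X t ω) ∂P = ∫⁻ z, g z ∂(B.law i) := by
      rw [← h.law_eq i t, lintegral_map hgm hZ']
    calc ∫⁻ ω, W (t + 1) ω ∂P
        = ∫⁻ ω, {ω | I t ω = i}ᶜ.indicator (W t) ω ∂P +
          (∫⁻ ω, {ω | I t ω = i}.indicator (W t) ω ∂P) * ∫⁻ ω, g (Y i t ω, X t ω) ∂P := by
          rw [lintegral_congr hsplit, lintegral_add_left (hWm'.indicator hIs'.compl), hindep]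
      _ ≤ ∫⁻ ω, {ω | I t ω = i}ᶜ.indicator (W t) ω ∂P +
          ∫⁻ ω, {ω | I t ω = i}.indicator (W t) ω ∂P := by
          gcongr
          rw [hlaw]
          exact mul_le_of_le_one_right' hfactor
      _ = ∫⁻ ω, W t ω ∂P := by
          rw [lintegral_indicator hIs'.compl, lintegral_indicator hIs', add_comm,
            lintegral_add_compl _ hIs']
      _ ≤ 1 := ih

theorem IsUniformSampling.measure_le_exp_neg (h : IsUniformSampling P B n X Y I) (i : Fin K)
    {A : Set (ℝ × Ctx D)} (hA : MeasurableSet A) (c u : ℝ) :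
    P {ω | u ≤ c * hits X Y I i A n ω - (B.law i).real A * (Real.exp c - 1) * pulls I i n ω}
      ≤ ENNReal.ofReal (Real.exp (-u)) := by
  obtain ⟨hm, h1⟩ := h.lintegral_exp_le_one i hA c n
  set Z : Ω → ℝ := fun ω =>
    c * hits X Y I i A n ω - (B.law i).real A * (Real.exp c - 1) * pulls I i n ω with hZ
  have h2 : {ω | u ≤ Z ω} ⊆ {ω | ENNReal.ofReal (Real.exp u) ≤ ENNReal.ofReal (Real.exp (Z ω))} :=
    fun ω hω => ENNReal.ofReal_le_ofReal (Real.exp_le_exp.2 hω)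
  refine (measure_mono h2).trans ((meas_ge_le_lintegral_div hm.aemeasurable
    (ENNReal.ofReal_pos.2 (Real.exp_pos u)).ne' ENNReal.ofReal_ne_top).trans ?_)
  rw [Real.exp_neg, ENNReal.ofReal_inv_of_pos (Real.exp_pos u), ← one_div]
  gcongr

/-- Uniform concentration over finitely many sets and all the arms. -/
theorem IsUniformSampling.measure_not_concentrated_le (h : IsUniformSampling P B n X Y I)
    (𝒜 : Finset (Set (ℝ × Ctx D))) (h𝒜 : ∀ A ∈ 𝒜, MeasurableSet A) {l : ℝ} (u : ℝ) (hl : 0 < l)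
    (hl1 : l ≤ 1) :
    P {ω | ¬ ∀ i, ∀ A ∈ 𝒜,
      (hits X Y I i A n ω : ℝ) ≤ (1 + l) * (pulls I i n ω * (B.law i).real A) + u / l ∧
      (1 - l) * (pulls I i n ω * (B.law i).real A) - u / l ≤ hits X Y I i A n ω} ≤
    ENNReal.ofReal (K * 𝒜.card * 2 * Real.exp (-u)) := by
  set E : ℝ → Fin K → Set (ℝ × Ctx D) → Set Ω := fun c i A =>
    {ω | u ≤ c * hits X Y I i A n ω - (B.law i).real A * (Real.exp c - 1) * pulls I i n ω} with hE
  have hsub : {ω | ¬ ∀ i, ∀ A ∈ 𝒜,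
      (hits X Y I i A n ω : ℝ) ≤ (1 + l) * (pulls I i n ω * (B.law i).real A) + u / l ∧
      (1 - l) * (pulls I i n ω * (B.law i).real A) - u / l ≤ hits X Y I i A n ω} ⊆
      ⋃ i, ⋃ A ∈ 𝒜, (E l i A ∪ E (-l) i A) := by
    intro ω hω
    by_contra hnot
    refine hω fun i A hA => ?_
    simp only [mem_iUnion, mem_union, not_exists, not_or] at hnot
    obtain ⟨h1, h2⟩ := hnot i A hA
    simp only [hE, mem_ofPred_eq, not_le] at h1 h2
    set q := (B.law i).real A with hq
    have hq0 : 0 ≤ q * pulls I i n ω := mul_nonneg measureReal_nonneg (Nat.cast_nonneg _)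
    have e1 := (abs_le.1 (Real.abs_exp_sub_one_sub_id_le (x := l)
      (by rw [abs_of_pos hl]; exact hl1))).2
    have e2 := (abs_le.1 (Real.abs_exp_sub_one_sub_id_le (x := -l)
      (by rw [abs_neg, abs_of_pos hl]; exact hl1))).2
    have e3 := mul_le_mul_of_nonneg_left (show Real.exp l - 1 ≤ l + l ^ 2 by linarith) hq0
    have e4 := mul_le_mul_of_nonneg_left (show Real.exp (-l) - 1 ≤ -l + l ^ 2 by linarith) hq0
    have hul : u / l * l = u := div_mul_cancel₀ u hl.ne'
    constructor
    · refine le_of_mul_le_mul_right ?_ hl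
      linarith
    · refine le_of_mul_le_mul_right ?_ hl
      linarith
  have hEle : ∀ c i, ∀ A ∈ 𝒜, P (E c i A) ≤ ENNReal.ofReal (Real.exp (-u)) := fun c i A hA =>
    h.measure_le_exp_neg i (h𝒜 A hA) c u
  calc _ ≤ P (⋃ i, ⋃ A ∈ 𝒜, (E l i A ∪ E (-l) i A)) := measure_mono hsub
    _ ≤ ∑ i, P (⋃ A ∈ 𝒜, (E l i A ∪ E (-l) i A)) := measure_iUnion_fintype_le _ _
    _ ≤ ∑ _i : Fin K, ∑ _A ∈ 𝒜, (ENNReal.ofReal (Real.exp (-u)) + ENNReal.ofReal (Real.exp (-u))) := by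
        refine Finset.sum_le_sum fun i _ => (measure_biUnion_finset_le _ _).trans ?_
        exact Finset.sum_le_sum fun A hA =>
          (measure_union_le _ _).trans (add_le_add (hEle _ _ _ hA) (hEle _ _ _ hA))
    _ = ENNReal.ofReal (K * 𝒜.card * 2 * Real.exp (-u)) := by
        rw [Finset.sum_const, Finset.sum_const, Finset.card_univ, Fintype.card_fin, smul_smul,
          nsmul_eq_mul, ← two_mul, ENNReal.ofReal_mul (by positivity),
          ENNReal.ofReal_mul (by positivity), ← Nat.cast_mul,
          ENNReal.ofReal_natCast, mul_assoc]
        norm_num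

end Concentration

end ModalBandit

namespace ModalBandit

variable {D K : ℕ} {Ω : Type*}

/-! ### A net of the context support -/

section Net

variable {B : Environment D K} {θ : Params} {i : Fin K}

/-- Separated points of the context support are few: the balls around the modes over these points
are disjoint and have a probability bounded below. -/
theorem Regular.card_mul_le_one_of_separated (h : Regular B θ) (i : Fin K)
    [IsProbabilityMeasure (B.law i)] {η : ℝ} (hη : 0 < η) (hη1 : η ≤ 1) (hη₀ : η ≤ θ.ρ₀)
    (hC : θ.Cα * η ^ θ.α ≤ θ.lam / 2) {Z : Finset (Ctx D)} (hZ : ∀ z ∈ Z, z ∈ B.𝒳)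
    (hsep : ∀ z ∈ Z, ∀ z' ∈ Z, z ≠ z' → 2 * η < dist z z') :
    Z.card * (θ.lam / 2 * (slabConst θ D * η ^ (D + 1))) ≤ 1 := by
  have hmode : ∀ z ∈ Z, ∃ t, t ∈ modes fun r => B.f i r z := fun z hz =>
    (h.modalShape i (hZ z hz)).exists_mode
  choose! t ht using hmode
  have hlow : ∀ z ∈ Z, θ.lam / 2 * (slabConst θ D * η ^ (D + 1)) ≤
      (B.law i).real (jball (t z, z) η) := by
    intro z hz
    refine le_trans ?_ (h.le_mass i (hZ z hz) (ht z hz).1)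
    have h1 := (h.modalShape i (hZ z hz)).lower _ (ht z hz)
    have := slabConst_pos θ D
    exact mul_le_mul (by linarith) (h.le_slabVol (hZ z hz) (ht z hz).1 hη hη1 hη₀) (by positivity)
      (by linarith [θ.lam_pos])
  have hdisj : (Z : Set (Ctx D)).PairwiseDisjoint fun z => jball (t z, z) η := by
    intro z hz z' hz' hne
    refine Set.disjoint_left.2 fun w hw hw' => ?_
    have h1 := hsep z hz z' hz' hne
    have h2 := (dist_snd_le_jointDist w (t z, z)).trans hw
    have h3 := (dist_snd_le_jointDist w (t z', z')).trans hw'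
    have h4 := dist_triangle_left z z' w.2
    simp only at h2 h3
    linarith
  calc Z.card * (θ.lam / 2 * (slabConst θ D * η ^ (D + 1)))
      = ∑ _z ∈ Z, θ.lam / 2 * (slabConst θ D * η ^ (D + 1)) := by
        rw [Finset.sum_const, nsmul_eq_mul]
    _ ≤ ∑ z ∈ Z, (B.law i).real (jball (t z, z) η) := Finset.sum_le_sum hlow
    _ = (B.law i).real (⋃ z ∈ Z, jball (t z, z) η) :=
        (measureReal_biUnion_finset hdisj fun _ _ => measurableSet_jball _ _).symm
    _ ≤ 1 := measureReal_le_one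

/-- A `2 η`-net of polynomial size, obtained as a separated subset of the context support of maximal
cardinality. -/
theorem Regular.exists_net (h : Regular B θ) (i : Fin K)
    [IsProbabilityMeasure (B.law i)] {η : ℝ} (hη : 0 < η) (hη1 : η ≤ 1) (hη₀ : η ≤ θ.ρ₀)
    (hC : θ.Cα * η ^ θ.α ≤ θ.lam / 2) :
    ∃ Z : Finset (Ctx D), (∀ x ∈ B.𝒳, ∃ z ∈ Z, dist x z ≤ 2 * η) ∧
      Z.card * (θ.lam / 2 * (slabConst θ D * η ^ (D + 1))) ≤ 1 := by
  classical
  set c := θ.lam / 2 * (slabConst θ D * η ^ (D + 1)) with hc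
  have hc0 : 0 < c := by
    have := slabConst_pos θ D
    have := θ.lam_pos
    positivity
  set s : Set ℕ := {q | ∃ Z : Finset (Ctx D), (∀ z ∈ Z, z ∈ B.𝒳) ∧
    (∀ z ∈ Z, ∀ z' ∈ Z, z ≠ z' → 2 * η < dist z z') ∧ Z.card = q} with hs
  have hbdd : BddAbove s := by
    refine ⟨⌊1 / c⌋₊, ?_⟩
    rintro _ ⟨Z, hZ, hsep, rfl⟩
    refine Nat.le_floor ((le_div_iff₀ hc0).2 ?_)
    exact h.card_mul_le_one_of_separated i hη hη1 hη₀ hC hZ hsep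
  obtain ⟨Z, hZ, hsep, hcard⟩ := Nat.sSup_mem (s := s) ⟨0, ∅, by simp, by simp, by simp⟩ hbdd
  refine ⟨Z, fun x hx => ?_, h.card_mul_le_one_of_separated i hη hη1 hη₀ hC hZ hsep⟩
  by_contra! hfar
  have hxZ : x ∉ Z := fun hmem => by
    have := hfar x hmem
    rw [dist_self] at this
    linarith
  have hmem : Z.card + 1 ∈ s := by
    refine ⟨insert x Z, ?_, ?_, Finset.card_insert_of_notMem hxZ⟩
    · intro z hz
      rcases Finset.mem_insert.1 hz with rfl | hz
      · exact hx
      · exact hZ z hz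
    · intro z hz z' hz' hne
      rcases Finset.mem_insert.1 hz with rfl | hzZ <;>
      rcases Finset.mem_insert.1 hz' with rfl | hzZ'
      · exact absurd rfl hne
      · exact hfar z' hzZ'
      · rw [dist_comm]; exact hfar z hzZ
      · exact hsep z hzZ z' hzZ' hne
  have := le_csSup hbdd hmem
  omega

end Net

/-! ### Samples are good with high probability -/

theorem add_pow_sub_pow_le {a d : ℝ} (ha : 0 ≤ a) (ha1 : a ≤ 1) (hd : 0 ≤ d) (hd1 : d ≤ 1)
    (n : ℕ) : (a + d) ^ n - a ^ n ≤ 2 ^ n * d := by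
  suffices h : (a + d) ^ n ≤ a ^ n + (2 ^ n - 1) * d by nlinarith
  induction n with
  | zero => simp
  | succ n ih =>
    have h2 : (1 : ℝ) ≤ 2 ^ n := one_le_pow₀ (by norm_num)
    have h3 : a ^ n ≤ 1 := pow_le_one₀ ha ha1
    calc (a + d) ^ (n + 1) = (a + d) ^ n * (a + d) := pow_succ _ _
      _ ≤ (a ^ n + (2 ^ n - 1) * d) * (a + d) := by gcongr
      _ = a ^ (n + 1) + a ^ n * d + (2 ^ n - 1) * d * (a + d) := by ring
      _ ≤ a ^ (n + 1) + 1 * d + (2 ^ n - 1) * d * 2 := by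
        have : 0 ≤ (2 ^ n - 1) * d := mul_nonneg (by linarith) hd
        gcongr
        linarith
      _ = _ := by ring

open scoped Classical in
/-- The balls with centres and radii in a net of mesh `1 / H`. -/
def netBalls (Z : Finset (Ctx D)) (H : ℕ) : Finset (Set (ℝ × Ctx D)) :=
  (Z ×ˢ (Finset.range (H + 1) ×ˢ Finset.range (H + 4))).image
    fun v => jball ((v.2.1 : ℝ) / H, v.1) ((v.2.2 : ℝ) / H)

theorem jball_mem_netBalls {Z : Finset (Ctx D)} {H : ℕ} {z : Ctx D} {j a : ℕ} (hz : z ∈ Z)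
    (hj : j ≤ H) (ha : a ≤ H + 3) : jball ((j : ℝ) / H, z) ((a : ℝ) / H) ∈ netBalls Z H := by
  classical
  rw [netBalls]
  exact Finset.mem_image.2 ⟨(z, j, a), by simp [hz]; omega, rfl⟩

theorem card_netBalls_le (Z : Finset (Ctx D)) {H : ℕ} (hH : 4 ≤ H) :
    (netBalls Z H).card ≤ Z.card * (4 * H ^ 2) := by
  classical
  refine Finset.card_image_le.trans ?_
  rw [Finset.card_product, Finset.card_product, Finset.card_range, Finset.card_range]
  exact Nat.mul_le_mul_left _ (by nlinarith)

section GoodEvent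

variable {B : Environment D K} {θ : Params} {n : ℕ} {X : ℕ → Ω → Ctx D} {Y : Fin K → ℕ → Ω → ℝ}
  {I : ℕ → Ω → Fin K}

theorem Regular.law_sub_le (h : Regular B θ) (i : Fin K) [IsProbabilityMeasure (B.law i)]
    {z z' : ℝ × Ctx D} {a d : ℝ} (ha : 0 < a) (ha1 : a ≤ 1) (hd : 0 ≤ d)
    (hd1 : d ≤ 1) (hsub : jball z a ⊆ jball z' (a + d)) :
    (B.law i).real (jball z' (a + d)) - (B.law i).real (jball z a) ≤
      θ.fMax * ballVol D * 2 ^ (D + 1) * d := by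
  rw [← measureReal_sdiff hsub (measurableSet_jball _ _)]
  refine (h.law_real_le i ((measurableSet_jball _ _).diff (measurableSet_jball _ _))
    ((measure_mono sdiff_subset).trans_lt (volume_jball_ne_top _ _).lt_top).ne).trans ?_
  rw [measureReal_sdiff hsub (measurableSet_jball _ _) (volume_jball_ne_top _ _),
    volume_real_jball _ ha, volume_real_jball _ (by linarith : 0 < a + d), ← mul_sub]
  have h1 := add_pow_sub_pow_le ha.le ha1 hd hd1 (D + 1)
  have h2 := (h.fMax_pos i).le
  have h3 := ballVol_nonneg D
  calc θ.fMax * (ballVol D * ((a + d) ^ (D + 1) - a ^ (D + 1)))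
      ≤ θ.fMax * (ballVol D * (2 ^ (D + 1) * d)) := by gcongr
    _ = _ := by ring

/-- Concentration on the balls of a fine net yields concentration on all balls. -/
theorem Regular.goodSample_of_concentrated (h : Regular B θ) (i : Fin K)
    [IsProbabilityMeasure (B.law i)] {Z : Finset (Ctx D)} {H : ℕ} (hH : 4 ≤ H)
    (hZ : ∀ x ∈ B.𝒳, ∃ z ∈ Z, dist x z ≤ 2 * (1 / H)) {ω : Ω} {l u : ℝ} {k : ℕ} (hl : 0 < l)
    (hl1 : l ≤ 1) (hu : u ≤ l ^ 2 * k) (hu1 : 1 ≤ u)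
    (hfine : pulls I i n ω * (θ.fMax * ballVol D * 2 ^ (D + 4)) ≤ H)
    (hconc : ∀ A ∈ netBalls Z H,
      (hits X Y I i A n ω : ℝ) ≤ (1 + l) * (pulls I i n ω * (B.law i).real A) + u / l ∧
      (1 - l) * (pulls I i n ω * (B.law i).real A) - u / l ≤ hits X Y I i A n ω) :
    GoodSample B i (armSample X Y I i n ω) k l := by
  intro x hx r hr ρ hρ hρ1
  rw [ballCount_armSample, card_armSample]
  obtain ⟨z, hz, hxz⟩ := hZ x hx
  have hH0 : (0 : ℝ) < H := by exact_mod_cast (by omega : 0 < H)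
  have hH4 : (4 : ℝ) ≤ H := by exact_mod_cast hH
  set N : ℝ := ((pulls I i n ω : ℕ) : ℝ) with hN
  have hN0 : 0 ≤ N := Nat.cast_nonneg _
  set Fc := θ.fMax * ballVol D * 2 ^ (D + 1) with hFc
  have hFc0 : 0 ≤ Fc := by
    have := (h.fMax_pos i).le
    have := ballVol_nonneg D
    positivity
  set j := ⌊r * H⌋₊ with hj
  have hj1 : (j : ℝ) ≤ r * H := Nat.floor_le (mul_nonneg hr.1 hH0.le)
  have hj2 : r * H < j + 1 := Nat.lt_floor_add_one _
  have hjH : j ≤ H := by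
    have : (j : ℝ) ≤ H := hj1.trans (mul_le_of_le_one_left hH0.le hr.2)
    exact_mod_cast this
  have hd : jointDist (r, x) ((j : ℝ) / H, z) ≤ 3 / H := by
    refine (jointDist_le_add _ _).trans ?_
    have e1 : |r - (j : ℝ) / H| ≤ 1 / H := by
      have : r - (j : ℝ) / H = (r * H - j) / H := by field_simp
      rw [this, abs_of_nonneg (div_nonneg (by linarith) hH0.le)]
      gcongr
      linarith
    have e2 : (3 : ℝ) / H = 1 / H + 2 * (1 / H) := by ring
    rw [e2]
    exact add_le_add e1 hxz
  have hlk : u / l ≤ l * k := by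
    rw [div_le_iff₀ hl]; linarith
  have hlk1 : 1 ≤ l * k := by
    have : l ^ 2 * k ≤ l * k := by
      have : l ^ 2 ≤ l := by nlinarith
      gcongr
    linarith
  have hNF : N * (Fc * (4 / H)) ≤ 1 / 2 := by
    have : N * (Fc * (4 / H)) = N * (θ.fMax * ballVol D * 2 ^ (D + 4)) / H / 2 := by
      rw [hFc, pow_add 2 D 4, pow_succ 2 D]; ring
    rw [this]
    have := div_le_one_of_le₀ hfine hH0.le
    linarith
  have hmassdef : B.mass i x r ρ = (B.law i).real (jball (r, x) ρ) := rfl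
  constructor
  · -- comparison with a slightly larger ball of the net
    set a := ⌈ρ * H⌉₊ + 3 with ha
    have ha1 : ρ * H ≤ ⌈ρ * H⌉₊ := Nat.le_ceil _
    have ha2 : (⌈ρ * H⌉₊ : ℝ) < ρ * H + 1 := Nat.ceil_lt_add_one (by positivity)
    have haH : a ≤ H + 3 := by
      have : ⌈ρ * H⌉₊ ≤ H := Nat.ceil_le.2 (mul_le_of_le_one_left hH0.le hρ1)
      omega
    have ha3 : ρ + 3 / H ≤ (a : ℝ) / H := by
      rw [ha, le_div_iff₀ hH0]; push_cast
      rw [add_mul, div_mul_cancel₀ _ hH0.ne']; linarith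
    have ha4 : (a : ℝ) / H ≤ ρ + 4 / H := by
      rw [ha, div_le_iff₀ hH0]; push_cast
      rw [add_mul, div_mul_cancel₀ _ hH0.ne']; linarith
    have hsub : jball (r, x) ρ ⊆ jball ((j : ℝ) / H, z) ((a : ℝ) / H) := fun w hw =>
      ((jointDist_triangle w (r, x) _).trans (add_le_add hw hd)).trans ha3
    have h1 := (hconc _ (jball_mem_netBalls hz hjH haH)).1
    have h2 : hits X Y I i (jball (r, x) ρ) n ω ≤
        hits X Y I i (jball ((j : ℝ) / H, z) ((a : ℝ) / H)) n ω := by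
      classical
      exact Finset.card_le_card (Finset.monotone_filter_right _ fun s _ hs => ⟨hs.1, hsub hs.2⟩)
    have h2' : (hits X Y I i (jball (r, x) ρ) n ω : ℝ) ≤
        hits X Y I i (jball ((j : ℝ) / H, z) ((a : ℝ) / H)) n ω := by exact_mod_cast h2
    have h3 := h.law_sub_le i (z := (r, x)) (z' := ((j : ℝ) / H, z)) (a := ρ)
      (d := (a : ℝ) / H - ρ) hρ hρ1
      (by have : (0 : ℝ) ≤ 3 / H := by positivity
          linarith)
      (by have : (4 : ℝ) / H ≤ 1 := by rw [div_le_one hH0]; exact hH4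
          linarith)
      (by rw [add_sub_cancel]; exact hsub)
    rw [add_sub_cancel] at h3
    have h4 : Fc * ((a : ℝ) / H - ρ) ≤ Fc * (4 / H) := by gcongr; linarith
    have h5 : N * (B.law i).real (jball ((j : ℝ) / H, z) ((a : ℝ) / H)) ≤
        N * B.mass i x r ρ + 1 / 2 := by
      have : N * (B.law i).real (jball ((j : ℝ) / H, z) ((a : ℝ) / H)) ≤
        N * (B.mass i x r ρ + Fc * (4 / H)) := by
        gcongr
        rw [hmassdef]
        linarith
      linarith
    have h6 : (1 + l) * (N * (B.law i).real (jball ((j : ℝ) / H, z) ((a : ℝ) / H))) ≤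
        (1 + l) * (N * B.mass i x r ρ + 1 / 2) := by gcongr
    linarith
  · rcases lt_or_ge ρ (4 / H) with hsmall | hlarge
    · have h1 : B.mass i x r ρ ≤ Fc * (4 / H) := by
        have e1 := h.law_real_le i (measurableSet_jball (r, x) ρ) (volume_jball_ne_top _ _)
        rw [volume_real_jball _ hρ] at e1
        have e2 : ρ ^ (D + 1) ≤ 2 ^ (D + 1) * (4 / H) := by
          calc ρ ^ (D + 1) ≤ 1 * ρ := by
                rw [pow_succ]; gcongr; exact pow_le_one₀ hρ.le hρ1
            _ ≤ 2 ^ (D + 1) * (4 / H) := by gcongr; exact one_le_pow₀ (by norm_num)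
        have := (h.fMax_pos i).le
        have := ballVol_nonneg D
        calc B.mass i x r ρ ≤ θ.fMax * (ballVol D * ρ ^ (D + 1)) := e1
          _ ≤ θ.fMax * (ballVol D * (2 ^ (D + 1) * (4 / H))) := by gcongr
          _ = _ := by rw [hFc]; ring
      have h2 : N * B.mass i x r ρ ≤ N * (Fc * (4 / H)) := by gcongr
      have h3 : 0 ≤ N * B.mass i x r ρ := mul_nonneg hN0 measureReal_nonneg
      have h4 : (0 : ℝ) ≤ hits X Y I i (jball (r, x) ρ) n ω := Nat.cast_nonneg _
      nlinarith [mul_nonneg hl.le h3]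
    · -- comparison with a slightly smaller ball of the net
      have hf4 : 4 ≤ ⌊ρ * H⌋₊ := Nat.le_floor (by
        rw [div_le_iff₀ hH0] at hlarge
        exact_mod_cast hlarge)
      set a := ⌊ρ * H⌋₊ - 3 with ha
      have ha0 : (a : ℝ) = ⌊ρ * H⌋₊ - 3 := by
        rw [ha, Nat.cast_sub (by omega)]; norm_num
      have ha1 : (⌊ρ * H⌋₊ : ℝ) ≤ ρ * H := Nat.floor_le (by positivity)
      have ha2 : ρ * H < (⌊ρ * H⌋₊ : ℝ) + 1 := Nat.lt_floor_add_one _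
      have hapos : 0 < (a : ℝ) / H := by
        have : (0 : ℝ) < a := by exact_mod_cast (by omega : 0 < a)
        positivity
      have haH : a ≤ H + 3 := by
        have : ⌊ρ * H⌋₊ ≤ H := by
          have : (⌊ρ * H⌋₊ : ℝ) ≤ H := ha1.trans (mul_le_of_le_one_left hH0.le hρ1)
          exact_mod_cast this
        omega
      have ha3 : (a : ℝ) / H ≤ ρ - 3 / H := by
        rw [ha0, div_le_iff₀ hH0, sub_mul, div_mul_cancel₀ _ hH0.ne']; linarith
      have ha4 : ρ - 4 / H ≤ (a : ℝ) / H := by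
        rw [ha0, le_div_iff₀ hH0, sub_mul, div_mul_cancel₀ _ hH0.ne']; linarith
      have h3H : (0 : ℝ) ≤ 3 / H := by positivity
      have hsub : jball ((j : ℝ) / H, z) ((a : ℝ) / H) ⊆ jball (r, x) ρ := fun w hw => by
        have e1 := jointDist_triangle w ((j : ℝ) / H, z) (r, x)
        rw [jointDist_comm ((j : ℝ) / H, z)] at e1
        have e2 : jointDist w ((j : ℝ) / H, z) ≤ (a : ℝ) / H := hw
        exact e1.trans (by linarith)
      have h1 := (hconc _ (jball_mem_netBalls hz hjH haH)).2
      have h2 : hits X Y I i (jball ((j : ℝ) / H, z) ((a : ℝ) / H)) n ω ≤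
          hits X Y I i (jball (r, x) ρ) n ω := by
        classical
        exact Finset.card_le_card (Finset.monotone_filter_right _ fun s _ hs => ⟨hs.1, hsub hs.2⟩)
      have h2' : (hits X Y I i (jball ((j : ℝ) / H, z) ((a : ℝ) / H)) n ω : ℝ) ≤
        hits X Y I i (jball (r, x) ρ) n ω := by exact_mod_cast h2
      have h3 := h.law_sub_le i (z := ((j : ℝ) / H, z)) (z' := (r, x)) (a := (a : ℝ) / H)
        (d := ρ - (a : ℝ) / H) hapos (by linarith) (by linarith)
        (by have : (4 : ℝ) / H ≤ 1 := by rw [div_le_one hH0]; exact hH4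
            linarith)
        (by rw [add_sub_cancel]; exact hsub)
      rw [add_sub_cancel] at h3
      have h4 : Fc * (ρ - (a : ℝ) / H) ≤ Fc * (4 / H) := by gcongr; linarith
      have h5 : N * B.mass i x r ρ ≤
          N * (B.law i).real (jball ((j : ℝ) / H, z) ((a : ℝ) / H)) + 1 / 2 := by
        have : N * B.mass i x r ρ ≤
            N * ((B.law i).real (jball ((j : ℝ) / H, z) ((a : ℝ) / H)) + Fc * (4 / H)) := by
          gcongr
          rw [hmassdef]
          linarith
        linarith
      have h6 : (1 - l) * (N * B.mass i x r ρ) ≤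
          (1 - l) * (N * (B.law i).real (jball ((j : ℝ) / H, z) ((a : ℝ) / H)) + 1 / 2) := by
        have : 0 ≤ 1 - l := by linarith
        gcongr
      linarith

/-- With probability more than `1 - δ`, the samples of all arms are good, where the error `l` is
of the order of the square root of `log (K n / δ) / k`, up to constants. -/
theorem exists_goodSample_const (D : ℕ) (θ : Params) : ∃ c : ℝ, 3 ≤ c ∧
    ∀ {K : ℕ} {Ω : Type*} [MeasurableSpace Ω] {P : Measure Ω} [IsProbabilityMeasure P]
      {B : Environment D K} {n : ℕ} {X : ℕ → Ω → Ctx D} {Y : Fin K → ℕ → Ω → ℝ}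
      {I : ℕ → Ω → Fin K}, Regular B θ → IsUniformSampling P B n X Y I → 1 ≤ n / K →
    ∀ {δ l : ℝ} {k : ℕ → ℕ}, Monotone k → 0 < δ → δ < 1 → 0 < l → l ≤ 1 →
      Real.log (c * K * ((n / K : ℕ) : ℝ) ^ (D + 3) / δ) ≤ l ^ 2 * k (n / K) →
      P {ω | ¬ ∀ i, GoodSample B i (armSample X Y I i n ω) (k (pulls I i n ω)) l} <
        ENNReal.ofReal δ := by
  -- the mesh `1 / H` of the net, up to the factor `n / K`
  obtain ⟨M, hM4, hM⟩ : ∃ M : ℕ, 4 ≤ M ∧ (θ.fMax * ballVol D * 2 ^ (D + 4) * 2 ≤ M ∧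
      ∀ H : ℕ, M ≤ H → 1 / (H : ℝ) ≤ θ.ρ₀ ∧ θ.Cα * (1 / (H : ℝ)) ^ θ.α ≤ θ.lam / 2) := by
    have t1 : Tendsto (fun H : ℕ => 1 / (H : ℝ)) atTop (𝓝 0) := tendsto_one_div_atTop_nhds_zero_nat
    have t2 : Tendsto (fun H : ℕ => θ.Cα * (1 / (H : ℝ)) ^ θ.α) atTop (𝓝 0) := by
      have := (t1.rpow_const (Or.inr θ.α_pos.le)).const_mul θ.Cα
      rwa [Real.zero_rpow θ.α_pos.ne', mul_zero] at this
    have e1 := (t1.eventually_le_const θ.ρ₀_pos).and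
      (t2.eventually_le_const (half_pos θ.lam_pos))
    obtain ⟨M₁, hM₁⟩ := eventually_atTop.1 e1
    obtain ⟨M₂, hM₂⟩ := exists_nat_ge (θ.fMax * ballVol D * 2 ^ (D + 4) * 2)
    refine ⟨max 4 (max M₁ M₂), le_max_left _ _, ?_, fun H hH => hM₁ H ?_⟩
    · exact hM₂.trans (by exact_mod_cast (le_max_right M₁ M₂).trans (le_max_right 4 _))
    · exact (le_max_left M₁ M₂).trans ((le_max_right 4 _).trans hH)
  have hs := slabConst_pos θ D
  have hlam := θ.lam_pos
  have hM0 : (0 : ℝ) < M := by exact_mod_cast (by omega : 0 < M)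
  set cA : ℝ := 8 / (θ.lam * slabConst θ D) * (M : ℝ) ^ (D + 3) with hcA
  have hcA0 : 0 < cA := by positivity
  refine ⟨max 3 (4 * cA), le_max_left _ _, ?_⟩
  intro K Ω _ P _ B n X Y I hreg hsamp hn δ l k hk hδ hδ1 hl hl1 hu
  set Nb := n / K with hNb
  set c := max 3 (4 * cA) with hc
  set u := Real.log (c * K * (Nb : ℝ) ^ (D + 3) / δ) with hu'
  have hK : 0 < K := by
    by_contra h0
    have : K = 0 := by omega
    subst this
    simp [hNb] at hn
  have hK1 : (1 : ℝ) ≤ K := by exact_mod_cast hK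
  have hNb1 : (1 : ℝ) ≤ Nb := by exact_mod_cast hn
  have hc3 : 3 ≤ c := le_max_left _ _
  have hNp : (1 : ℝ) ≤ (Nb : ℝ) ^ (D + 3) := one_le_pow₀ hNb1
  have hbig : 3 ≤ c * K * (Nb : ℝ) ^ (D + 3) / δ := by
    rw [le_div_iff₀ hδ]
    calc 3 * δ ≤ 3 * 1 := by gcongr
      _ = 3 * 1 * 1 := by ring
      _ ≤ c * K * (Nb : ℝ) ^ (D + 3) := by gcongr
  have hu1 : 1 ≤ u := by
    rw [hu', Real.le_log_iff_exp_le (by linarith)]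
    exact Real.exp_one_lt_d9.le.trans (by linarith)
  have hexp : Real.exp (-u) = δ / (c * K * (Nb : ℝ) ^ (D + 3)) := by
    rw [Real.exp_neg, hu', Real.exp_log (by linarith), inv_div]
  set H := M * Nb with hH
  have hMH : M ≤ H := Nat.le_mul_of_pos_right M hn
  have hH4 : 4 ≤ H := hM4.trans hMH
  have hH0 : (0 : ℝ) < H := by exact_mod_cast (by omega : 0 < H)
  obtain ⟨hHρ, hHC⟩ := hM.2 H hMH
  have hH1 : 1 / (H : ℝ) ≤ 1 := by
    rw [div_le_one hH0]; exact_mod_cast (by omega : 1 ≤ H)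
  have i₀ : Fin K := ⟨0, hK⟩
  have hprob : ∀ i, IsProbabilityMeasure (B.law i) := hsamp.isProbabilityMeasure_law
  obtain ⟨Z, hZ, hZcard⟩ := hreg.exists_net i₀ (η := 1 / (H : ℝ)) (by positivity) hH1 hHρ hHC
  have hmeas : ∀ A ∈ netBalls Z H, MeasurableSet A := by
    classical
    intro A hA
    obtain ⟨v, -, rfl⟩ := Finset.mem_image.1 hA
    exact measurableSet_jball _ _
  have hsub : {ω | ¬ ∀ i, GoodSample B i (armSample X Y I i n ω) (k (pulls I i n ω)) l} ⊆
      {ω | ¬ ∀ i, ∀ A ∈ netBalls Z H,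
      (hits X Y I i A n ω : ℝ) ≤ (1 + l) * (pulls I i n ω * (B.law i).real A) + u / l ∧
      (1 - l) * (pulls I i n ω * (B.law i).real A) - u / l ≤ hits X Y I i A n ω} := by
    intro ω hω hconc
    refine hω fun i => ?_
    obtain ⟨hp1, hp2⟩ := pulls_bounds (fun t ht => hsamp.least_pulled t ht ω) i
    refine hreg.goodSample_of_concentrated i hH4 hZ hl hl1 (hu.trans ?_) hu1 ?_ (hconc i)
    · have : (k Nb : ℝ) ≤ k (pulls I i n ω) := by exact_mod_cast hk hp1
      gcongr
    · have e1 : (pulls I i n ω : ℝ) ≤ 2 * Nb := by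
        have : pulls I i n ω ≤ 2 * Nb := by omega
        exact_mod_cast this
      have := (hreg.fMax_pos i).le
      have := ballVol_nonneg D
      calc pulls I i n ω * (θ.fMax * ballVol D * 2 ^ (D + 4))
          ≤ 2 * Nb * (θ.fMax * ballVol D * 2 ^ (D + 4)) := by gcongr
        _ = (θ.fMax * ballVol D * 2 ^ (D + 4) * 2) * Nb := by ring
        _ ≤ M * Nb := by gcongr; exact hM.1
        _ = H := by rw [hH]; push_cast; ring
  refine (measure_mono hsub).trans_lt ((hsamp.measure_not_concentrated_le (netBalls Z H) hmeas u hl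
    hl1).trans_lt ((ENNReal.ofReal_lt_ofReal_iff hδ).2 ?_))
  have hcard : ((netBalls Z H).card : ℝ) ≤ cA * (Nb : ℝ) ^ (D + 3) := by
    have e1 : ((netBalls Z H).card : ℝ) ≤ Z.card * (4 * (H : ℝ) ^ 2) := by
      exact_mod_cast card_netBalls_le Z hH4
    have e2 : (Z.card : ℝ) ≤ 2 / (θ.lam * slabConst θ D) * (H : ℝ) ^ (D + 1) := by
      rw [one_div, inv_pow] at hZcard
      have e3 : Z.card * (θ.lam / 2 * (slabConst θ D * ((H : ℝ) ^ (D + 1))⁻¹)) =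
        Z.card / (2 / (θ.lam * slabConst θ D) * (H : ℝ) ^ (D + 1)) := by field_simp
      rw [e3, div_le_one (by positivity)] at hZcard
      exact hZcard
    calc ((netBalls Z H).card : ℝ) ≤ Z.card * (4 * (H : ℝ) ^ 2) := e1
      _ ≤ 2 / (θ.lam * slabConst θ D) * (H : ℝ) ^ (D + 1) * (4 * (H : ℝ) ^ 2) := by gcongr
      _ = 8 / (θ.lam * slabConst θ D) * (H : ℝ) ^ (D + 3) := by ring
      _ = cA * (Nb : ℝ) ^ (D + 3) := by
        rw [hcA, hH]; push_cast; rw [mul_pow]; ring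
  rw [hexp, ← mul_div_assoc, div_lt_iff₀ (by positivity)]
  have hc4 : 4 * cA ≤ c := le_max_right _ _
  calc K * ((netBalls Z H).card : ℝ) * 2 * δ ≤ K * (cA * (Nb : ℝ) ^ (D + 3)) * 2 * δ := by gcongr
    _ < K * (cA * (Nb : ℝ) ^ (D + 3)) * 4 * δ := by gcongr; norm_num
    _ = δ * (4 * cA * K * (Nb : ℝ) ^ (D + 3)) := by ring
    _ ≤ δ * (c * K * (Nb : ℝ) ^ (D + 3)) := by gcongr

end GoodEvent

end ModalBandit

namespace ModalBandit

variable {D K : ℕ}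

/-! ### Rates -/

/-- The exponent `α / (2 α + D + 1)` of the accuracy of the density estimate. -/
def densityExp (θ : Params) (D : ℕ) : ℝ := θ.α / (2 * θ.α + D + 1)

theorem denom_pos (θ : Params) (D : ℕ) : 0 < 2 * θ.α + D + 1 := by
  have := θ.α_pos
  positivity

theorem densityExp_pos (θ : Params) (D : ℕ) : 0 < densityExp θ D :=
  div_pos θ.α_pos (denom_pos θ D)

theorem densityExp_le_one (θ : Params) (D : ℕ) : densityExp θ D ≤ 1 := by
  rw [densityExp, div_le_one (denom_pos θ D)]
  have := θ.α_pos
  have : (0 : ℝ) ≤ D := Nat.cast_nonneg D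
  linarith

theorem rateExp_eq (θ : Params) (D : ℕ) : rateExp θ.α D = 2 / densityExp θ D := by
  have := θ.α_pos
  have := denom_pos θ D
  rw [rateExp, densityExp]
  field_simp
  ring

theorem rpow_le_kSetting (θ : Params) (D N : ℕ) :
    (N : ℝ) ^ (2 * densityExp θ D) ≤ kSetting θ.α D N := by
  rw [densityExp, ← mul_div_assoc]
  exact Nat.le_ceil _

section KSetting

variable {N : ℕ} (θ : Params) (D : ℕ)

theorem one_le_cast (hN : 1 ≤ N) : (1 : ℝ) ≤ N := by exact_mod_cast hN

theorem kSetting_le_two_mul (hN : 1 ≤ N) :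
    (kSetting θ.α D N : ℝ) ≤ 2 * (N : ℝ) ^ (2 * densityExp θ D) := by
  have h1 : (1 : ℝ) ≤ (N : ℝ) ^ (2 * densityExp θ D) :=
    Real.one_le_rpow (one_le_cast hN) (by linarith [densityExp_pos θ D])
  have h2 : (kSetting θ.α D N : ℝ) < (N : ℝ) ^ (2 * densityExp θ D) + 1 := by
    rw [densityExp, ← mul_div_assoc]
    exact Nat.ceil_lt_add_one (Real.rpow_nonneg (Nat.cast_nonneg N) _)
  linarith

theorem kSetting_pos (hN : 1 ≤ N) : 0 < kSetting θ.α D N :=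
  Nat.ceil_pos.2 (Real.rpow_pos_of_pos (by exact_mod_cast hN) _)

theorem kSetting_le_self (hN : 1 ≤ N) : kSetting θ.α D N ≤ N := by
  refine Nat.ceil_le.2 ?_
  have h1 : 2 * θ.α / (2 * θ.α + D + 1) ≤ 1 := by
    rw [div_le_one (denom_pos θ D)]
    have : (0 : ℝ) ≤ D := Nat.cast_nonneg D
    linarith
  simpa using Real.rpow_le_rpow_of_exponent_le (one_le_cast hN) h1

theorem kSetting_mono : Monotone (kSetting θ.α D) := by
  intro N N' h
  refine Nat.ceil_mono (Real.rpow_le_rpow (Nat.cast_nonneg N) (by exact_mod_cast h) ?_)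
  have := θ.α_pos
  have := denom_pos θ D
  positivity

theorem mul_rpow_eq (hN : 1 ≤ N) :
    (N : ℝ) * ((N : ℝ) ^ (-(1 / (2 * θ.α + D + 1)))) ^ (D + 1) =
      (N : ℝ) ^ (2 * densityExp θ D) := by
  have hN0 : (0 : ℝ) < N := by exact_mod_cast hN
  have hd := denom_pos θ D
  rw [← Real.rpow_natCast, ← Real.rpow_mul hN0.le]
  nth_rewrite 1 [← Real.rpow_one (N : ℝ)]
  rw [← Real.rpow_add hN0, densityExp]
  congr 1
  push_cast
  field_simp
  ring

theorem rpow_rpow_eq : ((N : ℝ) ^ (-(1 / (2 * θ.α + D + 1)))) ^ θ.α =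
    (N : ℝ) ^ (-densityExp θ D) := by
  rw [← Real.rpow_mul (Nat.cast_nonneg N), densityExp]
  congr 1
  ring

theorem rpow_neg_one_div_le (hN : 1 ≤ N) :
    (N : ℝ) ^ (-(1 / (2 * θ.α + D + 1))) ≤ (N : ℝ) ^ (-densityExp θ D) := by
  refine Real.rpow_le_rpow_of_exponent_le (one_le_cast hN) (neg_le_neg ?_)
  rw [densityExp]
  exact div_le_div_of_nonneg_right θ.α_le (denom_pos θ D).le

theorem one_div_le_of_sq_le {m : ℕ} (hN : 1 ≤ N) (hm : kSetting θ.α D N ^ 2 ≤ m) :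
    0 < m ∧ 1 / (m : ℝ) ≤ (N : ℝ) ^ (-densityExp θ D) := by
  have hk := kSetting_pos θ D hN
  have hm0 : 0 < m := (pow_pos hk 2).trans_le hm
  have hN0 : (0 : ℝ) < N := by exact_mod_cast hN
  refine ⟨hm0, ?_⟩
  rw [Real.rpow_neg hN0.le, one_div]
  refine inv_anti₀ (Real.rpow_pos_of_pos hN0 _) ?_
  have h1 : (kSetting θ.α D N : ℝ) ≤ m := by
    exact_mod_cast (Nat.le_self_pow two_ne_zero _).trans hm
  refine le_trans ?_ ((rpow_le_kSetting θ D N).trans h1)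
  exact Real.rpow_le_rpow_of_exponent_le (one_le_cast hN) (by linarith [densityExp_pos θ D])

end KSetting

theorem rpow_le_self_of_one_le {x α : ℝ} (hx : 1 ≤ x) (hα : α ≤ 1) : x ^ α ≤ x := by
  simpa using Real.rpow_le_rpow_of_exponent_le hx hα

/-- A good sample gives rise to a setup for the estimators as soon as the error `l` of the counts
and the accuracy `N ^ (-α / (2 α + D + 1))` are small; the factor `E` enlarges the radius. -/
theorem exists_knnSetup_const (D : ℕ) (θ : Params) : ∃ a ω₀ c : ℝ, 1 ≤ a ∧ 0 < ω₀ ∧ ω₀ ≤ 1 ∧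
    1 ≤ c ∧ ∀ {K : ℕ} {B : Environment D K} {i : Fin K} {S : Multiset (ℝ × Ctx D)} {m : ℕ}
      {l E ω : ℝ}, Regular B θ → 1 ≤ S.card → kSetting θ.α D S.card ^ 2 ≤ m →
      GoodSample B i S (kSetting θ.α D S.card) l → 0 ≤ l → l ≤ ω → 1 ≤ E →
      E * (S.card : ℝ) ^ (-densityExp θ D) ≤ ω → ω ≤ ω₀ →
      KnnSetup B θ i S (kSetting θ.α D S.card) m l
        (2 * a * E * (S.card : ℝ) ^ (-(1 / (2 * θ.α + D + 1))))
        (a * (S.card : ℝ) ^ (-(1 / (2 * θ.α + D + 1)))) ∧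
      2 * a * E * (S.card : ℝ) ^ (-(1 / (2 * θ.α + D + 1))) + 2 / m ≤ c * ω ∧
      ∀ τ, 0 ≤ τ → compError θ D m l
        (2 * a * E * (S.card : ℝ) ^ (-(1 / (2 * θ.α + D + 1)))) τ ≤ c * (ω + τ) := by
  have hs := slabConst_pos θ D
  have hlam := θ.lam_pos
  have hcU := θ.cUp_pos
  set a := max 1 (8 / (θ.lam * slabConst θ D)) with ha
  have ha1 : 1 ≤ a := le_max_left _ _
  have ha2 : 8 ≤ θ.lam * slabConst θ D * a := by
    have : 8 / (θ.lam * slabConst θ D) ≤ a := le_max_right _ _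
    rw [div_le_iff₀ (by positivity)] at this
    linarith
  set c₁ := 2 * a + 2 with hc₁
  have hc₁1 : 1 ≤ c₁ := by linarith
  have hc₁0 : 0 < c₁ := by linarith
  set c₂ := θ.cUp * c₁ ^ 2 + |θ.Cα| * c₁ with hc₂
  have hc₂0 : 0 < c₂ := by positivity
  set ω₀ := min (min (1 / 16) (1 / (4 * c₁))) (min (min (θ.ρ₀ / c₁) (θ.rM / c₁))
    (θ.lam / 2 / c₂)) with hω₀
  have hρ₀ := θ.ρ₀_pos
  have hrM := θ.rM_pos
  have hω₀0 : 0 < ω₀ := by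
    refine lt_min (lt_min ?_ ?_) (lt_min (lt_min ?_ ?_) ?_) <;> positivity
  set c₃ := |compConst θ D| * (1 + |θ.Cα| * c₁) + θ.cUp * c₁ ^ 2 + c₁ with hc₃
  have hp1 : 0 ≤ |compConst θ D| * (1 + |θ.Cα| * c₁) := by positivity
  have hp2 : 0 ≤ θ.cUp * c₁ ^ 2 := by positivity
  refine ⟨a, ω₀, c₃, ha1, hω₀0, ?_, by linarith, ?_⟩
  · exact (min_le_left _ _).trans ((min_le_left _ _).trans (by norm_num))
  intro K B i S m l E ω hreg hN hm hS hl hlω hE hEω hω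
  have h16 : ω ≤ 1 / 16 := hω.trans ((min_le_left _ _).trans (min_le_left _ _))
  have h4 : c₁ * ω ≤ 1 / 4 := by
    have : ω ≤ 1 / (4 * c₁) := hω.trans ((min_le_left _ _).trans (min_le_right _ _))
    rw [le_div_iff₀ (by positivity)] at this
    linarith
  have hρ : c₁ * ω ≤ θ.ρ₀ := by
    have : ω ≤ θ.ρ₀ / c₁ :=
      hω.trans ((min_le_right _ _).trans ((min_le_left _ _).trans (min_le_left _ _)))
    rwa [le_div_iff₀ hc₁0, mul_comm] at this
  have hr : c₁ * ω ≤ θ.rM := by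
    have : ω ≤ θ.rM / c₁ :=
      hω.trans ((min_le_right _ _).trans ((min_le_left _ _).trans (min_le_right _ _)))
    rwa [le_div_iff₀ hc₁0, mul_comm] at this
  have hd : c₂ * ω ≤ θ.lam / 2 := by
    have : ω ≤ θ.lam / 2 / c₂ := hω.trans ((min_le_right _ _).trans (min_le_right _ _))
    rwa [le_div_iff₀ hc₂0, mul_comm] at this
  set N := S.card with hNdef
  set k := kSetting θ.α D N with hk
  set x := (N : ℝ) ^ (-(1 / (2 * θ.α + D + 1))) with hx
  set y := (N : ℝ) ^ (-densityExp θ D) with hy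
  have hN0 : (0 : ℝ) < N := by exact_mod_cast hN
  have hx0 : 0 < x := Real.rpow_pos_of_pos hN0 _
  have hy0 : 0 < y := Real.rpow_pos_of_pos hN0 _
  have hxy : x ≤ y := rpow_neg_one_div_le θ D hN
  obtain ⟨hm0, hmy⟩ := one_div_le_of_sq_le θ D hN hm
  have hyω : y ≤ ω := (le_mul_of_one_le_left hy0.le hE).trans hEω
  have hω0 : 0 < ω := hy0.trans_le hyω
  set R := 2 * a * E * x with hR
  have hRω : R ≤ 2 * a * ω := by
    calc R = 2 * a * (E * x) := by ring
      _ ≤ 2 * a * (E * y) := by gcongr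
      _ ≤ 2 * a * ω := by gcongr
  have hRα : R ^ θ.α ≤ c₁ * ω := by
    have e1 : (1 : ℝ) ≤ 2 * a * E := by nlinarith
    calc R ^ θ.α = (2 * a * E) ^ θ.α * y := by
          rw [hR, Real.mul_rpow (by positivity) hx0.le, hx, rpow_rpow_eq]
      _ ≤ 2 * a * E * y := by gcongr; exact rpow_le_self_of_one_le e1 θ.α_le
      _ = 2 * a * (E * y) := by ring
      _ ≤ 2 * a * ω := by gcongr
      _ ≤ c₁ * ω := by gcongr; linarith
  have h2m : 2 / (m : ℝ) ≤ 2 * ω := by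
    have : 2 / (m : ℝ) = 2 * (1 / m) := by ring
    rw [this]
    linarith
  have h2m0 : 0 ≤ 2 / (m : ℝ) := by positivity
  have hRm : R + 2 / m ≤ c₁ * ω := by
    rw [hc₁]; linarith
  have hR0 : 0 < R := by positivity
  have hRc : R ≤ c₁ * ω := by linarith
  have hsq : (R + 2 / m) ^ 2 ≤ c₁ ^ 2 * ω := by
    calc (R + 2 / m) ^ 2 ≤ (c₁ * ω) ^ 2 := by gcongr
      _ = c₁ ^ 2 * (ω * ω) := by ring
      _ ≤ c₁ ^ 2 * (ω * 1) := by gcongr; linarith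
      _ = c₁ ^ 2 * ω := by ring
  have hcsq : θ.cUp * (R + 2 / m) ^ 2 ≤ θ.cUp * c₁ ^ 2 * ω := by
    rw [mul_assoc]; gcongr
  have hCR : θ.Cα * R ^ θ.α ≤ |θ.Cα| * c₁ * ω := by
    have := Real.rpow_nonneg hR0.le θ.α
    rw [mul_assoc]
    exact mul_le_mul (le_abs_self _) hRα this (abs_nonneg _)
  have hCR0 : 0 ≤ θ.Cα * R ^ θ.α := mul_nonneg (hreg.Cα_nonneg i) (Real.rpow_nonneg hR0.le _)
  refine ⟨⟨hreg, hS, hl, hlω.trans h16, kSetting_pos θ D hN, kSetting_le_self θ D hN,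
    by positivity, ?_, hRc.trans h4, hRc.trans hρ, hm0, by linarith, hRm.trans hr, ?_, ?_⟩,
    ?_, ?_⟩
  · calc 2 * (a * x) = 2 * a * 1 * x := by ring
      _ ≤ 2 * a * E * x := by gcongr
  · refine le_trans ?_ hd
    rw [hc₂, add_mul]
    exact add_le_add hcsq hCR
  · have e1 : (k : ℝ) ≤ 2 * (N : ℝ) ^ (2 * densityExp θ D) := kSetting_le_two_mul θ D hN
    have e2 : a ≤ a ^ (D + 1) := le_self_pow₀ ha1 (by omega)
    rw [← hNdef]
    calc 4 * (k : ℝ) ≤ 8 * (N : ℝ) ^ (2 * densityExp θ D) := by linarith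
      _ ≤ (θ.lam * slabConst θ D * a) * (N : ℝ) ^ (2 * densityExp θ D) := by gcongr
      _ ≤ (θ.lam * slabConst θ D * a ^ (D + 1)) * (N : ℝ) ^ (2 * densityExp θ D) := by gcongr
      _ = (θ.lam * slabConst θ D * a ^ (D + 1)) * (N * x ^ (D + 1)) := by
          rw [hx, mul_rpow_eq θ D hN]
      _ = N * (θ.lam * slabConst θ D * (a * x) ^ (D + 1)) := by rw [mul_pow]; ring
  · refine hRm.trans ?_
    have : c₁ ≤ c₃ := by rw [hc₃]; linarith
    gcongr
  · intro τ hτ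
    rw [compError]
    have e1 : compConst θ D * (l + θ.Cα * R ^ θ.α + τ) ≤
        |compConst θ D| * (ω + |θ.Cα| * c₁ * ω + τ) := by
      refine (mul_le_mul_of_nonneg_right (le_abs_self _) (by positivity)).trans ?_
      gcongr
    have e2 : 0 ≤ |compConst θ D| * (|θ.Cα| * c₁) * τ := by positivity
    have e3 : 0 ≤ θ.cUp * c₁ ^ 2 * τ := by positivity
    have e4 : 0 ≤ c₁ * ω := by positivity
    have e5 : 0 ≤ c₁ * τ := by positivity
    have e6 : c₃ * (ω + τ) = |compConst θ D| * (ω + |θ.Cα| * c₁ * ω + τ) +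
      |compConst θ D| * (|θ.Cα| * c₁) * τ + θ.cUp * c₁ ^ 2 * ω + θ.cUp * c₁ ^ 2 * τ +
      c₁ * ω + c₁ * τ := by rw [hc₃]; ring
    rw [e6]
    linarith

/-- The accuracy of density comparisons, up to constants, with samples of size `N` and
`ℓ = 1 + log (K / δ)`. -/
def rateError (θ : Params) (D : ℕ) (ℓ : ℝ) (N : ℕ) : ℝ :=
  (N : ℝ) ^ (-densityExp θ D) * (ℓ + Real.log N)

theorem rateError_nonneg (θ : Params) (D : ℕ) {ℓ : ℝ} (hℓ : 0 ≤ ℓ) (N : ℕ) :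
    0 ≤ rateError θ D ℓ N :=
  mul_nonneg (Real.rpow_nonneg (Nat.cast_nonneg N) _)
    (add_nonneg hℓ (Real.log_natCast_nonneg N))

theorem rpow_le_rateError (θ : Params) (D : ℕ) {ℓ : ℝ} (hℓ : 1 ≤ ℓ) (N : ℕ) :
    (N : ℝ) ^ (-densityExp θ D) ≤ rateError θ D ℓ N :=
  le_mul_of_one_le_right (Real.rpow_nonneg (Nat.cast_nonneg N) _)
    (by linarith [Real.log_natCast_nonneg N])

theorem rateError_le_two_mul (θ : Params) (D : ℕ) {ℓ : ℝ} (hℓ : 0 ≤ ℓ) {N N' : ℕ} (hN : 1 ≤ N)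
    (h : N ≤ N') (h' : N' ≤ N + 1) : rateError θ D ℓ N ≤ 2 * rateError θ D ℓ N' := by
  have hN0 : (0 : ℝ) < N := by exact_mod_cast hN
  have hNN : (N : ℝ) ≤ N' := by exact_mod_cast h
  have hN'0 : (0 : ℝ) < N' := hN0.trans_le hNN
  have hN2 : (N' : ℝ) ≤ 2 * N := by exact_mod_cast (by omega : N' ≤ 2 * N)
  have hγ := densityExp_pos θ D
  have h1 : (N : ℝ) ^ (-densityExp θ D) ≤ 2 * (N' : ℝ) ^ (-densityExp θ D) := by
    rw [Real.rpow_neg hN0.le, Real.rpow_neg hN'0.le, ← div_eq_mul_inv,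
      inv_le_comm₀ (Real.rpow_pos_of_pos hN0 _) (by positivity), inv_div]
    rw [div_le_iff₀ two_pos]
    calc (N' : ℝ) ^ densityExp θ D ≤ (2 * N) ^ densityExp θ D := by gcongr
      _ = 2 ^ densityExp θ D * (N : ℝ) ^ densityExp θ D := Real.mul_rpow two_pos.le hN0.le
      _ ≤ 2 * (N : ℝ) ^ densityExp θ D := by
          gcongr
          exact rpow_le_self_of_one_le one_le_two (densityExp_le_one θ D)
      _ = _ := mul_comm _ _
  have h2 : Real.log N ≤ Real.log N' := Real.log_le_log hN0 hNN
  have h3 := Real.log_natCast_nonneg N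
  calc rateError θ D ℓ N ≤ (2 * (N' : ℝ) ^ (-densityExp θ D)) * (ℓ + Real.log N') := by
        rw [rateError]; gcongr
    _ = _ := by rw [rateError]; ring

/-- With probability more than `1 - δ`, the samples of all arms are good with an error of the
order of `rateError`. -/
theorem exists_good_event (D : ℕ) (θ : Params) : ∃ c : ℝ, 1 ≤ c ∧
    ∀ {K : ℕ} {Ω : Type*} [MeasurableSpace Ω] {P : Measure Ω} [IsProbabilityMeasure P]
      {B : Environment D K} {n : ℕ} {X : ℕ → Ω → Ctx D} {Y : Fin K → ℕ → Ω → ℝ}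
      {I : ℕ → Ω → Fin K}, Regular B θ → IsUniformSampling P B n X Y I → 1 ≤ n / K →
    ∀ {δ : ℝ}, 0 < δ → δ < 1 → c * rateError θ D (1 + Real.log (K / δ)) (n / K) ≤ 1 →
      P {ω | ¬ ∀ i, GoodSample B i (armSample X Y I i n ω) (kSetting θ.α D (pulls I i n ω))
        (c * rateError θ D (1 + Real.log (K / δ)) (n / K))} < ENNReal.ofReal δ := by
  obtain ⟨c, hc, hgood⟩ := exists_goodSample_const D θ
  have hlogc : 0 < Real.log c := Real.log_pos (by linarith)
  have hD : (0 : ℝ) ≤ D := Nat.cast_nonneg D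
  refine ⟨Real.log c + D + 3, by linarith, ?_⟩
  intro K Ω _ P _ B n X Y I hreg hsamp hn δ hδ hδ1 hsmall
  have hK : 0 < K := by
    by_contra h0
    have : K = 0 := by omega
    subst this
    simp at hn
  set Nb := n / K with hNb
  have hNb0 : (0 : ℝ) < Nb := by exact_mod_cast hn
  have hK1 : (1 : ℝ) ≤ K := by exact_mod_cast hK
  have hKδ : 0 < Real.log (K / δ) := Real.log_pos (by rw [lt_div_iff₀ hδ]; linarith)
  set ℓ := 1 + Real.log (K / δ) with hℓ
  set c' := Real.log c + D + 3 with hc'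
  have hlogN := Real.log_natCast_nonneg Nb
  have hy : 0 < (Nb : ℝ) ^ (-densityExp θ D) := Real.rpow_pos_of_pos hNb0 _
  have hrate : 0 < rateError θ D ℓ Nb := mul_pos hy (by linarith)
  refine hgood hreg hsamp hn (kSetting_mono θ D) hδ hδ1 (mul_pos (by linarith) hrate) hsmall ?_
  rw [mul_div_right_comm, mul_div_assoc, Real.log_mul (by positivity) (by positivity),
    Real.log_mul (by linarith) (by positivity), Real.log_pow]
  have h1 : Real.log c + Real.log (K / δ) + ((D + 3 : ℕ) : ℝ) * Real.log Nb ≤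
      c' * (ℓ + Real.log Nb) := by
    push_cast
    nlinarith [mul_nonneg hlogc.le hKδ.le, mul_nonneg hlogc.le hlogN, mul_nonneg hD hKδ.le]
  have h2 : c' * (ℓ + Real.log Nb) ≤ (c' * (ℓ + Real.log Nb)) ^ 2 := by
    have : 1 ≤ c' * (ℓ + Real.log Nb) := by nlinarith
    nlinarith
  refine h1.trans (h2.trans ?_)
  have h3 : (Nb : ℝ) ^ (-densityExp θ D) * (Nb : ℝ) ^ (-densityExp θ D) *
      (Nb : ℝ) ^ (2 * densityExp θ D) = 1 := by
    rw [← Real.rpow_add hNb0, ← Real.rpow_add hNb0]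
    convert Real.rpow_zero (Nb : ℝ) using 2
    ring
  have h4 := rpow_le_kSetting θ D Nb
  calc (c' * (ℓ + Real.log Nb)) ^ 2
      = (c' * (ℓ + Real.log Nb)) ^ 2 * ((Nb : ℝ) ^ (-densityExp θ D) *
        (Nb : ℝ) ^ (-densityExp θ D) * (Nb : ℝ) ^ (2 * densityExp θ D)) := by rw [h3, mul_one]
    _ = (c' * rateError θ D ℓ Nb) ^ 2 * (Nb : ℝ) ^ (2 * densityExp θ D) := by
        rw [rateError]; ring
    _ ≤ _ := by gcongr

/-- The `p`-mode is the smallest element of a set of `min p (number of modes)` modes that are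
higher than the other ones. -/
theorem Regular.value_eq_of_gap {B : Environment D K} {θ : Params} (h : Regular B θ) {p : ℕ}
    {i : Fin K} {x : Ctx D} (hx : x ∈ B.𝒳) {T : Set ℝ} (hT : T ⊆ modes fun r => B.f i r x)
    (hcard : T.encard = min (p : ℕ∞) (modes fun r => B.f i r x).encard) {Δ : ℝ} (hΔ : 0 ≤ Δ)
    (hgap : ∀ j ∈ T, ∀ j' ∈ modes (fun r => B.f i r x) \ T, Δ < B.f i j x - B.f i j' x) :
    B.value p i x = sInf T := by
  rw [h.value_eq p i hx, topModes_eq hT hcard fun j hj j' hj' => ?_]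
  linarith [hgap j hj j' hj']

/-- In a salient context the mode estimate is close to the mode. -/
theorem KnnSetup.abs_sub_value_le {B : Environment D K} {θ : Params} {i : Fin K}
    {S : Multiset (ℝ × Ctx D)} {k m : ℕ} {l R R₁ : ℝ} {x : Ctx D}
    (h : KnnSetup B θ i S k m l R R₁) {η w a : ℝ} (hη : 0 ≤ η)
    (hx : x ∈ B.salientRegion 1 η) (hE : compError θ D m l R R < θ.cLow * θ.rM ^ 2)
    (hEη : compError θ D m l R R ≤ η) (hw0 : 0 ≤ w) (hw : compError θ D m l R R ≤ θ.cLow * w ^ 2)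
    (ha : IsModeEstimate S k m x a) : |a - B.value 1 i x| ≤ w := by
  obtain ⟨hx𝒳, hsal⟩ := hx
  obtain ⟨T, hT, hcard, hgap⟩ := hsal i
  rw [h.regular.modes_cond i hx𝒳] at hT hcard hgap
  have hne := (h.regular.modalShape i hx𝒳).exists_mode
  have hT1 : T.encard = 1 := by
    rw [hcard]
    simpa using Set.one_le_encard_iff_nonempty.2 hne
  obtain ⟨t, rfl⟩ := Set.encard_eq_one.1 hT1
  rw [h.regular.value_eq_of_gap hx𝒳 hT (by exact_mod_cast hcard) hη hgap, csInf_singleton]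
  have h1 := h.modeEstimate_close hx𝒳 (hT rfl) (fun t' ht' hne => by
    have := hgap t rfl t' ⟨ht', hne⟩
    linarith) hE ha
  have h2 := le_of_mul_le_mul_left (h1.trans hw) θ.cLow_pos
  rw [abs_sub_comm]
  exact abs_le_of_sq_le_sq h2 hw0

theorem value_mem_Icc (B : Environment D K) (p : ℕ) (i : Fin K) (x : Ctx D) :
    B.value p i x ∈ Icc (0 : ℝ) 1 := pMode_mem_Icc _ _

/-- The sample size required for `Δ`-optimality makes the error at most of the order of `Δ ^ 2`.
With `y = N ^ (1 / q)` and `s = y Δ`, both `ℓ` and `|log Δ|` are at most `s` and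
`log y ≤ s + |log Δ|`, so `ℓ + log N` is at most a multiple of `s`. -/
theorem rateError_le_of_size (θ : Params) (D : ℕ) {c : ℝ} (hc : 0 < c) : ∃ C : ℝ, 1 ≤ C ∧
    ∀ {ℓ Δ : ℝ} {N : ℕ}, 1 ≤ ℓ → 0 < Δ → Δ < 1 →
      C * (ℓ * (1 + |Real.log Δ|)) ^ ⌈rateExp θ.α D⌉₊ * Δ ^ (-rateExp θ.α D) ≤ 2 * N →
      rateError θ D ℓ N ≤ c * Δ ^ 2 := by
  set q := rateExp θ.α D with hq
  have hγ := densityExp_pos θ D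
  have hq2 : q = 2 / densityExp θ D := rateExp_eq θ D
  have hq0 : 0 < q := by rw [hq2]; positivity
  have hq1 : 1 ≤ q := by
    rw [hq2, le_div_iff₀ hγ]
    linarith [densityExp_le_one θ D]
  set C' := max 2 (2 * ((2 + 3 * q) / c)) with hC'
  have hC'2 : 2 ≤ C' := le_max_left _ _
  have hC'c : 2 * ((2 + 3 * q) / c) ≤ C' := le_max_right _ _
  refine ⟨C' ^ q, Real.one_le_rpow (by linarith) hq0.le, ?_⟩
  intro ℓ Δ N hℓ hΔ hΔ1 h
  set b := ℓ * (1 + |Real.log Δ|) with hb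
  have habs := abs_nonneg (Real.log Δ)
  have hb1 : 1 ≤ b := by nlinarith
  have hbq : b ^ q ≤ b ^ ⌈q⌉₊ := by
    rw [← Real.rpow_natCast]
    exact Real.rpow_le_rpow_of_exponent_le hb1 (Nat.le_ceil q)
  have h1 : (C' * b / Δ) ^ q ≤ 2 * N := by
    refine le_trans (le_of_eq ?_) ((mul_le_mul_of_nonneg_right (mul_le_mul_of_nonneg_left hbq
      (by positivity : 0 ≤ C' ^ q)) (Real.rpow_nonneg hΔ.le _)).trans h)
    rw [Real.div_rpow (by positivity) hΔ.le, Real.mul_rpow (by linarith) (by linarith),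
      Real.rpow_neg hΔ.le, div_eq_mul_inv]
  have hN0 : (0 : ℝ) < N := by
    have : 0 < (C' * b / Δ) ^ q := by positivity
    linarith
  set y := (N : ℝ) ^ (1 / q) with hy
  have hy0 : 0 < y := Real.rpow_pos_of_pos hN0 _
  have h2 : C' * b / Δ ≤ 2 * y := by
    have e1 : C' * b / Δ ≤ (2 * N) ^ (1 / q) := by
      rw [one_div, Real.le_rpow_inv_iff_of_pos (by positivity) (by positivity) hq0]
      exact h1
    refine e1.trans ?_
    rw [Real.mul_rpow two_pos.le hN0.le]
    gcongr
    exact rpow_le_self_of_one_le one_le_two (by rw [div_le_one hq0]; exact hq1)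
  set s := y * Δ with hs
  have hs0 : 0 < s := by positivity
  have h3 : C' * b ≤ 2 * s := by
    rw [div_le_iff₀ hΔ] at h2
    linarith
  have hbs : b ≤ s := by nlinarith
  have hlogy : Real.log y ≤ s + |Real.log Δ| := by
    have e1 : Real.log s = Real.log y + Real.log Δ := Real.log_mul hy0.ne' hΔ.ne'
    have e2 := Real.log_le_sub_one_of_pos hs0
    have e3 := neg_abs_le (Real.log Δ)
    linarith
  have hlogN : Real.log N = q * Real.log y := by
    rw [hy, Real.log_rpow hN0, one_div, mul_inv_cancel_left₀ hq0.ne']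
  have hℓb : ℓ ≤ b := by nlinarith
  have hΔb : |Real.log Δ| ≤ b := by nlinarith
  have h4 : ℓ + Real.log N ≤ (2 + 3 * q) * s := by
    rw [hlogN]
    have : q * Real.log y ≤ q * (s + s) := by
      gcongr
      linarith
    nlinarith
  have h5 : (2 + 3 * q) * s ≤ c * s ^ 2 := by
    have e1 : (2 + 3 * q) / c ≤ s := by nlinarith
    rw [div_le_iff₀ hc] at e1
    nlinarith
  have hyN : (N : ℝ) ^ (-densityExp θ D) = (y ^ 2)⁻¹ := by
    rw [hy, ← Real.rpow_natCast, ← Real.rpow_mul hN0.le, Real.rpow_neg hN0.le, hq2]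
    congr 2
    push_cast
    field_simp
  rw [rateError, hyN, inv_mul_le_iff₀ (by positivity)]
  calc ℓ + Real.log N ≤ c * s ^ 2 := h4.trans h5
    _ = y ^ 2 * (c * Δ ^ 2) := by rw [hs]; ring

end ModalBandit

namespace ModalBandit

variable {D K : ℕ}

/-! ### Accuracy of the mode estimates -/

/-- The `k`-NN setup with all comparison errors below prescribed thresholds, as needed for the mode
estimator to be accurate up to `w` under a margin `η`. -/
theorem exists_knnSetup_accurate (D : ℕ) (θ : Params) : ∃ c : ℝ, 0 < c ∧ c ≤ 1 ∧
    ∀ {K : ℕ} {B : Environment D K} {i : Fin K} {S : Multiset (ℝ × Ctx D)} {m : ℕ}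
      {l ω η w : ℝ}, Regular B θ → 1 ≤ S.card → kSetting θ.α D S.card ^ 2 ≤ m →
      GoodSample B i S (kSetting θ.α D S.card) l → 0 ≤ l → l ≤ ω →
      (S.card : ℝ) ^ (-densityExp θ D) ≤ ω → 0 < w → w ≤ 1 → ω ≤ c * w ^ 2 → ω ≤ c * η →
      ∃ R R₁, KnnSetup B θ i S (kSetting θ.α D S.card) m l R R₁ ∧
        compError θ D m l R R < θ.cLow * θ.rM ^ 2 ∧ compError θ D m l R R ≤ η ∧
        compError θ D m l R R ≤ θ.cLow * w ^ 2 := by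
  obtain ⟨a, ω₀, c₃, ha, hω₀, hω₀1, hc₃, hsetup⟩ := exists_knnSetup_const D θ
  have hcL := θ.cLow_pos
  have hrM := θ.rM_pos
  set M := c₃ * (1 + c₃) with hM
  have hM1 : 1 ≤ M := by nlinarith
  have hM0 : 0 < M := by linarith
  set c := min (min ω₀ (1 / M)) (min (θ.cLow / M) (θ.cLow * θ.rM ^ 2 / 2 / M)) with hc
  have hc1 : c ≤ ω₀ := (min_le_left _ _).trans (min_le_left _ _)
  have hc2 : c ≤ 1 / M := (min_le_left _ _).trans (min_le_right _ _)
  have hc3 : c ≤ θ.cLow / M := (min_le_right _ _).trans (min_le_left _ _)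
  have hc4 : c ≤ θ.cLow * θ.rM ^ 2 / 2 / M := (min_le_right _ _).trans (min_le_right _ _)
  rw [le_div_iff₀ hM0] at hc2 hc3 hc4
  have hc0 : 0 < c := by
    refine lt_min (lt_min hω₀ ?_) (lt_min ?_ ?_) <;> positivity
  refine ⟨c, hc0, hc1.trans hω₀1, ?_⟩
  intro K B i S m l ω η w hreg hN hm hS hl hlω hNω hw hw1 hcw hcη
  have hw2 : w ^ 2 ≤ 1 := pow_le_one₀ hw.le hw1
  have hωω : ω ≤ ω₀ := hcw.trans ((mul_le_of_le_one_right hc0.le hw2).trans hc1)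
  obtain ⟨h1, h2, h3⟩ := hsetup hreg hN hm hS hl hlω le_rfl (by simpa using hNω) hωω
  have hR0 := h1.R_pos
  have hm0 : (0 : ℝ) ≤ 2 / m := by positivity
  have herr := h3 _ hR0.le
  set R := 2 * a * 1 * (S.card : ℝ) ^ (-(1 / (2 * θ.α + D + 1))) with hR
  have hE : compError θ D m l R R ≤ M * ω := by
    refine herr.trans ?_
    rw [hM, mul_assoc]
    have : R ≤ c₃ * ω := by linarith
    gcongr
    linarith
  have hMw : M * ω ≤ M * (c * w ^ 2) := by gcongr
  have hMη : M * ω ≤ M * (c * η) := by gcongr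
  have hω0 : 0 ≤ ω := hl.trans hlω
  have hη0 : 0 ≤ η := by
    by_contra! hneg
    nlinarith
  refine ⟨_, _, h1, ?_, ?_, ?_⟩
  · have e1 : c * M * w ^ 2 ≤ θ.cLow * θ.rM ^ 2 / 2 * 1 := by gcongr
    have e2 : 0 < θ.cLow * θ.rM ^ 2 := by positivity
    linarith
  · have e1 : c * M * η ≤ 1 * η := by gcongr
    linarith
  · have e1 : c * M * w ^ 2 ≤ θ.cLow * w ^ 2 := by gcongr
    linarith

theorem le_mul_two_mul_div {n K : ℕ} (hK : 0 < K) (h : 1 ≤ n / K) :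
    (n : ℝ) ≤ K * (2 * ((n / K : ℕ) : ℝ)) := by
  have h3 : n ≤ K * (2 * (n / K)) := by
    have := Nat.lt_mul_div_succ n hK
    nlinarith
  exact_mod_cast h3

/-- Up to a factor `2`, the number `n / K` of pulls of an arm inherits lower bounds on the number of
rounds per arm. -/
theorem div_bounds {n K : ℕ} (hK : 0 < K) {z : ℝ} (hz : 1 ≤ z) (h : K * z ≤ n) :
    1 ≤ n / K ∧ z ≤ 2 * ((n / K : ℕ) : ℝ) := by
  have hK0 : (0 : ℝ) < K := by exact_mod_cast hK
  have h1 : K ≤ n := by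
    have : (K : ℝ) ≤ n := by nlinarith
    exact_mod_cast this
  have h2 : 1 ≤ n / K := (Nat.one_le_div_iff hK).2 h1
  exact ⟨h2, le_of_mul_le_mul_left (h.trans (le_mul_two_mul_div hK h2)) hK0⟩

/-- Uniform sampling with the conditional mode estimator is `Δ`-optimal in all contexts. -/
theorem exists_deltaOptimal_const (D : ℕ) (θ : Params) {η : ℝ} (hη : 0 < η) :
    ∃ (C : ℝ) (a : ℕ), 0 < C ∧ ∀ (K : ℕ) (B : Environment D K), Regular B θ →
      B.𝒳 ⊆ B.salientRegion 1 η → ∀ (δ Δ : ℝ), 0 < δ → δ < 1 → 0 < Δ →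
      ∀ m : ℕ → ℕ, (∀ N, kSetting θ.α D N ^ 2 ≤ m N) → ∀ n : ℕ,
        C * K * ((1 + Real.log (K / δ)) * (1 + |Real.log Δ|)) ^ a * Δ ^ (-rateExp θ.α D) ≤ n →
      ∀ (Ω : Type*) [MeasurableSpace Ω] (P : Measure Ω) [IsProbabilityMeasure P]
        (X : ℕ → Ω → Ctx D) (Y : Fin K → ℕ → Ω → ℝ) (I : ℕ → Ω → Fin K),
        IsUniformSampling P B n X Y I →
      ∀ (est : Fin K → Ω → Ctx D → ℝ) (πhat : Ω → Ctx D → Fin K),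
        (∀ i ω, ∀ x ∈ B.𝒳, IsModeEstimate (armSample X Y I i n ω)
          (kSetting θ.α D (pulls I i n ω)) (m (pulls I i n ω)) x (est i ω x)) →
        IsGreedyPolicy B.𝒳 est πhat →
        P {ω | ¬ ∀ x ∈ B.𝒳, B.IsDeltaOptimal 1 Δ (πhat ω x) x} < ENNReal.ofReal δ := by
  obtain ⟨cg, hcg, hgood⟩ := exists_good_event D θ
  obtain ⟨c, hc, hc1, hacc⟩ := exists_knnSetup_accurate D θ
  have hcg0 : 0 < cg := by linarith
  obtain ⟨C, hC, hrate⟩ := rateError_le_of_size θ D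
    (show 0 < c * min η (1 / 4) / cg by positivity)
  refine ⟨C, ⌈rateExp θ.α D⌉₊, by linarith, ?_⟩
  intro K B hreg hsal δ Δ hδ hδ1 hΔ m hm n hn Ω _ P _ X Y I hsamp est πhat hest hgreedy
  -- Modes lie in `[0, 1]`, so every arm is `Δ`-optimal if `Δ ≥ 1`.
  rcases le_or_gt 1 Δ with hΔ1 | hΔ1
  · convert ENNReal.ofReal_pos.2 hδ
    convert measure_empty (μ := P)
    refine eq_empty_of_forall_notMem fun ω hω => hω fun x _ j => ?_
    have h1 := (value_mem_Icc B 1 j x).2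
    have h2 := (value_mem_Icc B 1 (πhat ω x) x).1
    linarith
  -- There is an arm, since one is pulled in round `0`.
  obtain ⟨ω⟩ : Nonempty Ω := nonempty_of_isProbabilityMeasure P
  have hK : 0 < K := (I 0 ω).pos
  clear ω
  have hK1 : (1 : ℝ) ≤ K := by exact_mod_cast hK
  have hKδ : 0 < Real.log (K / δ) := Real.log_pos (by rw [lt_div_iff₀ hδ]; linarith)
  set ℓ := 1 + Real.log (K / δ) with hℓ
  have hℓ1 : 1 ≤ ℓ := by linarith
  set z := C * (ℓ * (1 + |Real.log Δ|)) ^ ⌈rateExp θ.α D⌉₊ * Δ ^ (-rateExp θ.α D) with hz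
  have hq0 : 0 < rateExp θ.α D := by
    rw [rateExp_eq]
    exact div_pos two_pos (densityExp_pos θ D)
  have hz1 : 1 ≤ z := by
    have e1 : 1 ≤ Δ ^ (-rateExp θ.α D) :=
      Real.one_le_rpow_of_pos_of_le_one_of_nonpos hΔ hΔ1.le (by linarith)
    have e2 : 1 ≤ ℓ * (1 + |Real.log Δ|) :=
      one_le_mul_of_one_le_of_one_le hℓ1 (by linarith [abs_nonneg (Real.log Δ)])
    exact one_le_mul_of_one_le_of_one_le (one_le_mul_of_one_le_of_one_le hC
      (one_le_pow₀ e2)) e1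
  obtain ⟨hNb, hzN⟩ := div_bounds hK hz1 (n := n) (by rw [hz]; linarith)
  have he := hrate hℓ1 hΔ hΔ1 hzN
  set e := rateError θ D ℓ (n / K) with he'
  have hΔ2 : Δ ^ 2 ≤ 1 := pow_le_one₀ hΔ.le hΔ1.le
  have hmin : 0 < min η (1 / 4) := by positivity
  have he2 : cg * e ≤ c * min η (1 / 4) * Δ ^ 2 := by
    have := mul_le_mul_of_nonneg_left he hcg0.le
    refine this.trans (le_of_eq ?_)
    field_simp
  have he3 : cg * e ≤ c * η := he2.trans <| by
    calc c * min η (1 / 4) * Δ ^ 2 ≤ c * η * 1 := by gcongr; exact min_le_left _ _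
      _ = _ := mul_one _
  have he4 : cg * e ≤ c * (Δ / 2) ^ 2 := he2.trans <| by
    calc c * min η (1 / 4) * Δ ^ 2 ≤ c * (1 / 4) * Δ ^ 2 := by gcongr; exact min_le_right _ _
      _ = _ := by ring
  have he0 : 0 ≤ e := rateError_nonneg θ D (by linarith) _
  refine (measure_mono fun ω hω => ?_).trans_lt (hgood hreg hsamp hNb hδ hδ1
    (by nlinarith : cg * e ≤ 1))
  refine fun hall => hω fun x hx j => ?_
  have key : ∀ i, |est i ω x - B.value 1 i x| ≤ Δ / 2 := by
    intro i
    have hcard := card_armSample X Y I i n ω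
    have hp := (pulls_bounds (fun t ht => hsamp.least_pulled t ht ω) i).1
    have h1 := hest i ω x hx
    have h2 := hall i
    rw [← hcard] at hp h1 h2
    obtain ⟨R, R₁, hset, hE1, hE2, hE3⟩ := hacc hreg (hNb.trans hp) (hm _) h2 (by positivity)
      le_rfl (by
        have e1 : ((armSample X Y I i n ω).card : ℝ) ^ (-densityExp θ D) ≤
            ((n / K : ℕ) : ℝ) ^ (-densityExp θ D) :=
          Real.rpow_le_rpow_of_nonpos (by exact_mod_cast hNb) (by exact_mod_cast hp)
            (by linarith [densityExp_pos θ D])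
        have e2 := rpow_le_rateError θ D hℓ1 (n / K)
        refine e1.trans (e2.trans ?_)
        exact le_mul_of_one_le_left he0 hcg) (half_pos hΔ) (by linarith) he4 he3
    exact hset.abs_sub_value_le hη.le (hsal hx) hE1 hE2 (half_pos hΔ).le hE3 h1
  have h1 := abs_le.1 (key j)
  have h2 := abs_le.1 (key (πhat ω x))
  have h3 := hgreedy ω x hx j
  linarith [h1.1, h2.2]

end ModalBandit

namespace ModalBandit

variable {D K : ℕ}

/-! ### Asymptotics of the rates -/

theorem tendsto_rpow_neg_mul_log_pow {s : ℝ} (hs : 0 < s) (ℓ : ℝ) {j : ℕ} (hj : j ≠ 0) :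
    Tendsto (fun N : ℕ => (N : ℝ) ^ (-s) * (ℓ + Real.log N) ^ j) atTop (𝓝 0) := by
  have hj0 : (0 : ℝ) < j := by positivity
  have h1 : (fun x : ℝ => ℓ + Real.log x) =o[atTop] fun x => x ^ (s / j) :=
    (Asymptotics.isLittleO_const_left.2 (Or.inr
      (tendsto_norm_atTop_atTop.comp (tendsto_rpow_atTop (by positivity))))).add
      (isLittleO_log_rpow_atTop (by positivity))
  have h2 := (h1.pow (Nat.pos_of_ne_zero hj)).tendsto_div_nhds_zero
  refine (h2.comp tendsto_natCast_atTop_atTop).congr fun N => ?_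
  simp only [Function.comp_apply]
  rw [← Real.rpow_natCast (_ ^ (s / (j : ℝ))), ← Real.rpow_mul (Nat.cast_nonneg N),
    div_mul_cancel₀ _ hj0.ne', Real.rpow_neg (Nat.cast_nonneg N), div_eq_mul_inv, mul_comm]

theorem tendsto_rateError (θ : Params) (D : ℕ) (ℓ : ℝ) :
    Tendsto (rateError θ D ℓ) atTop (𝓝 0) := by
  refine (tendsto_rpow_neg_mul_log_pow (densityExp_pos θ D) ℓ one_ne_zero).congr fun N => ?_
  rw [rateError, pow_one]

theorem exists_one_div_le_log {ε : ℕ → ℝ} (hε : ∀ N, 0 < ε N)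
    (h : (fun N : ℕ => 1 / Real.log N) =O[atTop] ε) :
    ∃ C : ℝ, 0 < C ∧ ∀ᶠ N : ℕ in atTop, 1 / ε N ≤ C * Real.log N := by
  obtain ⟨C, hC, hb⟩ := h.exists_pos
  refine ⟨C, hC, ?_⟩
  filter_upwards [hb.bound, eventually_ge_atTop 2] with N hN hN2
  have hlog : 0 < Real.log N := Real.log_pos (by exact_mod_cast hN2)
  rw [Real.norm_of_nonneg (by positivity), Real.norm_of_nonneg (hε N).le,
    div_le_iff₀ hlog] at hN
  rw [div_le_iff₀ (hε N)]
  linarith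

/-- The comparison error is negligible with respect to the slack. -/
theorem tendsto_rateError_div (θ : Params) (D : ℕ) {ℓ : ℝ} (hℓ : 1 ≤ ℓ) {ε : ℕ → ℝ}
    (hε : ∀ N, 0 < ε N) (h : (fun N : ℕ => 1 / Real.log N) =O[atTop] ε) :
    Tendsto (fun N => rateError θ D ℓ N / ε N) atTop (𝓝 0) := by
  obtain ⟨C, hC, hb⟩ := exists_one_div_le_log hε h
  have h1 := (tendsto_rpow_neg_mul_log_pow (densityExp_pos θ D) ℓ two_ne_zero).const_mul C
  rw [mul_zero] at h1
  refine squeeze_zero' (.of_forall fun N => div_nonneg (rateError_nonneg θ D (by linarith) N)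
    (hε N).le) ?_ h1
  filter_upwards [hb] with N hN
  have hlog := Real.log_natCast_nonneg N
  have hr := rateError_nonneg θ D (by linarith : 0 ≤ ℓ) N
  calc rateError θ D ℓ N / ε N = rateError θ D ℓ N * (1 / ε N) := by ring
    _ ≤ rateError θ D ℓ N * (C * (ℓ + Real.log N)) := by
        gcongr
        refine hN.trans ?_
        gcongr
        linarith
    _ = _ := by rw [rateError]; ring

/-- The bias at the scale of the comparison error is negligible with respect to the square of the
slack. -/
theorem tendsto_rateError_rpow_div (θ : Params) (D : ℕ) {ℓ : ℝ} (hℓ : 1 ≤ ℓ) {ε : ℕ → ℝ}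
    (hε : ∀ N, 0 < ε N) (h : (fun N : ℕ => 1 / Real.log N) =O[atTop] ε) :
    Tendsto (fun N => rateError θ D ℓ N ^ θ.α / ε N ^ 2) atTop (𝓝 0) := by
  obtain ⟨C, hC, hb⟩ := exists_one_div_le_log hε h
  have h1 := (tendsto_rpow_neg_mul_log_pow (mul_pos (densityExp_pos θ D) θ.α_pos) ℓ
    three_ne_zero).const_mul (C ^ 2)
  rw [mul_zero] at h1
  refine squeeze_zero' (.of_forall fun N => div_nonneg
    (Real.rpow_nonneg (rateError_nonneg θ D (by linarith) N) _) (sq_nonneg _)) ?_ h1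
  filter_upwards [hb] with N hN
  have hlog := Real.log_natCast_nonneg N
  have hG : 1 ≤ ℓ + Real.log N := by linarith
  have hN0 : (0 : ℝ) ≤ N := Nat.cast_nonneg N
  have hp := Real.rpow_nonneg hN0 (-(densityExp θ D * θ.α))
  have hε0 := hε N
  have e1 : rateError θ D ℓ N ^ θ.α ≤
      (N : ℝ) ^ (-(densityExp θ D * θ.α)) * (ℓ + Real.log N) := by
    rw [rateError, Real.mul_rpow (Real.rpow_nonneg hN0 _) (by linarith), ← Real.rpow_mul hN0,
      neg_mul]
    gcongr
    exact rpow_le_self_of_one_le hG θ.α_le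
  have e2 : 1 / ε N ≤ C * (ℓ + Real.log N) := by
    refine hN.trans ?_
    gcongr
    linarith
  calc rateError θ D ℓ N ^ θ.α / ε N ^ 2 = rateError θ D ℓ N ^ θ.α * (1 / ε N) ^ 2 := by
        field_simp
    _ ≤ ((N : ℝ) ^ (-(densityExp θ D * θ.α)) * (ℓ + Real.log N)) *
        (C * (ℓ + Real.log N)) ^ 2 := by
        have : 0 ≤ 1 / ε N := by positivity
        gcongr
    _ = _ := by ring

theorem eventually_const_mul_lt {u : ℕ → ℝ} (hu : Tendsto u atTop (𝓝 0)) (c : ℝ) {d : ℝ}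
    (hd : 0 < d) : ∀ᶠ N in atTop, c * u N < d := by
  have h := hu.const_mul c
  rw [mul_zero] at h
  exact h.eventually (gt_mem_nhds hd)

theorem eventually_le_rpow {s : ℝ} (hs : 0 < s) (c : ℝ) :
    ∀ᶠ N : ℕ in atTop, c ≤ (N : ℝ) ^ s :=
  ((tendsto_rpow_atTop hs).comp tendsto_natCast_atTop_atTop).eventually_ge_atTop c

/-- The grid is eventually finer than any fixed multiple of the `k`-NN scale. For `α > 1 / 4` this
is a consequence of `m ≥ k ^ 2`. -/
theorem eventually_mesh_le (θ : Params) (D : ℕ) {b : ℝ} (hb : 0 < b) (hD : 1 ≤ D) :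
    ∀ᶠ N : ℕ in atTop, ∀ m : ℕ, kSetting θ.α D N ^ 2 ≤ m → (θ.α ≤ 1 / 4 → N ≤ m) →
      1 / (m : ℝ) ≤ b * (N : ℝ) ^ (-(1 / (2 * θ.α + D + 1))) := by
  have hα := θ.α_pos
  have hden := denom_pos θ D
  have hD0 : (1 : ℝ) ≤ D := by exact_mod_cast hD
  have key : ∀ s : ℝ, 1 / (2 * θ.α + D + 1) < s → ∀ᶠ N : ℕ in atTop, ∀ m : ℕ,
      (N : ℝ) ^ s ≤ m → 1 / (m : ℝ) ≤ b * (N : ℝ) ^ (-(1 / (2 * θ.α + D + 1))) := by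
    intro s hs
    filter_upwards [eventually_le_rpow (sub_pos.2 hs) (1 / b), eventually_ge_atTop 1]
      with N hN hN1 m hm
    have hN0 : (0 : ℝ) < N := by exact_mod_cast hN1
    have hp := Real.rpow_pos_of_pos hN0 s
    refine (one_div_le_one_div_of_le hp hm).trans ?_
    rw [div_le_iff₀ hp, mul_assoc, ← Real.rpow_add hN0]
    rw [div_le_iff₀ hb] at hN
    convert hN using 1
    rw [mul_comm]
    congr 2
    ring
  rcases le_or_gt θ.α (1 / 4) with h4 | h4
  · filter_upwards [key 1 (by rw [div_lt_one hden]; linarith)] with N hN m _ hm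
    exact hN m (by rw [Real.rpow_one]; exact_mod_cast hm h4)
  · filter_upwards [key (2 * densityExp θ D * 2) (by
      rw [densityExp, mul_div_assoc', div_mul_eq_mul_div]
      exact div_lt_div_of_pos_right (by linarith) hden)] with N hN m hm _
    refine hN m ?_
    have e1 := rpow_le_kSetting θ D N
    have e2 : ((kSetting θ.α D N : ℕ) : ℝ) ^ 2 ≤ m := by exact_mod_cast hm
    refine le_trans ?_ e2
    rw [Real.rpow_mul (Nat.cast_nonneg N)]
    have e3 := Real.rpow_nonneg (Nat.cast_nonneg N) (2 * densityExp θ D) (x := (N : ℝ))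
    calc ((N : ℝ) ^ (2 * densityExp θ D)) ^ (2 : ℝ) =
          ((N : ℝ) ^ (2 * densityExp θ D)) ^ 2 := Real.rpow_two _
      _ ≤ _ := by gcongr

/-- The sample size required for exact recovery makes the error at most a prescribed multiple of
`Δ ^ 2`, once the samples are larger than a threshold that does not depend on `Δ`. With
`y = N ^ (1 / q)` and `s = y Δ` the size condition bounds `u = log (3 / Δ)` by a multiple of `s`.
Hence `s` is large if `u` is, and otherwise `Δ` is bounded below and `s` is large because `N`
is. -/
theorem exists_rateError_le_of_gap_size (θ : Params) (D : ℕ) {c L ℓ : ℝ} (hc : 0 < c)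
    (hL : 0 < L) (hℓ : 0 ≤ ℓ) : ∃ N₁ : ℕ, ∀ {N : ℕ} {Δ : ℝ}, N₁ ≤ N → 0 < Δ → Δ < 1 →
      L ^ rateExp θ.α D * (Δ / 3) ^ (-rateExp θ.α D) *
        Real.log ((Δ / 3) ^ (-rateExp θ.α D)) ^ rateExp θ.α D < 2 * N →
      rateError θ D ℓ N ≤ c * Δ ^ 2 := by
  set q := rateExp θ.α D with hq
  have hγ := densityExp_pos θ D
  have hq2 : q = 2 / densityExp θ D := rateExp_eq θ D
  have hq0 : 0 < q := by rw [hq2]; positivity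
  have hq1 : 1 ≤ q := by
    rw [hq2, le_div_iff₀ hγ]
    linarith [densityExp_le_one θ D]
  set κ := 3 * L * q / 2 with hκ
  have hκ0 : 0 < κ := by positivity
  set S₀ := max 1 ((ℓ + q * (1 + 1 / κ)) / c) with hS₀
  have hS1 : 1 ≤ S₀ := le_max_left _ _
  have hS2 : (ℓ + q * (1 + 1 / κ)) / c ≤ S₀ := le_max_right _ _
  obtain ⟨N₁, hN₁⟩ := eventually_atTop.1
    (eventually_le_rpow (show 0 < 1 / q by positivity) (S₀ * Real.exp (S₀ / κ)))
  refine ⟨N₁, ?_⟩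
  intro N Δ hN hΔ hΔ1 h
  set u := Real.log (3 / Δ) with hu
  have hu0 : 0 < u := Real.log_pos (by rw [lt_div_iff₀ hΔ]; linarith)
  have hlog : Real.log ((Δ / 3) ^ (-q)) = q * u := by
    rw [Real.log_rpow (by positivity), hu, ← inv_div Δ 3, Real.log_inv]
    ring
  rw [hlog, Real.rpow_neg (by positivity), ← Real.inv_rpow (by positivity), inv_div,
    ← Real.mul_rpow hL.le (by positivity), ← Real.mul_rpow (by positivity) (by positivity)] at h
  have hN0 : (0 : ℝ) < N := by
    have : 0 < (L * (3 / Δ) * (q * u)) ^ q := by positivity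
    linarith
  have hy := hN₁ N hN
  set y := (N : ℝ) ^ (1 / q) with hydef
  have hy0 : 0 < y := Real.rpow_pos_of_pos hN0 _
  have h2 : L * (3 / Δ) * (q * u) ≤ 2 * y := by
    have e1 : L * (3 / Δ) * (q * u) ≤ (2 * N) ^ (1 / q) := by
      rw [one_div, Real.le_rpow_inv_iff_of_pos (by positivity) (by positivity) hq0]
      exact h.le
    refine e1.trans ?_
    rw [Real.mul_rpow two_pos.le hN0.le]
    gcongr
    exact rpow_le_self_of_one_le one_le_two (by rw [div_le_one hq0]; exact hq1)
  set s := y * Δ with hs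
  have hs0 : 0 < s := by positivity
  have h3 : κ * u ≤ s := by
    have e1 : L * (3 / Δ) * (q * u) = 2 * (κ * u) / Δ := by rw [hκ]; field_simp
    rw [e1, div_le_iff₀ hΔ] at h2
    linarith
  have hus : u ≤ 1 / κ * s := by
    rw [one_div, inv_mul_eq_div, le_div_iff₀ hκ0]
    linarith
  have hlogy : Real.log y ≤ s + u := by
    have e1 : Real.log s = Real.log y + Real.log Δ := Real.log_mul hy0.ne' hΔ.ne'
    have e2 := Real.log_le_sub_one_of_pos hs0
    have e3 : u = Real.log 3 - Real.log Δ := Real.log_div three_ne_zero hΔ.ne'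
    have e4 : 0 < Real.log 3 := Real.log_pos (by norm_num)
    linarith
  have hsS : S₀ ≤ s := by
    rcases le_or_gt (S₀ / κ) u with h4 | h4
    · rw [div_le_iff₀ hκ0] at h4
      linarith
    · have e1 : 3 / Δ ≤ Real.exp (S₀ / κ) := by
        rw [← Real.exp_log (show 0 < 3 / Δ by positivity)]
        exact Real.exp_le_exp.2 h4.le
      rw [div_le_iff₀ hΔ] at e1
      have e2 : 1 ≤ Real.exp (S₀ / κ) * Δ := by linarith
      calc S₀ = S₀ * 1 := (mul_one _).symm
        _ ≤ S₀ * (Real.exp (S₀ / κ) * Δ) := by gcongr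
        _ = S₀ * Real.exp (S₀ / κ) * Δ := by ring
        _ ≤ s := by rw [hs]; gcongr
  have hs1 : 1 ≤ s := hS1.trans hsS
  have hlogN : Real.log N = q * Real.log y := by
    rw [hydef, Real.log_rpow hN0, one_div, mul_inv_cancel_left₀ hq0.ne']
  have h4 : ℓ + Real.log N ≤ (ℓ + q * (1 + 1 / κ)) * s := by
    have e1 : q * Real.log y ≤ q * (s + 1 / κ * s) := by
      gcongr
      linarith
    have e2 : ℓ ≤ ℓ * s := le_mul_of_one_le_right hℓ hs1
    rw [hlogN]
    linarith
  have h5 : (ℓ + q * (1 + 1 / κ)) * s ≤ c * s ^ 2 := by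
    have e1 := hS2.trans hsS
    rw [div_le_iff₀ hc] at e1
    have := mul_le_mul_of_nonneg_right e1 hs0.le
    linarith
  have hyN : (N : ℝ) ^ (-densityExp θ D) = (y ^ 2)⁻¹ := by
    rw [hydef, ← Real.rpow_natCast, ← Real.rpow_mul hN0.le, Real.rpow_neg hN0.le, hq2]
    congr 2
    push_cast
    field_simp
  rw [rateError, hyN, inv_mul_le_iff₀ (by positivity)]
  calc ℓ + Real.log N ≤ c * s ^ 2 := h4.trans h5
    _ = y ^ 2 * (c * Δ ^ 2) := by rw [hs]; ring

end ModalBandit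

namespace ModalBandit

variable {D K : ℕ}

/-! ### Exact recovery -/

theorem betaWidth_nonneg {δ : ℝ} (hδ : 0 < δ) (hδ1 : δ < 1) (n k : ℕ) : 0 ≤ betaWidth δ n k := by
  have : 0 ≤ Real.log (1 / δ) := Real.log_nonneg (by rw [le_div_iff₀ hδ]; linarith)
  rw [betaWidth]
  positivity

theorem betaWidth_le (θ : Params) (D : ℕ) {δ : ℝ} (hδ : 0 < δ) (hδ1 : δ < 1) {N : ℕ}
    (hN : 1 ≤ N) : betaWidth δ N (kSetting θ.α D N) ≤
      100 * Real.log (1 / δ) * rateError θ D (1 + Real.log (1 / δ)) N := by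
  have hL : 0 ≤ Real.log (1 / δ) := Real.log_nonneg (by rw [le_div_iff₀ hδ]; linarith)
  have hN0 : (0 : ℝ) < N := by exact_mod_cast hN
  have hlog := Real.log_natCast_nonneg N
  have hp : 0 < (N : ℝ) ^ densityExp θ D := Real.rpow_pos_of_pos hN0 _
  have h1 : (N : ℝ) ^ densityExp θ D ≤ Real.sqrt (kSetting θ.α D N) := by
    refine Real.le_sqrt_of_sq_le ?_
    rw [← Real.rpow_mul_natCast hN0.le]
    push_cast
    rw [mul_comm]
    exact rpow_le_kSetting θ D N
  have h2 : Real.sqrt (Real.log N) ≤ 1 + Real.log (1 / δ) + Real.log N := by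
    refine Real.sqrt_le_iff.2 ⟨by linarith, ?_⟩
    nlinarith
  rw [betaWidth, rateError, Real.rpow_neg hN0.le, mul_div_assoc, inv_mul_eq_div]
  gcongr

set_option maxHeartbeats 1000000 in
/-- For large samples the `p`-mode setup holds, with errors of the order of `rateError`. The region
of a grid point is followed at the scale `R` of order `N ^ (-1 / (2 α + D + 1)) / ε`, on which the
`k`-NN estimate resolves densities of the order of the slack `ε`. The distances in the level graph
may increase by a factor `1 + τ` with `τ` of order `ε`, and paths may lose density `e` of order
`ε ^ 2`. -/
theorem exists_pModeSetup (D : ℕ) (hD : 1 ≤ D) (θ : Params) {δ cl : ℝ} (hδ : 0 < δ) (hδ1 : δ < 1)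
    (hcl : 0 < cl) {ε : ℕ → ℝ} (hε : ∀ N, 0 < ε N) (hε0 : Tendsto ε atTop (𝓝 0))
    (hεlog : (fun N : ℕ => 1 / Real.log N) =O[atTop] ε) :
    ∃ (N₂ : ℕ) (C : ℝ), 0 < C ∧ ∀ {K : ℕ} {B : Environment D K} {i : Fin K}
      {S : Multiset (ℝ × Ctx D)} {m : ℕ} {l : ℝ}, Regular B θ → N₂ ≤ S.card →
      kSetting θ.α D S.card ^ 2 ≤ m → (θ.α ≤ 1 / 4 → S.card ≤ m) →
      GoodSample B i S (kSetting θ.α D S.card) l → 0 ≤ l →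
      l ≤ cl * rateError θ D (1 + Real.log (1 / δ)) S.card →
      ∃ R R₁ ξ rm ρm Q e τ, PModeSetup B θ i S (kSetting θ.α D S.card) m l R R₁
          (betaWidth δ S.card (kSetting θ.α D S.card)) (ε S.card) ξ rm ρm Q e τ ∧
        compError θ D m l R R ≤ C * rateError θ D (1 + Real.log (1 / δ)) S.card := by
  obtain ⟨a, ω₀, c₃, ha, hω₀, hω₀1, hc₃, hsetup⟩ := exists_knnSetup_const D θ
  obtain ⟨Cε, hCε, hCεb⟩ := exists_one_div_le_log hε hεlog
  have hv := unitBallVol_pos D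
  have hκ := ballVol_pos D
  have hcL := θ.cLow_pos
  have hrM := θ.rM_pos
  have hL : 0 < Real.log (1 / δ) := Real.log_pos (by rw [lt_div_iff₀ hδ]; linarith)
  set L := Real.log (1 / δ) with hLdef
  set ℓ := 1 + L with hℓ
  have hℓ1 : 1 ≤ ℓ := by linarith
  set v := unitBallVol D with hvdef
  set κ := ballVol D with hκdef
  -- The constant `Cω` absorbs both the error `l` and the factor `E = 2 / (v ε) = O(log N)` by which
  -- the scale `R` exceeds the scale of the `k`-NN radii near modes.
  set Cω := cl + 2 / v * Cε with hCω
  have hCω0 : 0 < Cω := by positivity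
  set A := v * a ^ (D + 1) with hA
  have hA0 : 0 < A := by positivity
  set rm := min θ.rM 1 with hrm
  have hrm0 : 0 < rm := by positivity
  -- With this `b` balls of radius `b N ^ (-1 / (2 α + D + 1))` hold fewer than `k / 2` expected
  -- points, so that all `k`-NN radii exceed it and neighbouring grid points can be adjacent.
  set b := 1 / (2 * |θ.fMax| * κ + 2) with hb
  have hb0 : 0 < b := by positivity
  have hb1 : b ≤ 1 := by
    rw [hb, div_le_one (by positivity)]
    have : 0 ≤ 2 * |θ.fMax| * κ := by positivity
    linarith
  have hbF : 2 * |θ.fMax| * κ * b < 1 := by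
    rw [hb, mul_one_div, div_lt_one (by positivity)]
    linarith
  -- The losses are `τ = cτ ε`, small enough for `τ` not to use up the slack, and `e = ce ε ^ 2`,
  -- chosen such that its contribution to the path condition is `τ / 4`.
  set cτ := v * b ^ (D + 1) / (4 * (D + 1)) with hcτ
  have hcτ0 : 0 < cτ := by positivity
  set ce := cτ * v / (16 * κ) with hce
  have hce0 : 0 < ce := by positivity
  have hd : 0 < θ.cLow * (rm / 2) ^ 2 := by positivity
  have hrate := tendsto_rateError θ D ℓ
  have hall := ((((eventually_const_mul_lt hrate Cω hω₀).and
    (eventually_const_mul_lt hε0 v two_pos)).and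
    ((eventually_const_mul_lt hrate (100 * L) (show (0 : ℝ) < 1 / 4 by norm_num)).and
    (eventually_const_mul_lt hε0 A (show (0 : ℝ) < 1 / 4 by norm_num)))).and
    (((eventually_const_mul_lt hrate (c₃ * Cω) (half_pos hrm0)).and
    (eventually_const_mul_lt hrate (c₃ * (Cω + 200 * L)) (half_pos hd))).and
    ((eventually_const_mul_lt hε0 (c₃ * (2 * A)) (half_pos hd)).and
    (eventually_mesh_le θ D hb0 hD)))).and
    (((eventually_const_mul_lt (tendsto_rateError_div θ D hℓ1 hε hεlog) (32 * Cω)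
      (show 0 < cτ / 4 by positivity)).and
    (eventually_const_mul_lt (tendsto_rateError_rpow_div θ D hℓ1 hε hεlog)
      (12 * |θ.Cα| * (c₃ * Cω) ^ θ.α * κ / v) (show 0 < cτ / 4 by positivity))).and
    (((eventually_const_mul_lt hε0 cτ one_pos).and hCεb).and (eventually_ge_atTop 1)))
  obtain ⟨N₂, hN₂⟩ := eventually_atTop.1 hall
  refine ⟨N₂, c₃ * (1 + c₃) * Cω, by positivity, ?_⟩
  intro K B i S m l hreg hN hm hmN hS hl hlr
  obtain ⟨⟨⟨⟨h1, h2⟩, h3, h4⟩, ⟨h5, h6⟩, h7, h8⟩, ⟨h9, h10⟩, ⟨h11, h12⟩, h13⟩ := hN₂ _ hN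
  have h8' := h8 m hm hmN
  have hεN := hε S.card
  set N := S.card with hNdef
  set εN := ε N with hεdef
  set k := kSetting θ.α D N with hk
  set r := rateError θ D ℓ N with hr
  have hr0 : 0 ≤ r := rateError_nonneg θ D (by linarith) N
  have hyr : (N : ℝ) ^ (-densityExp θ D) ≤ r := rpow_le_rateError θ D hℓ1 N
  have hN0 : (0 : ℝ) < N := by exact_mod_cast h13
  have hk0 : (0 : ℝ) < k := by exact_mod_cast kSetting_pos θ D h13
  have hlog := Real.log_natCast_nonneg N
  set E := 2 / (v * εN) with hE
  have hE1 : 1 ≤ E := by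
    rw [hE, le_div_iff₀ (by positivity)]
    linarith
  have hlω : l ≤ Cω * r := by
    refine hlr.trans ?_
    have : cl ≤ Cω := by
      have : 0 < 2 / v * Cε := by positivity
      linarith
    gcongr
  have hEω : E * (N : ℝ) ^ (-densityExp θ D) ≤ Cω * r := by
    have e1 : E ≤ 2 / v * Cε * (ℓ + Real.log N) := by
      calc E = 2 / v * (1 / εN) := by rw [hE]; field_simp
        _ ≤ 2 / v * (Cε * (ℓ + Real.log N)) := by
            gcongr
            refine h12.trans ?_
            gcongr
            linarith
        _ = _ := by ring
    have e2 : 0 ≤ (N : ℝ) ^ (-densityExp θ D) := Real.rpow_nonneg hN0.le _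
    calc E * (N : ℝ) ^ (-densityExp θ D) ≤
        2 / v * Cε * (ℓ + Real.log N) * (N : ℝ) ^ (-densityExp θ D) := by gcongr
      _ = 2 / v * Cε * r := by rw [hr, rateError]; ring
      _ ≤ Cω * r := by gcongr; linarith
  obtain ⟨hset, hRm, herr⟩ := hsetup hreg h13 hm hS hl hlω hE1 hEω h1.le
  have hR0 := hset.R_pos
  have hm0 : (0 : ℝ) ≤ 2 / m := by positivity
  have hR₁ : (N : ℝ) * (a * (N : ℝ) ^ (-(1 / (2 * θ.α + D + 1)))) ^ (D + 1) =
      a ^ (D + 1) * (N : ℝ) ^ (2 * densityExp θ D) := by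
    rw [← mul_rpow_eq θ D h13, mul_pow]
    ring
  have hk1 : (N : ℝ) ^ (2 * densityExp θ D) ≤ k := rpow_le_kSetting θ D N
  have hk2 : (k : ℝ) ≤ 2 * (N : ℝ) ^ (2 * densityExp θ D) := kSetting_le_two_mul θ D h13
  have hz0 : 0 < (N : ℝ) ^ (2 * densityExp θ D) := Real.rpow_pos_of_pos hN0 _
  have hmul := mul_rpow_eq θ D h13
  set z := (N : ℝ) ^ (2 * densityExp θ D) with hz
  set x := (N : ℝ) ^ (-(1 / (2 * θ.α + D + 1))) with hx
  have hx0 : 0 < x := Real.rpow_pos_of_pos hN0 _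
  have hx1 : x ≤ 1 := Real.rpow_le_one_of_one_le_of_nonpos (by exact_mod_cast h13) (by
    have := denom_pos θ D
    have : 0 ≤ 1 / (2 * θ.α + D + 1) := by positivity
    linarith)
  set R := 2 * a * E * x with hR
  have hRω : R ≤ c₃ * (Cω * r) := by linarith
  have hbx : (N : ℝ) * (b * x) ^ (D + 1) = b ^ (D + 1) * z := by
    rw [← hmul, mul_pow]
    ring
  have hβ := betaWidth_le θ D hδ hδ1 h13
  refine ⟨R, a * x, 100 * L * r + A * εN, rm, b * x, κ / (v * εN), ce * εN ^ 2, cτ * εN,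
    ⟨hset, betaWidth_nonneg hδ hδ1 _ _, hεN, ?_, by linarith, by positivity, min_le_left _ _,
      ?_, ?_, h8', by positivity, mul_le_one₀ hb1 hx0.le hx1, ?_, ?_, ?_, by positivity, ?_,
      h11.le, ?_⟩, ?_⟩
  · refine add_le_add hβ ?_
    rw [div_le_iff₀ hk0]
    calc εN * (v * N * (a * x) ^ (D + 1)) = εN * v * (N * (a * x) ^ (D + 1)) := by ring
      _ = A * εN * z := by rw [hR₁, hA]; ring
      _ ≤ A * εN * k := by gcongr
  · linarith
  · refine (herr _ (by positivity)).trans_lt ?_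
    linarith
  · have e1 : θ.fMax ≤ |θ.fMax| := le_abs_self _
    have e2 : b ^ (D + 1) ≤ b := pow_le_of_le_one hb0.le hb1 (by omega)
    calc 2 * (N * (θ.fMax * (κ * (b * x) ^ (D + 1)))) =
          2 * θ.fMax * κ * (N * (b * x) ^ (D + 1)) := by ring
      _ = 2 * θ.fMax * κ * (b ^ (D + 1) * z) := by rw [hbx]
      _ ≤ 2 * |θ.fMax| * κ * (b * z) := by gcongr
      _ = 2 * |θ.fMax| * κ * b * z := by ring
      _ < 1 * z := by gcongr
      _ ≤ k := by linarith
  · have e1 : (1 : ℝ) ≤ a ^ (D + 1) := one_le_pow₀ ha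
    have e2 : E ≤ E ^ (D + 1) := le_self_pow₀ hE1 (by omega)
    have e3 : 2 ≤ v * εN * a ^ (D + 1) * E ^ (D + 1) := by
      calc 2 = v * εN * 1 * E := by rw [hE]; field_simp
        _ ≤ _ := by gcongr
    calc 2 ^ (D + 1) * (k : ℝ) ≤ 2 ^ (D + 1) * (2 * z) := by gcongr
      _ ≤ 2 ^ (D + 1) * (v * εN * a ^ (D + 1) * E ^ (D + 1) * z) := by gcongr
      _ = 2 ^ (D + 1) * (v * εN * a ^ (D + 1) * E ^ (D + 1) * (N * x ^ (D + 1))) := by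
          rw [hmul]
      _ = v * N * εN * R ^ (D + 1) := by rw [hR, mul_pow, mul_pow, mul_pow]; ring
  · rw [div_mul_cancel₀ _ (by positivity)]
  · have hω0 : 0 ≤ c₃ * (Cω * r) := by positivity
    have e1 : (R + 2 / m) ^ θ.α ≤ (c₃ * Cω) ^ θ.α * r ^ θ.α := by
      rw [← Real.mul_rpow (by positivity) hr0]
      refine Real.rpow_le_rpow (by positivity) (by linarith) θ.α_pos.le
    have e2 : R ^ θ.α ≤ (c₃ * Cω) ^ θ.α * r ^ θ.α := by
      rw [← Real.mul_rpow (by positivity) hr0]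
      refine Real.rpow_le_rpow hR0.le (by linarith) θ.α_pos.le
    have hp1 := Real.rpow_nonneg hR0.le θ.α
    have hp2 := Real.rpow_nonneg (add_nonneg hR0.le hm0) θ.α
    have e3 : θ.Cα * (R + 2 / m) ^ θ.α ≤ |θ.Cα| * ((c₃ * Cω) ^ θ.α * r ^ θ.α) :=
      mul_le_mul (le_abs_self _) e1 hp2 (abs_nonneg _)
    have e4 : θ.Cα * R ^ θ.α ≤ |θ.Cα| * ((c₃ * Cω) ^ θ.α * r ^ θ.α) :=
      mul_le_mul (le_abs_self _) e2 hp1 (abs_nonneg _)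
    have e5 : 4 * (8 * l) ≤ cτ / 4 * εN := by
      have : 32 * Cω * r ≤ cτ / 4 * εN := by
        rw [mul_div_assoc', div_lt_iff₀ hεN] at h9
        exact h9.le
      linarith
    have e6 : 4 * (ce * εN ^ 2 * (κ / (v * εN))) = cτ / 4 * εN := by
      rw [hce]
      field_simp
      norm_num
    have e7 : 12 * (|θ.Cα| * ((c₃ * Cω) ^ θ.α * r ^ θ.α)) * (κ / (v * εN)) ≤
        cτ / 4 * εN := by
      have : 12 * (|θ.Cα| * ((c₃ * Cω) ^ θ.α * r ^ θ.α)) * (κ / (v * εN)) =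
          12 * |θ.Cα| * (c₃ * Cω) ^ θ.α * κ / v * (r ^ θ.α / εN ^ 2) * εN := by
        field_simp
      rw [this]
      gcongr
    have e8 : (ce * εN ^ 2 + θ.Cα * (R + 2 / m) ^ θ.α + 2 * (θ.Cα * R ^ θ.α)) *
        (κ / (v * εN)) ≤
        (ce * εN ^ 2 + 3 * (|θ.Cα| * ((c₃ * Cω) ^ θ.α * r ^ θ.α))) * (κ / (v * εN)) := by
      refine mul_le_mul_of_nonneg_right ?_ (by positivity)
      linarith
    have : 0 < cτ * εN := by positivity
    linarith
  · calc (D + 1) * (cτ * εN) * (k : ℝ) ≤ (D + 1) * (cτ * εN) * (2 * z) := by gcongr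
      _ = εN * v * b ^ (D + 1) * z / 2 := by rw [hcτ]; field_simp; norm_num
      _ < εN * v * b ^ (D + 1) * z := half_lt_self (by positivity)
      _ = εN * (v * N * (b * x) ^ (D + 1)) := by rw [mul_assoc v, hbx]; ring
  · refine (herr _ hR0.le).trans ?_
    calc c₃ * (Cω * r + R) ≤ c₃ * (Cω * r + c₃ * (Cω * r)) := by gcongr
      _ = _ := by ring

end ModalBandit

namespace ModalBandit

variable {D K : ℕ}

/-- If every estimate is within a third of the gap of the `p`-mode, the greedy arm is the optimal
one. -/
theorem greedy_eq_of_gap {B : Environment D K} {p : ℕ} {Δ : ℝ} {x : Ctx D} {v : Fin K → ℝ}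
    {a b : Fin K} (hx : x ∈ B.gapRegion p Δ) (hΔ : 0 < Δ)
    (hv : ∀ i, |v i - B.value p i x| ≤ Δ / 3) (ha : ∀ j, v j ≤ v a)
    (hb : ∀ j, B.value p j x ≤ B.value p b x) : a = b := by
  obtain ⟨-, i, hi⟩ := hx
  have hbi : b = i := by
    by_contra hne
    linarith [hi b hne, hb i]
  have hai : a = i := by
    by_contra hne
    have h1 := abs_le.1 (hv a)
    have h2 := abs_le.1 (hv i)
    linarith [hi a hne, ha i, h1.2, h2.1]
  rw [hai, hbi]

/-- Uniform sampling with the conditional `p`-mode estimator recovers the optimal policy. -/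
theorem exists_recovery_threshold (D : ℕ) (hD : 1 ≤ D) (θ : Params) (p : ℕ) (hp : 1 ≤ p)
    (ε : ℕ → ℝ) (hε : ∀ N, 0 < ε N) (hε0 : Tendsto ε atTop (𝓝 0))
    (hεlog : (fun N : ℕ => 1 / Real.log N) =O[atTop] ε) (K : ℕ) (δ : ℝ) (hδ : 0 < δ)
    (hδ1 : δ < 1) : ∃ N₀ : ℕ, ∀ (B : Environment D K), Regular B θ → ∀ (Δ : ℝ), 0 < Δ →
      ∀ m : ℕ → ℕ, (∀ N, kSetting θ.α D N ^ 2 ≤ m N) →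
        (2 ≤ p → θ.α ≤ 1 / 4 → ∀ N, N ≤ m N) → ∀ n : ℕ,
        max (K * (Real.log (1 / δ) + Real.log K) ^ rateExp θ.α D * (Δ / 3) ^ (-rateExp θ.α D)
            * Real.log ((Δ / 3) ^ (-rateExp θ.α D)) ^ rateExp θ.α D)
          ((K * N₀ : ℕ) : ℝ) < n →
      ∀ (Ω : Type*) [MeasurableSpace Ω] (P : Measure Ω) [IsProbabilityMeasure P]
        (X : ℕ → Ω → Ctx D) (Y : Fin K → ℕ → Ω → ℝ) (I : ℕ → Ω → Fin K),
        IsUniformSampling P B n X Y I →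
      ∀ (est : Fin K → Ω → Ctx D → ℝ) (πhat : Ω → Ctx D → Fin K),
        (∀ i ω, ∀ x ∈ B.𝒳, IsPModeEstimate (armSample X Y I i n ω) p
          (kSetting θ.α D (pulls I i n ω)) (m (pulls I i n ω)) (δ / K)
          (ε (pulls I i n ω)) x (est i ω x)) →
        IsGreedyPolicy B.𝒳 est πhat → ∀ π : Ctx D → Fin K, B.IsOptimalPolicy p π →
        P {ω | ¬ ∀ x ∈ B.gapRegion p Δ ∩ B.salientRegion p Δ, πhat ω x = π x}
          < ENNReal.ofReal δ := by
  -- Without a choice of arms there is nothing to recover.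
  rcases le_or_gt K 1 with hK1 | hK2
  · have : Subsingleton (Fin K) := Fin.subsingleton_iff_le_one.2 hK1
    refine ⟨0, ?_⟩
    intro B _ Δ _ m _ _ n _ Ω _ P _ X Y I _ est πhat _ _ π _
    convert ENNReal.ofReal_pos.2 hδ
    convert measure_empty (μ := P)
    exact eq_empty_of_forall_notMem fun ω hω => hω fun x _ => Subsingleton.elim _ _
  have hK0 : 0 < K := by omega
  have hKr : (1 : ℝ) < K := by exact_mod_cast hK2
  have hδK : 0 < δ / K := by positivity
  have hδK1 : δ / K < 1 := by rw [div_lt_one (by positivity)]; linarith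
  have hlogK : Real.log (1 / δ) + Real.log K = Real.log (K / δ) := by
    rw [← Real.log_mul (by positivity) (by positivity)]
    congr 1
    ring
  have hL : 0 < Real.log (K / δ) := Real.log_pos (by rw [lt_div_iff₀ hδ]; linarith)
  obtain ⟨cg, hcg, hgood⟩ := exists_good_event D θ
  obtain ⟨c, hc, hc1, hacc⟩ := exists_knnSetup_accurate D θ
  have hcg0 : 0 < cg := by linarith
  obtain ⟨N₂, C, hC, hpset⟩ := exists_pModeSetup D hD θ hδK hδK1
    (show 0 < 2 * cg by positivity) hε hε0 hεlog
  rw [one_div_div] at hpset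
  have hcL := θ.cLow_pos
  set c' := min (c / (9 * cg)) (min (θ.cLow / (9 * C)) (1 / C)) with hc'
  have hc'0 : 0 < c' := by
    refine lt_min ?_ (lt_min ?_ ?_) <;> positivity
  have hc'1 : c' ≤ c / (9 * cg) := min_le_left _ _
  have hc'2 : c' ≤ θ.cLow / (9 * C) := (min_le_right _ _).trans (min_le_left _ _)
  have hc'3 : c' ≤ 1 / C := (min_le_right _ _).trans (min_le_right _ _)
  rw [le_div_iff₀ (by positivity)] at hc'1 hc'2 hc'3
  set L := Real.log (K / δ) with hLdef
  obtain ⟨N₁, hN₁⟩ := exists_rateError_le_of_gap_size θ D hc'0 hL (by linarith : 0 ≤ 1 + L)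
  refine ⟨max (max N₁ N₂) 1, ?_⟩
  intro B hreg Δ hΔ m hm hmN n hn Ω _ P _ X Y I hsamp est πhat hest hgreedy π hπ
  -- Modes lie in `[0, 1]`, so no context has a gap of more than `1` between two arms.
  rcases le_or_gt 1 Δ with hΔ1 | hΔ1
  · convert ENNReal.ofReal_pos.2 hδ
    convert measure_empty (μ := P)
    refine eq_empty_of_forall_notMem fun ω hω => hω fun x hx => ?_
    obtain ⟨⟨-, i, hi⟩, -⟩ := hx
    have : Nontrivial (Fin K) := Fin.nontrivial_iff_two_le.2 hK2
    obtain ⟨j, hj⟩ := exists_ne i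
    have h1 := (value_mem_Icc B p i x).2
    have h2 := (value_mem_Icc B p j x).1
    linarith [hi j hj]
  rw [max_lt_iff, hlogK] at hn
  obtain ⟨hn1, hn2⟩ := hn
  have hNb : max (max N₁ N₂) 1 ≤ n / K := by
    rw [Nat.le_div_iff_mul_le hK0, mul_comm]
    exact_mod_cast hn2.le
  have hNb1 : 1 ≤ n / K := (le_max_right _ _).trans hNb
  have hNb2 : N₁ ≤ n / K := ((le_max_left _ _).trans (le_max_left _ _)).trans hNb
  have hNb3 : N₂ ≤ n / K := ((le_max_right _ _).trans (le_max_left _ _)).trans hNb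
  have hsize : L ^ rateExp θ.α D * (Δ / 3) ^ (-rateExp θ.α D) *
      Real.log ((Δ / 3) ^ (-rateExp θ.α D)) ^ rateExp θ.α D < 2 * ((n / K : ℕ) : ℝ) := by
    refine lt_of_mul_lt_mul_left (lt_of_le_of_lt (le_of_eq ?_) (hn1.trans_le
      (le_mul_two_mul_div hK0 hNb1)))
      (by linarith : (0 : ℝ) ≤ K)
    ring
  have hΔ2 : Δ ^ 2 ≤ 1 := pow_le_one₀ hΔ.le hΔ1.le
  have hΔ3 : Δ ^ 2 ≤ Δ := by nlinarith
  have he := hN₁ hNb2 hΔ hΔ1 hsize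
  set e := rateError θ D (1 + L) (n / K) with hedef
  have he0 : 0 ≤ e := rateError_nonneg θ D (by linarith) _
  have hece : cg * e ≤ c * (Δ / 3) ^ 2 := by
    have e1 := mul_le_mul_of_nonneg_left he hcg0.le
    have e2 := mul_le_mul_of_nonneg_right hc'1 (sq_nonneg Δ)
    linarith
  refine (measure_mono fun ω hω => ?_).trans_lt (hgood hreg hsamp hNb1 hδ hδ1
    (by nlinarith : cg * e ≤ 1))
  refine fun hall => hω fun x hx => ?_
  obtain ⟨hgapx, hsalx⟩ := hx
  have hx𝒳 := hgapx.1
  refine greedy_eq_of_gap hgapx hΔ (fun i => ?_) (fun j => hgreedy ω x hx𝒳 j)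
    (fun j => hπ x hx𝒳 j)
  have hcard := card_armSample X Y I i n ω
  have hpull := pulls_bounds (fun t ht => hsamp.least_pulled t ht ω) i
  have h1 := hest i ω x hx𝒳
  have h2 := hall i
  rw [← hcard] at hpull h1 h2
  obtain ⟨hp1, hp2⟩ := hpull
  have hN1 := hNb1.trans hp1
  -- For `p = 1` the estimator is the mode estimator, which needs no assumption on the slack or on
  -- the grid.
  rcases hp.eq_or_lt with rfl | hp'
  · obtain ⟨R, R₁, hset, hE1, hE2, hE3⟩ := hacc hreg hN1 (hm _) h2 (by positivity)
      le_rfl (by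
        have e1 : ((armSample X Y I i n ω).card : ℝ) ^ (-densityExp θ D) ≤
            ((n / K : ℕ) : ℝ) ^ (-densityExp θ D) :=
          Real.rpow_le_rpow_of_nonpos (by exact_mod_cast hNb1) (by exact_mod_cast hp1)
            (by linarith [densityExp_pos θ D])
        have e2 := rpow_le_rateError θ D (by linarith : 1 ≤ 1 + L) (n / K)
        refine e1.trans (e2.trans ?_)
        exact le_mul_of_one_le_left he0 hcg) (by linarith : 0 < Δ / 3) (by linarith) hece
      (hece.trans (by gcongr; linarith : c * (Δ / 3) ^ 2 ≤ c * Δ))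
    exact hset.abs_sub_value_le hΔ.le hsalx hE1 hE2 (by linarith) hE3
      (hset.isModeEstimate hx𝒳 (hε _) (betaWidth_nonneg hδK hδK1 _ _) h1)
  · have hN' := hN₁ (hNb2.trans hp1) hΔ hΔ1 (hsize.trans_le (by
      have : ((n / K : ℕ) : ℝ) ≤ (armSample X Y I i n ω).card := by exact_mod_cast hp1
      linarith))
    have hr0 := rateError_nonneg θ D (by linarith : 0 ≤ 1 + L) (armSample X Y I i n ω).card
    have h2r := rateError_le_two_mul θ D (by linarith : 0 ≤ 1 + L) hNb1 hp1 hp2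
    obtain ⟨R, R₁, ξ, rm, ρm, Q, e', τ, hset, hE⟩ := hpset hreg (hNb3.trans hp1) (hm _)
      (fun hα => hmN hp' hα _) h2 (by positivity) (by
        have := mul_le_mul_of_nonneg_left h2r hcg0.le
        linarith)
    have hE' := hE.trans (mul_le_mul_of_nonneg_left hN' hC.le)
    obtain ⟨T, hT, hTcard, hTgap⟩ := hsalx.2 i
    rw [hreg.modes_cond i hx𝒳] at hT hTcard hTgap
    rw [hreg.value_eq_of_gap hx𝒳 hT hTcard hΔ.le hTgap]
    refine hset.pModeEstimate_close hx𝒳 hp hT hTcard hTgap (Δ := Δ) ?_ (by linarith) ?_ rfl h1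
    · have := mul_le_mul_of_nonneg_right hc'3 (sq_nonneg Δ)
      linarith
    · have := mul_le_mul_of_nonneg_right hc'2 (sq_nonneg Δ)
      linarith

end ModalBandit

end

theorem mainTheorem9 (D : ℕ) (hD : 1 ≤ D) (θ : ModalBandit.Params) :
    -- Part 1: uniform `Δ`-optimality (the mode, i.e. `p = 1`).
    (∀ η : ℝ, 0 < η → ∃ (C : ℝ) (a : ℕ), 0 < C ∧
      ∀ (K : ℕ) (B : ModalBandit.Environment D K), ModalBandit.Regular B θ →
      B.𝒳 ⊆ B.salientRegion 1 η →
      ∀ (δ Δ : ℝ), 0 < δ → δ < 1 → 0 < Δ →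
      ∀ m : ℕ → ℕ, (∀ N, ModalBandit.kSetting θ.α D N ^ 2 ≤ m N) →
      ∀ n : ℕ,
        C * K * ((1 + Real.log (K / δ)) * (1 + |Real.log Δ|)) ^ a
          * Δ ^ (-ModalBandit.rateExp θ.α D) ≤ n →
      ∀ (Ω : Type*) [MeasurableSpace Ω] (P : Measure Ω) [IsProbabilityMeasure P]
        (X : ℕ → Ω → ModalBandit.Ctx D) (Y : Fin K → ℕ → Ω → ℝ) (I : ℕ → Ω → Fin K),
        ModalBandit.IsUniformSampling P B n X Y I →
      ∀ (est : Fin K → Ω → ModalBandit.Ctx D → ℝ) (πhat : Ω → ModalBandit.Ctx D → Fin K),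
        (∀ i ω, ∀ x ∈ B.𝒳, ModalBandit.IsModeEstimate (ModalBandit.armSample X Y I i n ω)
          (ModalBandit.kSetting θ.α D (ModalBandit.pulls I i n ω))
          (m (ModalBandit.pulls I i n ω)) x (est i ω x)) →
        ModalBandit.IsGreedyPolicy B.𝒳 est πhat →
        P {ω | ¬ ∀ x ∈ B.𝒳, B.IsDeltaOptimal 1 Δ (πhat ω x) x} < ENNReal.ofReal δ) ∧
    -- Part 2: exact recovery of the optimal policy for the `p`-mode on the region of gap and
    -- saliency more than `Δ`.
    (∀ (p : ℕ), 1 ≤ p → ∀ (ε : ℕ → ℝ), (∀ N, 0 < ε N) → Tendsto ε atTop (𝓝 0) →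
      (fun N : ℕ => 1 / Real.log N) =O[atTop] ε →
      ∀ (K : ℕ) (δ : ℝ), 0 < δ → δ < 1 → ∃ N₀ : ℕ,
      ∀ (B : ModalBandit.Environment D K), ModalBandit.Regular B θ →
      ∀ (Δ : ℝ), 0 < Δ →
      ∀ m : ℕ → ℕ, (∀ N, ModalBandit.kSetting θ.α D N ^ 2 ≤ m N) →
        (2 ≤ p → θ.α ≤ 1 / 4 → ∀ N, N ≤ m N) →
      ∀ n : ℕ,
        max (K * (Real.log (1 / δ) + Real.log K) ^ ModalBandit.rateExp θ.α D
            * (Δ / 3) ^ (-ModalBandit.rateExp θ.α D)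
            * Real.log ((Δ / 3) ^ (-ModalBandit.rateExp θ.α D)) ^ ModalBandit.rateExp θ.α D)
          ((K * N₀ : ℕ) : ℝ) < n →
      ∀ (Ω : Type*) [MeasurableSpace Ω] (P : Measure Ω) [IsProbabilityMeasure P]
        (X : ℕ → Ω → ModalBandit.Ctx D) (Y : Fin K → ℕ → Ω → ℝ) (I : ℕ → Ω → Fin K),
        ModalBandit.IsUniformSampling P B n X Y I →
      ∀ (est : Fin K → Ω → ModalBandit.Ctx D → ℝ) (πhat : Ω → ModalBandit.Ctx D → Fin K),
        (∀ i ω, ∀ x ∈ B.𝒳, ModalBandit.IsPModeEstimate (ModalBandit.armSample X Y I i n ω) p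
          (ModalBandit.kSetting θ.α D (ModalBandit.pulls I i n ω))
          (m (ModalBandit.pulls I i n ω)) (δ / K) (ε (ModalBandit.pulls I i n ω)) x
          (est i ω x)) →
        ModalBandit.IsGreedyPolicy B.𝒳 est πhat →
      ∀ π : ModalBandit.Ctx D → Fin K, B.IsOptimalPolicy p π →
        P {ω | ¬ ∀ x ∈ B.gapRegion p Δ ∩ B.salientRegion p Δ, πhat ω x = π x}
          < ENNReal.ofReal δ) := by
  refine ⟨fun η hη => ModalBandit.exists_deltaOptimal_const D θ hη, ?_⟩
  intro p hp ε hε hε0 hεlog K δ hδ hδ1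
  exact ModalBandit.exists_recovery_threshold D hD θ p hp ε hε hε0 hεlog K δ hδ hδ1
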